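/- Let $B$ be a closed braid on $b\ge 1$ strands with writhe $w$, given by a braid word in $\sigma_1^{\pm1},\dots,\sigma_{b-1}^{\pm1}$, and let $K_1,\dots,K_m$ be its components. Its edges are the arcs into which the crossings cut $B$ (a circle without crossings is one edge); give the $l$-th edge a variable $X_l$ of degree $2$, where for $1\le l\le m$ the $l$-th edge lies on $K_l$, and let $M$ be the number of edges. For a crossing $c$ with incoming edges $i$ (left), $j$ (right) and outgoing edges $k$ (left), $l$ (right) put $\rho(c)=X_k+X_l-X_i-X_j$, $s_c=X_k-X_i$, $t_c=X_l-X_i$. Let $R(B)=\mathbb{Q}[X_1,\dots,X_M]/(\rho(c))_c$ and $R_r(B)=\mathbb{Q}[X_2-X_1,\dots,X_M-X_1]/(\rho(c))_c$, the ideals being generated by the $\rho(c)$ of all crossings. For $R=R(B)$, write $R\{i,j,k\}$ for the free $\mathbb{Z}^3$-graded module with generator in degree $(i,j,k)$, where $R$ acts through the first degree. To a positive crossing assign the commutative square of $R$-modules with upper row $R\{0,-2,0\}\xrightarrow{s_c}R\{0,0,0\}$, lower row $R\{2,-2,-2\}\xrightarrow{s_ct_c}R\{0,0,-2\}$, and upward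 vertical maps $t_c$ (left) and $1$ (right); to a negative crossing the square with upper row $R\{0,-2,2\}\xrightarrow{s_ct_c}R\{-2,0,2\}$, lower row $R\{0,-2,0\}\xrightarrow{s_c}R\{0,0,0\}$, and upward vertical maps $1$ (left) and $t_c$ (right). The double complex $(C_0(B),d_+,d_v)$, with $d_+$ horizontal and $d_v$ vertical, is the tensor product over $R(B)$ of the squares of all crossings, and $(C_r(B),d_+,d_v)$ is defined in the same way over $R_r(B)$. With $\{a_1,a_2,a_3\}$ denoting the upward shift of the degrees, let $$H(B)=H(H(C_0(B),d_+),d_v)\{-w+b,\,w+b-1,\,w-b+1\},\qquad H_r(B)=H(H(C_r(B),d_+),d_v)\{-w+b-1,\,w+b-1,\,w-b+1\}.$$ The variables $X_1,\dots,X_m$ of edges on $K_1,\dots,K_m$ (one edge chosen on each component) make $H(B)$ a $\mathbb{Z}^3$-graded module over $R_B=\mathbb{Q}[X_1,\dots,X_m]$ and $H_r(B)$ a $\mathbb{Z}^3$-graded module over $R_{B,r}=\mathbb{Q}[X_2-X_1,\dots,X_m-X_1]$. Let $\mathfrak m=(X_1,\dots,X_m)$, $\mathfrak m_r=(X_2-X_1,\dots,X_m-X_1)$,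 $H^{\star,j,k}=\bigoplus_i H^{i,j,k}$ and $H_r^{\star,j,k}=\bigoplus_i H_r^{i,j,k}$. Define, for $p\in\mathbb{Z}_{\ge0}$ and $q,j,k\in\mathbb{Z}$, $$\beta_B(p,q,j,k)=\dim_{\mathbb Q}\mathrm{Tor}^{R_B}_p(R_B/\mathfrak m,H^{\star,j,k}(B))^q,\qquad \beta_{B,r}(p,q,j,k)=\dim_{\mathbb Q}\mathrm{Tor}^{R_{B,r}}_p(R_{B,r}/\mathfrak m_r,H_r^{\star,j,k}(B))^q,$$ where the upper index $q$ denotes the homogeneous component of degree $q$. Finally let $$\mathcal P_B(x,y,a,b)=\sum_{p,q,j,k}\beta_B(p,q,j,k)\,x^p\,\frac{y^q}{(1-y^2)^m}\,a^j b^{\frac{k-j}2},\qquad \mathcal P_{B,r}(x,y,a,b)=\sum_{p,q,j,k}\beta_{B,r}(p,q,j,k)\,x^p\,\frac{y^q}{(1-y^2)^{m-1}}\,a^j b^{\frac{k-j}2},$$ where $1/(1-y^2)^n$ is expanded as a power series in $y$ (here $b$ is a formal variable). Lemma 1.6. Only finitely many of the numbers $\beta_B(p,q,j,k)$ and $\beta_{B,r}(p,q,j,k)$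 are non-zero, so that $\mathcal P_B$ and $\mathcal P_{B,r}$ are polynomials in $x$, and: 1. the projective dimension of $H(B)$ over $R_B$ equals the $x$-degree of $\mathcal P_B(x,y,a,b)$; 2. the projective dimension of $H_r(B)$ over $R_{B,r}$ equals the $x$-degree of $\mathcal P_{B,r}(x,y,a,b)$. (The zero module has projective dimension $-\infty$ and the zero polynomial has degree $-\infty$.) -/

import Mathlib

open scoped TensorProduct

noncomputable section

namespace HOMFLYPT

/-! ## Graded modules, graded Tor and Betti numbers -/

/-- An `R`-module (with its underlying rational vector space) together with a family of rational
subspaces, the homogeneous components `piece i`, `i ∈ ℤ`. -/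
structure GrMod (R : Type) [CommRing R] [Algebra ℚ R] where
  carrier : Type
  [addCommGroup : AddCommGroup carrier]
  [module : Module R carrier]
  [moduleRat : Module ℚ carrier]
  [tower : IsScalarTower ℚ R carrier]
  piece : ℤ → Submodule ℚ carrier

attribute [instance] GrMod.addCommGroup GrMod.module GrMod.moduleRat GrMod.tower

namespace GrMod

variable {R : Type} [CommRing R] [Algebra ℚ R]

/-- The non-zero homogeneous elements of `M`, recorded with their degrees. -/
abbrev Gen (M : GrMod R) : Type :=
  {x : ℤ × M.carrier // x.2 ∈ M.piece x.1 ∧ x.2 ≠ 0}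

/-- The graded free module with one basis element `[x]` of degree `deg x` for every non-zero
homogeneous element `x` of `M`; `𝓡` is the grading of the base ring. -/
def free (𝓡 : ℤ → Submodule ℚ R) (M : GrMod R) : GrMod R where
  carrier := M.Gen →₀ R
  piece i :=
    { carrier := {f | ∀ x : M.Gen, f x ∈ 𝓡 (i - x.1.1)}
      add_mem' := fun hf hg x => Submodule.add_mem _ (hf x) (hg x)
      zero_mem' := fun _ => Submodule.zero_mem _
      smul_mem' := fun q _ hf x => Submodule.smul_mem _ q (hf x) }

/-- The canonical cover of `M` by a graded free module, `[x] ↦ x`. -/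
def cover (𝓡 : ℤ → Submodule ℚ R) (M : GrMod R) : (M.free 𝓡).carrier →ₗ[R] M.carrier :=
  Finsupp.linearCombination R (fun x : M.Gen => x.1.2)

/-- The kernel of the canonical cover, graded as a submodule of the free module. -/
def syz (𝓡 : ℤ → Submodule ℚ R) (M : GrMod R) : GrMod R where
  carrier := LinearMap.ker (M.cover 𝓡)
  piece i := ((M.free 𝓡).piece i).comap
    ((LinearMap.ker (M.cover 𝓡)).subtype.restrictScalars ℚ)

/-- The iterated kernels of canonical covers. -/
def syzIter (𝓡 : ℤ → Submodule ℚ R) (M : GrMod R) : ℕ → GrMod R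
  | 0 => M
  | p + 1 => (syzIter 𝓡 M p).syz 𝓡

/-- The `p`-th module `F_p` of the canonical graded free resolution of `M`. -/
def res (𝓡 : ℤ → Submodule ℚ R) (M : GrMod R) (p : ℕ) : GrMod R :=
  (syzIter 𝓡 M p).free 𝓡

/-- The differential `F_{p+1} → F_p` of the canonical graded free resolution of `M`: the cover of
the kernel of `F_p → F_{p-1}` (of `F_0 → M` if `p = 0`), followed by the inclusion. -/
def resD (𝓡 : ℤ → Submodule ℚ R) (M : GrMod R) (p : ℕ) :
    (M.res 𝓡 (p + 1)).carrier →ₗ[R] (M.res 𝓡 p).carrier :=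
  (LinearMap.ker ((syzIter 𝓡 M p).cover 𝓡)).subtype ∘ₗ
    ((syzIter 𝓡 M p).syz 𝓡).cover 𝓡

/-- The homogeneous component of degree `q` of `A ⊗ M`, spanned by the `a ⊗ x` with `a` and `x`
homogeneous and `deg a + deg x = q`. -/
def tensorPiece (A M : GrMod R) (q : ℤ) : Submodule ℚ (A.carrier ⊗[R] M.carrier) :=
  Submodule.span ℚ {z | ∃ i : ℤ, ∃ a ∈ A.piece i, ∃ x ∈ M.piece (q - i), z = a ⊗ₜ[R] x}

/-- The `p`-cycles of the complex `A ⊗ F_•`. -/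
def torCycles (𝓡 : ℤ → Submodule ℚ R) (A M : GrMod R) :
    (p : ℕ) → Submodule R (A.carrier ⊗[R] (M.res 𝓡 p).carrier)
  | 0 => ⊤
  | p + 1 => LinearMap.ker ((M.resD 𝓡 p).lTensor A.carrier)

/-- The `p`-boundaries of the complex `A ⊗ F_•`. -/
def torBoundaries (𝓡 : ℤ → Submodule ℚ R) (A M : GrMod R) (p : ℕ) :
    Submodule R (A.carrier ⊗[R] (M.res 𝓡 p).carrier) :=
  LinearMap.range ((M.resD 𝓡 p).lTensor A.carrier)

/-- `Tor_p(A, M)`, the `p`-th homology of `A ⊗ F_•` for the canonical graded free resolution `F_•`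
of `M`, with the grading induced by those of `A` and of `F_p`. -/
def tor (𝓡 : ℤ → Submodule ℚ R) (A M : GrMod R) (p : ℕ) : GrMod R where
  carrier := torCycles 𝓡 A M p ⧸ (torBoundaries 𝓡 A M p).submoduleOf (torCycles 𝓡 A M p)
  piece q := ((tensorPiece A (M.res 𝓡 p) q).comap
      ((torCycles 𝓡 A M p).subtype.restrictScalars ℚ)).map
    (((torBoundaries 𝓡 A M p).submoduleOf (torCycles 𝓡 A M p)).mkQ.restrictScalars ℚ)

/-- The cyclic graded module `R / I`. -/
def quot (𝓡 : ℤ → Submodule ℚ R) (I : Ideal R) : GrMod R where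
  carrier := R ⧸ I
  piece i := (𝓡 i).map (Ideal.Quotient.mkₐ ℚ I).toLinearMap

/-- The Betti number `dim_ℚ Tor_p(R/𝔪, M)^q`. -/
def betti (𝓡 : ℤ → Submodule ℚ R) (𝔪 : Ideal R) (M : GrMod R) (p : ℕ) (q : ℤ) : ℕ :=
  Module.finrank ℚ ((tor 𝓡 (quot 𝓡 𝔪) M p).piece q)

end GrMod

/-! ## Homology of an endomorphism of square zero -/

section Homology

variable {A : Type} [CommRing A] {M : Type} [AddCommGroup M] [Module A M]

/-- The homology `ker d / im d` of a differential `d`. -/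
abbrev Hlgy (d : M →ₗ[A] M) : Type :=
  LinearMap.ker d ⧸ (LinearMap.range d).submoduleOf (LinearMap.ker d)

/-- The classes in `ker d / im d` of the cycles that lie in `N`. -/
def hlgySub {S : Type} [CommRing S] [Algebra S A] [Module S M] [IsScalarTower S A M]
    (d : M →ₗ[A] M) (N : Submodule S M) : Submodule S (Hlgy d) :=
  (N.comap ((LinearMap.ker d).subtype.restrictScalars S)).map
    (((LinearMap.range d).submoduleOf (LinearMap.ker d)).mkQ.restrictScalars S)

/-- The map induced on the homology of `d` by a map `e` that commutes with `d`. -/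
def hlgyMap (d e : M →ₗ[A] M) (h : ∀ x, d (e x) = e (d x)) : Hlgy d →ₗ[A] Hlgy d :=
  Submodule.mapQ _ _
    (e.restrict (p := LinearMap.ker d) (q := LinearMap.ker d) (fun x hx => by
      rw [LinearMap.mem_ker] at hx ⊢
      rw [h, hx, map_zero]))
    (by
      rintro ⟨x, hx⟩ ⟨y, hy⟩
      exact ⟨e y, by rw [h, hy]; rfl⟩)

end Homology

/-! ## The double complex of a family of crossings -/

/-- The data from which the double complex is built: an algebra `A`, and for each of `n` crossings
its sign and two elements of `A`. For a crossing with incoming edges `i` (left), `j` (right) and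
outgoing edges `k` (left), `l` (right) these are `s = X_k - X_i` and `t = X_l - X_i`. -/
structure CubeData (A : Type) where
  n : ℕ
  positive : Fin n → Bool
  s : Fin n → A
  t : Fin n → A

/-- The summands of the tensor product over all crossings of the four-term squares. The first
component is the horizontal position at each crossing (`false` is left, `true` is right), the second
one is the vertical position (`false` is the lower row, `true` is the upper row). -/
abbrev Vertex (n : ℕ) : Type := (Fin n → Bool) × (Fin n → Bool)

namespace CubeData

/-! The square of a positive crossing is
```
  A{0,-2,0}   --- s -->   A{0,0,0}
     ^                       ^
     | t                     | 1
  A{2,-2,-2}  -- s t -->  A{0,0,-2}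
```
and the square of a negative crossing is
```
  A{0,-2,2}   -- s t -->  A{-2,0,2}
     ^                       ^
     | 1                     | t
  A{0,-2,0}   --- s -->   A{0,0,0}
```
where `A{a,b,c}` has its generator `1` in degree `(a,b,c)`. -/

variable {A : Type} [CommRing A]

/-- The horizontal map of the square of the crossing `c`, in the row `v`. -/
def horCoef (D : CubeData A) (c : Fin D.n) (v : Bool) : A :=
  if v = D.positive c then D.s c else D.s c * D.t c

/-- The vertical map of the square of the crossing `c`, in the column `h`. -/
def verCoef (D : CubeData A) (c : Fin D.n) (h : Bool) : A :=
  if h = D.positive c then 1 else D.t c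

/-- First degree of the generator. -/
def deg₁ (D : CubeData A) (x : Vertex D.n) : ℤ :=
  ∑ c, if D.positive c then (if x.1 c = false ∧ x.2 c = false then 2 else 0)
    else (if x.1 c = true ∧ x.2 c = true then -2 else 0)

/-- Second (horizontal) degree of the generator. -/
def deg₂ (D : CubeData A) (x : Vertex D.n) : ℤ :=
  ∑ c, if x.1 c then 0 else -2

/-- Third (vertical) degree of the generator. -/
def deg₃ (D : CubeData A) (x : Vertex D.n) : ℤ :=
  ∑ c, if D.positive c then (if x.2 c then 0 else -2) else (if x.2 c then 2 else 0)

/-- The free `A`-module with one generator per vertex: the tensor product over `A` of the squares of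
all crossings. -/
abbrev Cx (D : CubeData A) : Type := Vertex D.n → A

/-- The usual sign in a tensor product of complexes. -/
def sgn (D : CubeData A) (u : Fin D.n → Bool) (c : Fin D.n) : A :=
  (-1) ^ (Finset.univ.filter (fun c' => c' < c ∧ u c' = true)).card

/-- The horizontal differential `d_+`. -/
def dPlus (D : CubeData A) : D.Cx →ₗ[A] D.Cx where
  toFun f x := ∑ c, if x.1 c then
    D.sgn x.1 c * D.horCoef c (x.2 c) * f (Function.update x.1 c false, x.2) else 0
  map_add' f g := by
    funext x
    simp only [Pi.add_apply, ← Finset.sum_add_distrib]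
    refine Finset.sum_congr rfl fun c _ => ?_
    split_ifs <;> ring
  map_smul' a f := by
    funext x
    simp only [Pi.smul_apply, smul_eq_mul, Finset.mul_sum, RingHom.id_apply]
    refine Finset.sum_congr rfl fun c _ => ?_
    split_ifs <;> ring

/-- The vertical differential `d_v`. -/
def dV (D : CubeData A) : D.Cx →ₗ[A] D.Cx where
  toFun f x := ∑ c, if x.2 c then
    D.sgn x.2 c * D.verCoef c (x.1 c) * f (x.1, Function.update x.2 c false) else 0
  map_add' f g := by
    funext x
    simp only [Pi.add_apply, ← Finset.sum_add_distrib]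
    refine Finset.sum_congr rfl fun c _ => ?_
    split_ifs <;> ring
  map_smul' a f := by
    funext x
    simp only [Pi.smul_apply, smul_eq_mul, Finset.mul_sum, RingHom.id_apply]
    refine Finset.sum_congr rfl fun c _ => ?_
    split_ifs <;> ring

theorem dPlus_dV (D : CubeData A) (f : D.Cx) : D.dPlus (D.dV f) = D.dV (D.dPlus f) := by
  funext x
  have h1 : D.dPlus (D.dV f) x = ∑ c, ∑ c', if x.1 c then (if x.2 c' then
      D.sgn x.1 c * D.horCoef c (x.2 c) * (D.sgn x.2 c' *
        D.verCoef c' (Function.update x.1 c false c') *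
        f (Function.update x.1 c false, Function.update x.2 c' false)) else 0) else 0 := by
    simp only [dPlus, dV, LinearMap.coe_mk, AddHom.coe_mk]
    refine Finset.sum_congr rfl fun c _ => ?_
    split_ifs
    · rw [Finset.mul_sum]
      refine Finset.sum_congr rfl fun c' _ => ?_
      split_ifs <;> ring
    · simp
  have h2 : D.dV (D.dPlus f) x = ∑ c', ∑ c, if x.1 c then (if x.2 c' then
      D.sgn x.2 c' * D.verCoef c' (x.1 c') * (D.sgn x.1 c *
        D.horCoef c (Function.update x.2 c' false c) *
        f (Function.update x.1 c false, Function.update x.2 c' false)) else 0) else 0 := by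
    simp only [dPlus, dV, LinearMap.coe_mk, AddHom.coe_mk]
    refine Finset.sum_congr rfl fun c' _ => ?_
    split_ifs
    · rw [Finset.mul_sum]
      refine Finset.sum_congr rfl fun c _ => ?_
      split_ifs <;> ring
    · simp
  rw [h1, h2, Finset.sum_comm]
  refine Finset.sum_congr rfl fun c' _ => Finset.sum_congr rfl fun c _ => ?_
  by_cases hc : x.1 c = true
  · by_cases hc' : x.2 c' = true
    · simp only [hc, hc', if_true]
      by_cases h : c = c'
      · subst h
        simp only [Function.update_self, hc, hc', horCoef, verCoef]
        cases D.positive c <;> simp <;> ring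
      · rw [Function.update_of_ne h, Function.update_of_ne (Ne.symm h)]
        ring
    · simp [hc']
  · simp [hc]

/-- `H(H(C, d_+), d_v)`. -/
abbrev HH (D : CubeData A) : Type := Hlgy (hlgyMap D.dPlus D.dV D.dPlus_dV)

/-- The part of the double complex of second and third degree `(j, k)`. -/
def cxPart (D : CubeData A) (j k : ℤ) : Submodule A D.Cx where
  carrier := {f | ∀ x, ¬ (D.deg₂ x = j ∧ D.deg₃ x = k) → f x = 0}
  add_mem' hf hg x hx := by rw [Pi.add_apply, hf x hx, hg x hx, add_zero]
  zero_mem' _ _ := rfl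
  smul_mem' a f hf x hx := by rw [Pi.smul_apply, hf x hx, smul_zero]

/-- The part `H^{⋆,j,k}` of `H(H(C, d_+), d_v)` of second and third degree `(j, k)`. -/
def hhPart (D : CubeData A) (j k : ℤ) : Submodule A D.HH :=
  hlgySub _ (hlgySub D.dPlus (D.cxPart j k))

variable [Algebra ℚ A]

/-- The homogeneous component of degree `(i, j, k)` of the double complex; `𝒜` is the grading
of `A`. -/
def cxPiece (D : CubeData A) (𝒜 : ℤ → Submodule ℚ A) (i j k : ℤ) : Submodule ℚ D.Cx where
  carrier := {f | f ∈ D.cxPart j k ∧ ∀ x, f x ∈ 𝒜 (i - D.deg₁ x)}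
  add_mem' hf hg := ⟨Submodule.add_mem _ hf.1 hg.1, fun x => Submodule.add_mem _ (hf.2 x) (hg.2 x)⟩
  zero_mem' := ⟨Submodule.zero_mem _, fun _ => Submodule.zero_mem _⟩
  smul_mem' q _ hf := ⟨Submodule.smul_of_tower_mem _ q hf.1,
    fun x => Submodule.smul_mem _ q (hf.2 x)⟩

/-- The homogeneous component of degree `(i, j, k)` of `H(H(C, d_+), d_v)`. -/
def hhPiece (D : CubeData A) (𝒜 : ℤ → Submodule ℚ A) (i j k : ℤ) : Submodule ℚ D.HH :=
  hlgySub _ (hlgySub D.dPlus (D.cxPiece 𝒜 i j k))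

/-- `H(H(C, d_+), d_v)` as a module over `R` through `φ : R → A`. -/
def total {R : Type} [CommRing R] [Algebra ℚ R] (D : CubeData A) (φ : R →ₐ[ℚ] A) :
    ModuleCat R :=
  (ModuleCat.restrictScalars φ.toRingHom).obj (ModuleCat.of A D.HH)

/-- The graded `R`-module `H^{⋆,j,k}` for `H = H(H(C, d_+), d_v){a₁, a₂, a₃}`, where `R` acts through
`φ : R → A`. The shift is `H{a₁, a₂, a₃}^{i,j,k} = H^{i - a₁, j - a₂, k - a₃}`. -/
def graded {R : Type} [CommRing R] [Algebra ℚ R] (D : CubeData A) (𝒜 : ℤ → Submodule ℚ A)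
    (φ : R →ₐ[ℚ] A) (a : ℤ × ℤ × ℤ) (j k : ℤ) : GrMod R :=
  letI : Module R (D.hhPart (j - a.2.1) (k - a.2.2)) := Module.compHom _ φ.toRingHom
  { carrier := D.hhPart (j - a.2.1) (k - a.2.2)
    tower := ⟨fun q r x => by
      change φ (q • r) • x = q • (φ r • x)
      rw [map_smul, smul_assoc]⟩
    piece := fun i => (D.hhPiece 𝒜 (i - a.1) (j - a.2.1) (k - a.2.2)).comap
      ((D.hhPart (j - a.2.1) (k - a.2.2)).subtype.restrictScalars ℚ) }

end CubeData

/-! ## Polynomial rings with variables of degree two -/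

/-- The component of degree `i` of `ℚ[X_c]`, where every variable has degree `2`. -/
def polyPiece (σ : Type) (i : ℤ) : Submodule ℚ (MvPolynomial σ ℚ) :=
  MvPolynomial.weightedHomogeneousSubmodule ℚ (fun _ => (2 : ℤ)) i

/-- The subalgebra of `ℚ[X_c]` generated by all differences `X_c - X_d`. For variables
`X_1, …, X_m` it is `ℚ[X_2 - X_1, …, X_m - X_1]`. -/
def redPoly (σ : Type) : Subalgebra ℚ (MvPolynomial σ ℚ) :=
  Algebra.adjoin ℚ {f | ∃ c d, f = MvPolynomial.X c - MvPolynomial.X d}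

/-- The difference `X_c - X_d` as an element of `redPoly σ`. -/
def redPoly.diff {σ : Type} (c d : σ) : redPoly σ :=
  ⟨MvPolynomial.X c - MvPolynomial.X d, Algebra.subset_adjoin ⟨c, d, rfl⟩⟩

/-- The component of degree `i` of `redPoly σ`. -/
def redPolyPiece (σ : Type) (i : ℤ) : Submodule ℚ (redPoly σ) :=
  (polyPiece σ i).comap (redPoly σ).val.toLinearMap

theorem rename_mem_redPoly {σ τ : Type} (e : σ → τ) (f : redPoly σ) :
    MvPolynomial.rename e (f : MvPolynomial σ ℚ) ∈ redPoly τ := by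
  have h : redPoly σ ≤ (redPoly τ).comap (MvPolynomial.rename e) := by
    refine Algebra.adjoin_le ?_
    rintro _ ⟨c, d, rfl⟩
    change MvPolynomial.rename e _ ∈ redPoly τ
    rw [map_sub, MvPolynomial.rename_X, MvPolynomial.rename_X]
    exact Algebra.subset_adjoin ⟨e c, e d, rfl⟩
  exact h f.2

/-- The map `X_c - X_d ↦ X_{e c} - X_{e d}`. -/
def redRename {σ τ : Type} (e : σ → τ) : redPoly σ →ₐ[ℚ] redPoly τ :=
  ((MvPolynomial.rename e).comp (redPoly σ).val).codRestrict (redPoly τ)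
    (fun f => rename_mem_redPoly e f)

/-! ## Closed braids -/

/-- A closed braid with `r + 1` strands, given by a braid word: the letter `(k, true)` is the
generator `σ_k`, a positive crossing of the strands in the positions `k` and `k + 1` (counted
from `0`), and `(k, false)` is its inverse. -/
structure ClosedBraid where
  r : ℕ
  word : List (Fin r × Bool)

namespace ClosedBraid

/-- The number of strands. -/
def strands (B : ClosedBraid) : ℕ := B.r + 1

/-- The crossings, in their order along the braid. -/
abbrev Crossing (B : ClosedBraid) : Type := Fin B.word.length

/-- The left one of the two positions at a crossing. -/
def left (B : ClosedBraid) (c : B.Crossing) : Fin (B.r + 1) := (B.word.get c).1.castSucc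

/-- The right one of the two positions at a crossing. -/
def right (B : ClosedBraid) (c : B.Crossing) : Fin (B.r + 1) := (B.word.get c).1.succ

/-- Whether a crossing is positive. -/
def positive (B : ClosedBraid) (c : B.Crossing) : Bool := (B.word.get c).2

/-- The writhe. -/
def writhe (B : ClosedBraid) : ℤ := ∑ c, if B.positive c then 1 else -1

/-- The points of the closed braid at position `i` on level `t`; the crossing `c` lies between the
levels `c` and `c + 1`, and the last level is glued to the level `0`. -/
abbrev Point (B : ClosedBraid) : Type := Fin (B.word.length + 1) × Fin (B.r + 1)

/-- Two points that are joined by a piece of the braid that contains no crossing. -/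
inductive EdgeRel (B : ClosedBraid) : B.Point → B.Point → Prop
  | pass (c : B.Crossing) (i : Fin (B.r + 1)) (hl : i ≠ B.left c) (hr : i ≠ B.right c) :
      EdgeRel B (c.castSucc, i) (c.succ, i)
  | close (i : Fin (B.r + 1)) : EdgeRel B (Fin.last _, i) (0, i)

/-- Two points that are joined by a piece of the braid, which may run through a crossing. -/
inductive StrandRel (B : ClosedBraid) : B.Point → B.Point → Prop
  | step (c : B.Crossing) (i : Fin (B.r + 1)) :
      StrandRel B (c.castSucc, i) (c.succ, Equiv.swap (B.left c) (B.right c) i)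
  | close (i : Fin (B.r + 1)) : StrandRel B (Fin.last _, i) (0, i)

/-- The edges: the arcs into which the crossings cut the closed braid. A circle without crossings is
one edge. -/
abbrev Edge (B : ClosedBraid) : Type := Quot B.EdgeRel

/-- The components of the closed braid. -/
abbrev Comp (B : ClosedBraid) : Type := Quot B.StrandRel

/-- The component that contains a given edge. -/
def compOf (B : ClosedBraid) : B.Edge → B.Comp :=
  Quot.map id (by
    rintro _ _ (⟨c, i, hl, hr⟩ | ⟨i⟩)
    · have h := StrandRel.step (B := B) c i
      rwa [Equiv.swap_apply_of_ne_of_ne hl hr] at h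
    · exact StrandRel.close i)

/-- A choice of one edge on each component. -/
abbrev Marking (B : ClosedBraid) : Type := {e : B.Comp → B.Edge // ∀ K, B.compOf (e K) = K}

/-- The number of components. -/
def numComp (B : ClosedBraid) : ℕ := Nat.card B.Comp

/-- The incoming left edge at a crossing. -/
def inL (B : ClosedBraid) (c : B.Crossing) : B.Edge := Quot.mk _ (c.castSucc, B.left c)

/-- The incoming right edge at a crossing. -/
def inR (B : ClosedBraid) (c : B.Crossing) : B.Edge := Quot.mk _ (c.castSucc, B.right c)

/-- The outgoing left edge at a crossing. -/
def outL (B : ClosedBraid) (c : B.Crossing) : B.Edge := Quot.mk _ (c.succ, B.left c)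

/-- The outgoing right edge at a crossing. -/
def outR (B : ClosedBraid) (c : B.Crossing) : B.Edge := Quot.mk _ (c.succ, B.right c)

/-- The relation `ρ(c) = X_k + X_l - X_i - X_j` of a crossing with outgoing edges `k, l` and incoming
edges `i, j`. -/
def rho (B : ClosedBraid) (c : B.Crossing) : MvPolynomial B.Edge ℚ :=
  MvPolynomial.X (B.outL c) + MvPolynomial.X (B.outR c) -
    MvPolynomial.X (B.inL c) - MvPolynomial.X (B.inR c)

/-! ### The middle HOMFLYPT homology -/

/-- The ideal of the relations of all crossings. -/
def edgeIdeal (B : ClosedBraid) : Ideal (MvPolynomial B.Edge ℚ) :=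
  Ideal.span (Set.range B.rho)

/-- The edge ring `R(B)`. -/
abbrev EdgeRing (B : ClosedBraid) : Type := MvPolynomial B.Edge ℚ ⧸ B.edgeIdeal

/-- The grading of `R(B)`. -/
def edgePiece (B : ClosedBraid) (i : ℤ) : Submodule ℚ B.EdgeRing :=
  (polyPiece B.Edge i).map (Ideal.Quotient.mkₐ ℚ B.edgeIdeal).toLinearMap

/-- The data of the middle complex `C_0(B)` over `R(B)`. -/
def cube (B : ClosedBraid) : CubeData B.EdgeRing where
  n := B.word.length
  positive := B.positive
  s c := Ideal.Quotient.mk _ (MvPolynomial.X (B.outL c) - MvPolynomial.X (B.inL c))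
  t c := Ideal.Quotient.mk _ (MvPolynomial.X (B.outR c) - MvPolynomial.X (B.inL c))

/-- `R_B = ℚ[X_1, …, X_m]`, with one variable for each component. -/
abbrev RB (B : ClosedBraid) : Type := MvPolynomial B.Comp ℚ

/-- The ideal `𝔪 = (X_1, …, X_m)` of `R_B`. -/
def mB (B : ClosedBraid) : Ideal B.RB := Ideal.span (Set.range MvPolynomial.X)

/-- The map `R_B → R(B)` that sends the variable of a component to that of its marked edge. -/
def toEdge (B : ClosedBraid) (e : B.Marking) : B.RB →ₐ[ℚ] B.EdgeRing :=
  (Ideal.Quotient.mkₐ ℚ B.edgeIdeal).comp (MvPolynomial.rename e.1)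

/-- The middle HOMFLYPT homology `H(B)` as an `R_B`-module: the variable of a component acts as the
variable of the marked edge on it. -/
def H (B : ClosedBraid) (e : B.Marking) : ModuleCat B.RB := B.cube.total (B.toEdge e)

/-- The graded `R_B`-module `H^{⋆,j,k}(B)`, with the shift `{-w+b, w+b-1, w-b+1}`. -/
def Hgr (B : ClosedBraid) (e : B.Marking) (j k : ℤ) : GrMod B.RB :=
  B.cube.graded B.edgePiece (B.toEdge e)
    (-B.writhe + B.strands, B.writhe + B.strands - 1, B.writhe - B.strands + 1) j k

/-- The Betti numbers `β_B(p,q,j,k)` of `H(B)`. -/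
def beta (B : ClosedBraid) (e : B.Marking) (p : ℕ) (q j k : ℤ) : ℕ :=
  (B.Hgr e j k).betti (polyPiece B.Comp) B.mB p q

/-! ### The reduction with respect to one component -/

/-- The ideal of the relations of all crossings in `ℚ[X_2 - X_1, …, X_M - X_1]`. -/
def redEdgeIdeal (B : ClosedBraid) : Ideal (redPoly B.Edge) :=
  Ideal.span {f | ∃ c, (f : MvPolynomial B.Edge ℚ) = B.rho c}

/-- The reduced edge ring `R_r(B)`. -/
abbrev RedEdgeRing (B : ClosedBraid) : Type := redPoly B.Edge ⧸ B.redEdgeIdeal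

/-- The grading of `R_r(B)`. -/
def redEdgePiece (B : ClosedBraid) (i : ℤ) : Submodule ℚ B.RedEdgeRing :=
  (redPolyPiece B.Edge i).map (Ideal.Quotient.mkₐ ℚ B.redEdgeIdeal).toLinearMap

/-- The data of the reduced complex `C_r(B)` over `R_r(B)`. -/
def redCube (B : ClosedBraid) : CubeData B.RedEdgeRing where
  n := B.word.length
  positive := B.positive
  s c := Ideal.Quotient.mk _ (redPoly.diff (B.outL c) (B.inL c))
  t c := Ideal.Quotient.mk _ (redPoly.diff (B.outR c) (B.inL c))

/-- `R_{B,r} = ℚ[X_2 - X_1, …, X_m - X_1]`. -/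
abbrev RBr (B : ClosedBraid) : Type := redPoly B.Comp

/-- The ideal `𝔪_r = (X_2 - X_1, …, X_m - X_1)` of `R_{B,r}`. -/
def mBr (B : ClosedBraid) : Ideal B.RBr := Ideal.span {f | ∃ c d, f = redPoly.diff c d}

/-- The map `R_{B,r} → R_r(B)` given by the marked edges. -/
def toRedEdge (B : ClosedBraid) (e : B.Marking) : B.RBr →ₐ[ℚ] B.RedEdgeRing :=
  (Ideal.Quotient.mkₐ ℚ B.redEdgeIdeal).comp (redRename e.1)

/-- The reduction `H_r(B)` as an `R_{B,r}`-module. -/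
def Hr (B : ClosedBraid) (e : B.Marking) : ModuleCat B.RBr := B.redCube.total (B.toRedEdge e)

/-- The graded `R_{B,r}`-module `H_r^{⋆,j,k}(B)`, with the shift `{-w+b-1, w+b-1, w-b+1}`. -/
def Hrgr (B : ClosedBraid) (e : B.Marking) (j k : ℤ) : GrMod B.RBr :=
  B.redCube.graded B.redEdgePiece (B.toRedEdge e)
    (-B.writhe + B.strands - 1, B.writhe + B.strands - 1, B.writhe - B.strands + 1) j k

/-- The Betti numbers `β_{B,r}(p,q,j,k)` of `H_r(B)`. -/
def betaR (B : ClosedBraid) (e : B.Marking) (p : ℕ) (q j k : ℤ) : ℕ :=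
  (B.Hrgr e j k).betti (redPolyPiece B.Comp) B.mBr p q

end ClosedBraid

/-! ## The Betti polynomials -/

/-- The normalized binomial numbers. -/
def bn (n k : ℤ) : ℕ :=
  if 0 ≤ k ∧ k ≤ n then n.toNat.choose k.toNat else if n = -1 ∧ k = 0 then 1 else 0

/-- The coefficients of powers of `x`: Laurent series in `y` over finite sums of `a^j b^l`, with
`j ∈ ℤ` and `l ∈ ℚ`. -/
abbrev CoeffRing : Type := LaurentSeries (AddMonoidAlgebra ℤ (ℤ × ℚ))

/-- The series `∑ i, bn (i + m - 1) i * y ^ (2 * i)`, which is `1 / (1 - y ^ 2) ^ m`. -/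
def ySeries (m : ℤ) : CoeffRing :=
  HahnSeries.ofPowerSeries ℤ _
    (PowerSeries.mk fun d => if Even d then (bn ((d / 2 : ℕ) + m - 1) (d / 2 : ℕ) : _) else 0)

/-- The coefficient `y^q (∑ i, bn (i + m - 1) i * y ^ (2 * i)) a^j b^((k-j)/2)`. -/
def bettiTerm (m q j k : ℤ) : CoeffRing :=
  HahnSeries.single q (AddMonoidAlgebra.single (j, ((k - j : ℤ) : ℚ) / 2) 1) * ySeries m

/-- The polynomial in `x` with the coefficients above, weighted by the numbers `β p q j k`. -/
def bettiPoly (β : ℕ → ℤ → ℤ → ℤ → ℕ) (m : ℤ) : Polynomial CoeffRing :=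
  ∑ᶠ u : ℕ × ℤ × ℤ × ℤ, β u.1 u.2.1 u.2.2.1 u.2.2.2 •
    Polynomial.monomial u.1 (bettiTerm m u.2.1 u.2.2.1 u.2.2.2)

namespace ClosedBraid

/-- The polynomial `P_B(x,y,a,b)`. -/
def P (B : ClosedBraid) (e : B.Marking) : Polynomial CoeffRing :=
  bettiPoly (B.beta e) B.numComp

/-- The polynomial `P_{B,r}(x,y,a,b)`. -/
def Pr (B : ClosedBraid) (e : B.Marking) : Polynomial CoeffRing :=
  bettiPoly (B.betaR e) (B.numComp - 1)

end ClosedBraid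

/-- The degree of a polynomial in `x`, where the zero polynomial has degree `-∞`. -/
def degX (P : Polynomial CoeffRing) : WithBot ℕ∞ := P.degree.map (fun n : ℕ => (n : ℕ∞))

end HOMFLYPT

end

/-! Write R for `R_B` or `R_{B,r}`, 𝔪 for its ideal, A for the corresponding edge ring and M for a
part H^{⋆,j,k}. Then R is a polynomial ring over ℚ, in the reduced case in the differences to one
fixed variable. The proof compares two equivalences: the coefficient of x^p in the Betti polynomial
vanishes iff Tor_p(R/𝔪, M) = 0 for all parts M, and Tor_p(R/𝔪, M) = 0 iff M has projective dimension
less than p.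

Finite generation of M over R. Over the noetherian ring A it is clear, because the double complex is
free of finite rank. The vertical map of the square of a crossing c has an inverse up to t_c. This
inverse commutes with d_+ and is a null-homotopy of t_c for d_v (`dV_verHtpy`), so t_c kills the
iterated homology (`t_smul_HH`). Together with ρ(c) = 0 this identifies the two edges of each strand
through c. All edges of a component therefore act alike, and A acts through R
(`exists_toEdge_smul_eq`, `exists_toRedEdge_smul_eq`).

Tor and projective dimension. Tor is computed from the canonical resolution, whose syzygies need not
be finitely generated. Nakayama's lemma for graded modules that are bounded below needs no
finiteness (`nakayama`). It shows that Tor_1(R/𝔪, N) = 0 makes a graded module N projective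
(`projective_of_lTensor_injective`); dimension shifting gives the criterion for every p
(`subsingleton_tor_iff_hasProjectiveDimensionLT`).

Finiteness. The syzygies are still retracts of projectives modulo finitely generated submodules
(`IsFGRetract`), which makes each Tor_p(R/𝔪, M) finite-dimensional (`finite_tor`) and leaves
finitely many q. Hilbert's syzygy theorem bounds p, and the finitely many vertices of the cube bound
(j, k).

Conclusion. The total homology is the direct sum of its finitely many parts, so its projective
dimension is determined by theirs (`total_hasProjectiveDimensionLT_iff`). Terms of the Betti
polynomial do not cancel, since all their coefficients are non-negative and each term has a
coefficient 1 (`bettiPoly_coeff_eq_zero_iff`). -/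

noncomputable section

namespace HOMFLYPT

/-! ## Gradings by submodules -/

section Grading

variable {ι S M M' : Type} [CommRing S] [AddCommGroup M] [Module S M]
  [AddCommGroup M'] [Module S M']

/-- The module is the internal direct sum of the family `N` of submodules. -/
structure IsGrading (N : ι → Submodule S M) : Prop where
  indep : iSupIndep N
  span : iSup N = ⊤

namespace IsGrading

variable {N : ι → Submodule S M} {N' : ι → Submodule S M'}

/-- The kernel of `π a` contains the span of all other components, while `π a` is the identity on
the component `a`. -/
theorem of_proj (π : ι → M →ₗ[S] M) (h₁ : ∀ a, ∀ x ∈ N a, π a x = x)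
    (h₂ : ∀ a b, a ≠ b → ∀ x ∈ N a, π b x = 0) (hs : iSup N = ⊤) : IsGrading N := by
  refine ⟨fun a => ?_, hs⟩
  rw [Submodule.disjoint_def]
  intro x hx hx'
  have : (⨆ j, ⨆ (_ : j ≠ a), N j) ≤ LinearMap.ker (π a) :=
    iSup_le fun j => iSup_le fun hj => fun y hy => h₂ j a hj y hy
  rw [← h₁ a x hx]
  exact this hx'

open Classical in
/-- The projection to a component. -/
def proj (h : IsGrading N) (a : ι) : M →ₗ[S] M :=
  letI := (DirectSum.isInternal_submodule_of_iSupIndep_of_iSup_eq_top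
    h.indep h.span).chooseDecomposition
  (N a).subtype ∘ₗ DirectSum.component S ι (fun i => N i) a ∘ₗ
    (DirectSum.decomposeLinearEquiv N).toLinearMap

theorem proj_mem (h : IsGrading N) (a : ι) (x : M) : h.proj a x ∈ N a := by
  simp [proj]

theorem proj_of_mem (h : IsGrading N) {a : ι} {x : M} (hx : x ∈ N a) : h.proj a x = x := by
  classical
  let := (DirectSum.isInternal_submodule_of_iSupIndep_of_iSup_eq_top
    h.indep h.span).chooseDecomposition
  exact DirectSum.decompose_of_mem_same N hx

theorem proj_of_mem_ne (h : IsGrading N) {a b : ι} {x : M} (hx : x ∈ N a) (hab : a ≠ b) :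
    h.proj b x = 0 := by
  classical
  let := (DirectSum.isInternal_submodule_of_iSupIndep_of_iSup_eq_top
    h.indep h.span).chooseDecomposition
  exact DirectSum.decompose_of_mem_ne N hx hab

@[elab_as_elim]
theorem induction (h : IsGrading N) {p : M → Prop} (x : M) (hom : ∀ a, ∀ x ∈ N a, p x)
    (zero : p 0) (add : ∀ x y, p x → p y → p (x + y)) : p x :=
  Submodule.iSup_induction N (motive := p) (h.span ▸ Submodule.mem_top : x ∈ iSup N) hom zero add

theorem exists_sum (h : IsGrading N) (x : M) : ∃ s : Finset ι, x = ∑ a ∈ s, h.proj a x := by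
  classical
  -- Allowing every larger index set makes the claim additive: for a sum of two elements the union
  -- of their sets works.
  suffices ∃ s : Finset ι, ∀ t, s ⊆ t → x = ∑ a ∈ t, h.proj a x by
    obtain ⟨s, hs⟩ := this
    exact ⟨s, hs s subset_rfl⟩
  refine h.induction x (fun a x hx => ⟨{a}, fun t ht => ?_⟩) ⟨∅, fun t _ => by simp⟩ ?_
  · rw [Finset.sum_eq_single a (fun b _ hb => h.proj_of_mem_ne hx hb.symm)
      (fun hn => absurd (ht (Finset.mem_singleton_self a)) hn), h.proj_of_mem hx]
  · rintro x y ⟨s, hs⟩ ⟨t, ht⟩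
    refine ⟨s ∪ t, fun u hu => ?_⟩
    simp only [map_add, Finset.sum_add_distrib]
    rw [← hs u (Finset.subset_union_left.trans hu), ← ht u (Finset.subset_union_right.trans hu)]

theorem sum_proj (h : IsGrading N) (T : Finset ι) (hT : ∀ a, a ∉ T → N a = ⊥) (x : M) :
    ∑ a ∈ T, h.proj a x = x := by
  refine h.induction x (fun a x hx => ?_) (by simp) (fun x y hx hy => ?_)
  · rw [Finset.sum_eq_single a (fun b _ hb => h.proj_of_mem_ne hx hb.symm) fun ha => ?_,
      h.proj_of_mem hx]
    rw [hT a ha, Submodule.mem_bot] at hx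
    rw [hx, map_zero]
  · simp only [map_add, Finset.sum_add_distrib, hx, hy]

/-- The projection to a component, as a map into the component. -/
def projTo (h : IsGrading N) (a : ι) : M →ₗ[S] N a :=
  (h.proj a).codRestrict (N a) (h.proj_mem a)

theorem projTo_of_mem (h : IsGrading N) {a : ι} (x : N a) : h.projTo a x = x :=
  Subtype.ext (h.proj_of_mem x.2)

/-- A homogeneous map commutes with projections. Injectivity of `σ` is needed so that no second
component of `x` lands in degree `σ a`. -/
theorem map_proj {ι' : Type} {N' : ι' → Submodule S M'} (h : IsGrading N) (h' : IsGrading N')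
    (f : M →ₗ[S] M') (σ : ι → ι') (hσ : Function.Injective σ)
    (hf : ∀ a, ∀ x ∈ N a, f x ∈ N' (σ a)) (a : ι) (x : M) :
    f (h.proj a x) = h'.proj (σ a) (f x) := by
  refine h.induction x (fun b x hx => ?_) (by simp) (fun x y hx hy => by simp [hx, hy])
  by_cases hab : b = a
  · subst hab
    rw [h.proj_of_mem hx, h'.proj_of_mem (hf _ _ hx)]
  · rw [h.proj_of_mem_ne hx hab, h'.proj_of_mem_ne (hf _ _ hx) (hσ.ne hab), map_zero]

/-- A submodule that contains the components of its elements inherits the grading. -/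
theorem comap (h : IsGrading N) (j : M' →ₗ[S] M) (hj : Function.Injective j)
    (hs : ∀ a y, ∃ y', j y' = h.proj a (j y)) : IsGrading fun a => (N a).comap j := by
  choose ρ hρ using hs
  let π : ι → M' →ₗ[S] M' := fun a =>
    { toFun := ρ a
      map_add' := fun x y => hj (by simp [hρ])
      map_smul' := fun s x => hj (by simp [hρ]) }
  have hπ : ∀ a y, j (π a y) = h.proj a (j y) := hρ
  refine of_proj π (fun a x hx => hj ?_) (fun a b hab x hx => hj ?_) ?_
  · rw [hπ, h.proj_of_mem hx]
  · rw [hπ, h.proj_of_mem_ne hx hab, map_zero]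
  · rw [eq_top_iff]
    intro y _
    obtain ⟨s, hs⟩ := h.exists_sum (j y)
    have : y = ∑ a ∈ s, π a y := hj (by rw [map_sum]; simpa only [hπ] using hs)
    rw [this]
    refine Submodule.sum_mem _ fun a _ => Submodule.mem_iSup_of_mem a ?_
    rw [Submodule.mem_comap, hπ]
    exact h.proj_mem a _

/-- A quotient by a submodule that contains the components of its elements inherits the grading. -/
theorem map (h : IsGrading N) (q : M →ₗ[S] M') (hq : Function.Surjective q)
    (hs : ∀ a x, q x = 0 → q (h.proj a x) = 0) : IsGrading fun a => (N a).map q := by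
  let π : ι → M' →ₗ[S] M' := fun a =>
    ((LinearMap.ker q).liftQ (q ∘ₗ h.proj a) (fun x hx => hs a x hx)) ∘ₗ
      (q.quotKerEquivOfSurjective hq).symm.toLinearMap
  have hπ : ∀ a x, π a (q x) = q (h.proj a x) := by
    intro a x
    have : (q.quotKerEquivOfSurjective hq).symm (q x) = (LinearMap.ker q).mkQ x := by
      rw [LinearEquiv.symm_apply_eq]; rfl
    simp only [π, LinearMap.comp_apply, LinearEquiv.coe_coe, this]
    rfl
  refine of_proj π ?_ ?_ ?_
  · rintro a _ ⟨x, hx, rfl⟩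
    rw [hπ, h.proj_of_mem hx]
  · rintro a b hab _ ⟨x, hx, rfl⟩
    rw [hπ, h.proj_of_mem_ne hx hab, map_zero]
  · rw [← Submodule.map_iSup, h.span, Submodule.map_top, LinearMap.range_eq_top.2 hq]

/-- A spanning family that maps into the components of a grading along an injection is a
grading. -/
theorem of_injective {L : ι → Submodule S M'} (h : IsGrading N) (f : M' →ₗ[S] M)
    (hf : Function.Injective f) (hL : ∀ a, ∀ x ∈ L a, f x ∈ N a) (hs : iSup L = ⊤) :
    IsGrading L := by
  refine ⟨fun a => ?_, hs⟩
  rw [Submodule.disjoint_def]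
  intro x hx hx'
  have h1 : (⨆ j, ⨆ (_ : j ≠ a), L j) ≤ LinearMap.ker (h.proj a ∘ₗ f) :=
    iSup_le fun j => iSup_le fun hj => fun y hy => h.proj_of_mem_ne (hL j y hy) hj
  apply hf
  rw [map_zero, ← h.proj_of_mem (hL a x hx)]
  exact h1 hx'

/-- The functions with finite support, where the value at `x` is graded with a shift by `deg x`. -/
theorem finsupp {N : ℤ → Submodule S M} (h : IsGrading N) {X : Type} (deg : X → ℤ)
    (P : ℤ → Submodule S (X →₀ M)) (hP : ∀ i f, f ∈ P i ↔ ∀ x, f x ∈ N (i - deg x)) :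
    IsGrading P := by
  classical
  let π : ℤ → (X →₀ M) →ₗ[S] (X →₀ M) := fun i =>
    Finsupp.lsum S fun x => Finsupp.lsingle x ∘ₗ h.proj (i - deg x)
  have hπ : ∀ i f x, π i f x = h.proj (i - deg x) (f x) := by
    intro i f x
    simp only [π, Finsupp.lsum_apply, Finsupp.sum, Finsupp.finsetSum_apply, LinearMap.comp_apply,
      Finsupp.lsingle_apply, Finsupp.single_apply]
    rw [Finset.sum_ite_eq']
    split_ifs with hx
    · rfl
    · rw [Finsupp.notMem_support_iff.1 hx, map_zero]
  refine of_proj π (fun i f hf => ?_) (fun i j hij f hf => ?_) ?_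
  · ext x
    rw [hπ, h.proj_of_mem ((hP i f).1 hf x)]
  · ext x
    rw [hπ, h.proj_of_mem_ne ((hP i f).1 hf x) (by simpa using hij)]
    rfl
  · rw [eq_top_iff]
    rintro f -
    induction f using Finsupp.induction_linear with
    | zero => exact Submodule.zero_mem _
    | add f g hf hg => exact Submodule.add_mem _ hf hg
    | single x m =>
      refine h.induction m (fun a m hm => ?_) (by simp) (fun m m' hm hm' => ?_)
      · refine Submodule.mem_iSup_of_mem (a + deg x) ((hP _ _).2 fun y => ?_)
        rw [Finsupp.single_apply]
        split_ifs with hxy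
        · subst hxy; simpa using hm
        · exact Submodule.zero_mem _
      · rw [Finsupp.single_add]
        exact Submodule.add_mem _ hm hm'

end IsGrading

end Grading

/-! ### Gradings on homology -/

section HomologyGrading

variable {A : Type} [CommRing A] {M : Type} [AddCommGroup M] [Module A M]
  {S : Type} [CommRing S] [Algebra S A] [Module S M] [IsScalarTower S A M]
  {ι : Type} {N : ι → Submodule S M}

/-- Serves both the homology of the double complex and Tor: both are cycles modulo boundaries inside
a graded module. -/
theorem IsGrading.subquotient (h : IsGrading N) (P Q : Submodule A M)
    (hP : ∀ a, ∀ x ∈ P, h.proj a x ∈ P) (hQ : ∀ a, ∀ x ∈ Q, h.proj a x ∈ Q) :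
    IsGrading fun a => ((N a).comap (P.subtype.restrictScalars S)).map
      ((Q.submoduleOf P).mkQ.restrictScalars S) := by
  have h₁ := h.comap (P.subtype.restrictScalars S) Subtype.val_injective
    (fun a y => ⟨⟨h.proj a y, hP a y y.2⟩, rfl⟩)
  have hp : ∀ a (y : P), ((h₁.proj a y : P) : M) = h.proj a y :=
    fun a y => h₁.map_proj h (P.subtype.restrictScalars S) id
      Function.injective_id (fun _ _ hx => hx) a y
  let q : P →ₗ[S] P ⧸ Q.submoduleOf P := (Q.submoduleOf P).mkQ.restrictScalars S
  have hq : ∀ x, q x = 0 ↔ (x : M) ∈ Q := fun x => by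
    change Submodule.Quotient.mk x = 0 ↔ _
    rw [Submodule.Quotient.mk_eq_zero]
    rfl
  have hs : Function.Surjective q := Submodule.mkQ_surjective (Q.submoduleOf P)
  refine h₁.map q hs (fun a x hx => ?_)
  rw [hq] at hx ⊢
  rw [hp]
  exact hQ a x hx

/-- A component of a grading inherits a finer grading. -/
theorem IsGrading.restrict {κ ι' : Type} {P : κ → Submodule A M} (hg : IsGrading N)
    (hp : IsGrading P) (deg : ι → κ) (hdeg : ∀ a, ∀ x ∈ N a, x ∈ P (deg a)) (k : κ) (e : ι' → ι)
    (he : Function.Injective e) (hek : ∀ a, deg a = k ↔ a ∈ Set.range e) :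
    IsGrading fun i => (N (e i)).comap ((P k).subtype.restrictScalars S) := by
  classical
  have hmem : ∀ i x, hg.proj (e i) x ∈ P k := fun i x => by
    rw [← (hek (e i)).2 ⟨i, rfl⟩]
    exact hdeg _ _ (hg.proj_mem _ _)
  let π : ι' → P k →ₗ[S] P k := fun i =>
    { toFun := fun x => ⟨hg.proj (e i) x, hmem i x⟩
      map_add' := fun x y => Subtype.ext (map_add (hg.proj (e i)) (x : M) y)
      map_smul' := fun c x => Subtype.ext (map_smul (hg.proj (e i)) c (x : M)) }
  refine IsGrading.of_proj π (fun i x hx => ?_) (fun i l hil x hx => ?_) ?_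
  · exact Subtype.ext (hg.proj_of_mem hx)
  · exact Subtype.ext (hg.proj_of_mem_ne hx (he.ne hil))
  · rw [eq_top_iff]
    rintro x -
    obtain ⟨s, hs⟩ := hg.exists_sum (x : M)
    -- Projecting a decomposition of `x` to the coarse component `k` keeps exactly the fine
    -- components lying over `k`.
    have h1 : ∀ a, hp.proj k (hg.proj a x) = if deg a = k then hg.proj a x else 0 := by
      intro a
      have ha := hdeg a _ (hg.proj_mem a x)
      split_ifs with h'
      · rw [h'] at ha
        exact hp.proj_of_mem ha
      · exact hp.proj_of_mem_ne ha h'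
    have h2 : x = ∑ a ∈ s, hp.projTo k (hg.proj a x) := by
      rw [← map_sum, ← hs, hp.projTo_of_mem]
    rw [h2]
    refine Submodule.sum_mem _ fun a _ => ?_
    by_cases h' : deg a = k
    · obtain ⟨i, rfl⟩ := (hek a).1 h'
      refine Submodule.mem_iSup_of_mem i ?_
      change hp.proj k (hg.proj (e i) x) ∈ N (e i)
      rw [h1, if_pos h']
      exact hg.proj_mem _ _
    · have : hp.projTo k (hg.proj a x) = 0 := Subtype.ext ((h1 a).trans (if_neg h'))
      rw [this]
      exact Submodule.zero_mem _

theorem IsGrading.proj_mem_ker {ι' : Type} {M' : Type} [AddCommGroup M'] [Module A M']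
    [Module S M'] [IsScalarTower S A M'] {N' : ι' → Submodule S M'} (h : IsGrading N)
    (h' : IsGrading N') (d : M →ₗ[A] M') (σ : ι → ι') (hσ : Function.Injective σ)
    (hd : ∀ a, ∀ x ∈ N a, d x ∈ N' (σ a)) :
    ∀ a, ∀ x ∈ LinearMap.ker d, h.proj a x ∈ LinearMap.ker d := by
  intro a x hx
  have := h.map_proj h' (d.restrictScalars S) σ hσ hd a x
  rw [LinearMap.mem_ker] at hx ⊢
  rw [LinearMap.coe_restrictScalars, hx, map_zero] at this
  exact this

/-- A preimage of the component `a` is the component of degree `σ.symm a` of a preimage; hence the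
degree shift has to be a bijection here, unlike for kernels. -/
theorem IsGrading.proj_mem_range {ι' : Type} {M' : Type} [AddCommGroup M'] [Module A M']
    [Module S M'] [IsScalarTower S A M'] {N' : ι' → Submodule S M'} (h : IsGrading N)
    (h' : IsGrading N') (d : M →ₗ[A] M') (σ : ι ≃ ι')
    (hd : ∀ a, ∀ x ∈ N a, d x ∈ N' (σ a)) :
    ∀ a, ∀ x ∈ LinearMap.range d, h'.proj a x ∈ LinearMap.range d := by
  rintro a _ ⟨y, rfl⟩
  refine ⟨h.proj (σ.symm a) y, ?_⟩
  have := h.map_proj h' (d.restrictScalars S) σ σ.injective hd (σ.symm a) y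
  rw [σ.apply_symm_apply] at this
  exact this

theorem IsGrading.hlgySub (h : IsGrading N) (d : M →ₗ[A] M) (σ : ι ≃ ι)
    (hd : ∀ a, ∀ x ∈ N a, d x ∈ N (σ a)) :
    IsGrading fun a => HOMFLYPT.hlgySub d (N a) :=
  h.subquotient _ _ (h.proj_mem_ker h d σ σ.injective hd) (h.proj_mem_range h d σ hd)

theorem hlgyMap_mem_hlgySub (d e : M →ₗ[A] M) (h : ∀ x, d (e x) = e (d x)) {P Q : Submodule S M}
    (hPQ : ∀ x ∈ P, e x ∈ Q) :
    ∀ x ∈ hlgySub d P, hlgyMap d e h x ∈ hlgySub d Q := by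
  rintro _ ⟨x, hx, rfl⟩
  exact ⟨_, hPQ _ hx, rfl⟩

theorem hlgySub_mono {S' : Type} [CommRing S'] [Algebra S' A] [Module S' M] [IsScalarTower S' A M]
    (d : M →ₗ[A] M) {P : Submodule S M} {Q : Submodule S' M} (h : ∀ x ∈ P, x ∈ Q) :
    ∀ x ∈ hlgySub d P, x ∈ hlgySub d Q := by
  rintro _ ⟨x, hx, rfl⟩
  exact ⟨x, h _ hx, rfl⟩

end HomologyGrading

end HOMFLYPT

end

noncomputable section

namespace HOMFLYPT

/-! ## Graded modules over a connected graded ring -/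

variable {R : Type} [CommRing R] [Algebra ℚ R] {𝓡 : ℤ → Submodule ℚ R} {𝔪 : Ideal R}

/-- A non-negatively graded ring with `ℚ` in degree zero; `𝔪` is the ideal of the elements without
constant term. -/
structure IsConnectedGraded (𝓡 : ℤ → Submodule ℚ R) (𝔪 : Ideal R) : Prop where
  grading : IsGrading 𝓡
  one_mem : 1 ∈ 𝓡 0
  mul_mem : ∀ {i j : ℤ} {a b : R}, a ∈ 𝓡 i → b ∈ 𝓡 j → a * b ∈ 𝓡 (i + j)
  eq_bot_of_neg : ∀ {i : ℤ}, i < 0 → 𝓡 i = ⊥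
  eq_algebraMap : ∀ {a : R}, a ∈ 𝓡 0 → ∃ c : ℚ, a = algebraMap ℚ R c
  mem_of_pos : ∀ {i : ℤ} {a : R}, 0 < i → a ∈ 𝓡 i → a ∈ 𝔪
  proj_zero : ∀ {a : R}, a ∈ 𝔪 → grading.proj 0 a = 0

/-- R = ℚ + 𝔪, because the part of degree zero consists of constants and all positive degrees lie in
𝔪. -/
theorem IsConnectedGraded.exists_sub_mem (hR : IsConnectedGraded 𝓡 𝔪) (a : R) :
    ∃ c : ℚ, a - algebraMap ℚ R c ∈ 𝔪 := by
  refine hR.grading.induction a (fun i a ha => ?_) ⟨0, by simp⟩ ?_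
  · rcases lt_trichotomy i 0 with hi | rfl | hi
    · rw [hR.eq_bot_of_neg hi, Submodule.mem_bot] at ha
      exact ⟨0, by simp [ha]⟩
    · obtain ⟨c, rfl⟩ := hR.eq_algebraMap ha
      exact ⟨c, by simp⟩
    · exact ⟨0, by simpa using hR.mem_of_pos hi ha⟩
  · rintro a b ⟨c, hc⟩ ⟨c', hc'⟩
    refine ⟨c + c', ?_⟩
    rw [map_add, add_sub_add_comm]
    exact Ideal.add_mem _ hc hc'

namespace GrMod

/-- A graded module that is bounded below. -/
structure IsGraded (𝓡 : ℤ → Submodule ℚ R) (M : GrMod R) : Prop where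
  grading : IsGrading M.piece
  smul_mem : ∀ {i j : ℤ} {a : R} {x : M.carrier}, a ∈ 𝓡 i → x ∈ M.piece j →
    a • x ∈ M.piece (i + j)
  bdd : ∃ d : ℤ, ∀ i < d, M.piece i = ⊥

variable {M : GrMod R}

/-- Graded Nakayama by induction on the degree: elements of 𝔪 have only components of positive
degree, so the degree `i` part of `𝔪 • N'` involves only elements of `N'` of degree below `i`.
Boundedness below starts the induction and replaces finite generation. -/
theorem nakayama (hR : IsConnectedGraded 𝓡 𝔪) (hM : M.IsGraded 𝓡) (N N' : Submodule R M.carrier)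
    (hN : ∀ i, ∀ x ∈ N, hM.grading.proj i x ∈ N) (hN' : ∀ i, ∀ x ∈ N', hM.grading.proj i x ∈ N')
    (h : N' ≤ N ⊔ 𝔪 • N') : N' ≤ N := by
  obtain ⟨d, hd⟩ := hM.bdd
  have key : ∀ n : ℕ, ∀ i < d + n, ∀ x ∈ N', x ∈ M.piece i → x ∈ N := by
    intro n
    induction n with
    | zero =>
      intro i hi x _ hx
      rw [hd i (by simpa using hi), Submodule.mem_bot] at hx
      rw [hx]
      exact N.zero_mem
    | succ n ih =>
      intro i hi x hx hxi
      obtain ⟨y, hy, z, hz, rfl⟩ := Submodule.mem_sup.1 (h hx)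
      rw [← hM.grading.proj_of_mem hxi, map_add]
      refine N.add_mem (hN i y hy) ?_
      refine Submodule.smul_induction_on hz (fun r hr w hw => ?_) (fun u v hu hv => ?_)
      · obtain ⟨s, hs⟩ := hR.grading.exists_sum r
        obtain ⟨t, ht⟩ := hM.grading.exists_sum w
        -- Only products with `a + b = i` contribute to degree `i`; of these, `a < 0` and `a = 0`
        -- give zero, and `a > 0` forces `b < i`.
        have hrw : r • w = ∑ a ∈ s, ∑ b ∈ t, hR.grading.proj a r • hM.grading.proj b w := by
          conv_lhs => rw [hs, ht, Finset.sum_smul]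
          simp only [Finset.smul_sum]
        rw [hrw, map_sum]
        refine N.sum_mem fun a _ => ?_
        rw [map_sum]
        refine N.sum_mem fun b _ => ?_
        have hab := hM.smul_mem (hR.grading.proj_mem a r) (hM.grading.proj_mem b w)
        by_cases hi' : a + b = i
        · subst hi'
          rw [hM.grading.proj_of_mem hab]
          rcases lt_trichotomy a 0 with ha | rfl | ha
          · have := hR.grading.proj_mem a r
            rw [hR.eq_bot_of_neg ha, Submodule.mem_bot] at this
            rw [this, zero_smul]
            exact N.zero_mem
          · rw [hR.proj_zero hr, zero_smul]
            exact N.zero_mem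
          · refine N.smul_mem _ (ih b ?_ _ (hN' b w hw) (hM.grading.proj_mem b w))
            push_cast at hi
            omega
        · rw [hM.grading.proj_of_mem_ne hab hi']
          exact N.zero_mem
      · rw [map_add]
        exact N.add_mem hu hv
  intro x hx
  obtain ⟨s, hs⟩ := hM.grading.exists_sum x
  rw [hs]
  refine N.sum_mem fun i _ => ?_
  -- The truncation at 0 is harmless: for `i < d` the bound `i < d + 0` already holds.
  exact key (i - d + 1).toNat i (by omega) _ (hN' i x hx) (hM.grading.proj_mem i x)

/-! ### The canonical cover and its kernel -/

theorem free_isGraded (hR : IsConnectedGraded 𝓡 𝔪) (hM : M.IsGraded 𝓡) :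
    (M.free 𝓡).IsGraded 𝓡 where
  grading := IsGrading.finsupp (X := M.Gen) hR.grading (fun x => x.1.1) _ (fun _ _ => Iff.rfl)
  smul_mem := by
    rintro i j a (f : M.Gen →₀ R) ha hf x
    change a * f x ∈ _
    rw [add_sub_assoc]
    exact hR.mul_mem ha (hf x)
  bdd := by
    obtain ⟨d, hd⟩ := hM.bdd
    refine ⟨d, fun i hi => (Submodule.eq_bot_iff _).2 fun f hf => ?_⟩
    refine Finsupp.ext fun x => ?_
    by_cases hx : x.1.1 < d
    · exact absurd (by simpa [hd _ hx] using x.2.1) x.2.2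
    · have := hf x
      rw [hR.eq_bot_of_neg (by omega), Submodule.mem_bot] at this
      exact this

theorem cover_single (x : M.Gen) (a : R) :
    M.cover 𝓡 (Finsupp.single x a : M.Gen →₀ R) = a • x.1.2 :=
  Finsupp.linearCombination_single R a x

theorem cover_mem (hM : M.IsGraded 𝓡) {i : ℤ} {f : (M.free 𝓡).carrier}
    (hf : f ∈ (M.free 𝓡).piece i) : M.cover 𝓡 f ∈ M.piece i := by
  refine Submodule.sum_mem _ fun x _ => ?_
  have := hM.smul_mem (hf x) x.2.1
  rwa [sub_add_cancel] at this

theorem cover_surjective (hM : M.IsGraded 𝓡) : Function.Surjective (M.cover 𝓡) := by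
  intro x
  refine hM.grading.induction x (fun i x hx => ?_) ⟨0, map_zero _⟩ ?_
  · by_cases h0 : x = 0
    · exact ⟨0, by rw [h0, map_zero]⟩
    · exact ⟨Finsupp.single ⟨(i, x), hx, h0⟩ 1, by rw [cover_single, one_smul]⟩
  · rintro _ _ ⟨f, rfl⟩ ⟨g, rfl⟩
    exact ⟨f + g, map_add _ _ _⟩

theorem cover_proj (hR : IsConnectedGraded 𝓡 𝔪) (hM : M.IsGraded 𝓡) (i : ℤ)
    (f : (M.free 𝓡).carrier) :
    M.cover 𝓡 ((free_isGraded hR hM).grading.proj i f) = hM.grading.proj i (M.cover 𝓡 f) :=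
  (free_isGraded hR hM).grading.map_proj hM.grading ((M.cover 𝓡).restrictScalars ℚ) id
    Function.injective_id (fun _ _ hx => cover_mem hM hx) i f

theorem syz_isGraded (hR : IsConnectedGraded 𝓡 𝔪) (hM : M.IsGraded 𝓡) :
    (M.syz 𝓡).IsGraded 𝓡 where
  grading := by
    refine (free_isGraded hR hM).grading.comap
      ((LinearMap.ker (M.cover 𝓡)).subtype.restrictScalars ℚ) Subtype.val_injective
      (fun i y => ⟨⟨(free_isGraded hR hM).grading.proj i y, ?_⟩, rfl⟩)
    rw [LinearMap.mem_ker, cover_proj hR hM, y.2, map_zero]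
  smul_mem := fun ha hx => (free_isGraded hR hM).smul_mem ha hx
  bdd := by
    obtain ⟨d, hd⟩ := (free_isGraded hR hM).bdd
    refine ⟨d, fun i hi => (Submodule.eq_bot_iff _).2 ?_⟩
    rintro (f : LinearMap.ker (M.cover 𝓡)) hf
    refine Subtype.ext ?_
    have : (f : (M.free 𝓡).carrier) ∈ (M.free 𝓡).piece i := hf
    rwa [hd i hi, Submodule.mem_bot] at this

theorem syzIter_isGraded (hR : IsConnectedGraded 𝓡 𝔪) (hM : M.IsGraded 𝓡) (p : ℕ) :
    (M.syzIter 𝓡 p).IsGraded 𝓡 := by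
  induction p with
  | zero => exact hM
  | succ p ih => exact syz_isGraded hR ih

end GrMod

end HOMFLYPT

end

noncomputable section

namespace HOMFLYPT

variable {R : Type} [CommRing R] {𝔪 : Ideal R}

/-! ### Tensor products with a cyclic module -/

section CyclicTensor

variable {A N : Type} [AddCommGroup A] [Module R A] [AddCommGroup N] [Module R N]

/-- The left factor is cyclic, generated by `u.symm 1`, so all scalars can be moved to the right. -/
theorem exists_one_tmul (u : A ≃ₗ[R] R ⧸ 𝔪) (z : A ⊗[R] N) : ∃ n, u.symm 1 ⊗ₜ[R] n = z := by
  induction z using TensorProduct.induction_on with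
  | zero => exact ⟨0, TensorProduct.tmul_zero _ _⟩
  | tmul a n =>
    obtain ⟨r, hr⟩ := Ideal.Quotient.mk_surjective (u a)
    refine ⟨r • n, ?_⟩
    rw [← TensorProduct.smul_tmul]
    congr 1
    rw [← map_smul, LinearEquiv.symm_apply_eq, ← hr, Algebra.smul_def, mul_one]
    rfl
  | add x y hx hy =>
    obtain ⟨m, rfl⟩ := hx
    obtain ⟨n, rfl⟩ := hy
    exact ⟨m + n, TensorProduct.tmul_add _ _ _⟩

theorem one_tmul_eq_zero_iff (u : A ≃ₗ[R] R ⧸ 𝔪) (n : N) :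
    u.symm 1 ⊗ₜ[R] n = 0 ↔ n ∈ 𝔪 • (⊤ : Submodule R N) := by
  rw [← (TensorProduct.congr u (LinearEquiv.refl R N)).map_eq_zero_iff,
    ← (TensorProduct.quotTensorEquivQuotSMul N 𝔪).map_eq_zero_iff]
  rw [TensorProduct.congr_tmul, LinearEquiv.apply_symm_apply, LinearEquiv.refl_apply]
  have := TensorProduct.quotTensorEquivQuotSMul_mk_tmul (I := 𝔪) 1 n
  rw [map_one, one_smul] at this
  rw [this, Submodule.Quotient.mk_eq_zero]

/-- Injectivity of K/𝔪K → N/𝔪N, in the form K ∩ 𝔪N ⊆ 𝔪K. -/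
theorem mem_smul_of_lTensor_injective (u : A ≃ₗ[R] R ⧸ 𝔪) (K : Submodule R N)
    (h : Function.Injective (K.subtype.lTensor A)) {k : N} (hk : k ∈ K)
    (hk' : k ∈ 𝔪 • (⊤ : Submodule R N)) : k ∈ 𝔪 • K := by
  have h1 : u.symm 1 ⊗ₜ[R] (⟨k, hk⟩ : K) = 0 := by
    apply h
    rw [LinearMap.lTensor_tmul, map_zero]
    exact (one_tmul_eq_zero_iff u k).2 hk'
  have h2 := Submodule.mem_map_of_mem (f := K.subtype) ((one_tmul_eq_zero_iff u _).1 h1)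
  rwa [Submodule.map_smul'', Submodule.map_top, Submodule.range_subtype] at h2

/-- A section of `c` makes the inclusion of its kernel split, and split injections survive any
tensor product. -/
theorem lTensor_injective_of_projective (A : Type) [AddCommGroup A] [Module R A]
    {F : Type} [AddCommGroup F] [Module R F] (c : F →ₗ[R] N) (hc : Function.Surjective c)
    [Module.Projective R N] : Function.Injective ((LinearMap.ker c).subtype.lTensor A) := by
  obtain ⟨s, hs⟩ := Module.projective_lifting_property c LinearMap.id hc
  let ρ : F →ₗ[R] LinearMap.ker c := (LinearMap.id - s ∘ₗ c).codRestrict _ fun x => by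
    rw [LinearMap.mem_ker]
    simpa [sub_eq_zero] using (LinearMap.congr_fun hs (c x)).symm
  have hρ : ρ ∘ₗ (LinearMap.ker c).subtype = LinearMap.id := by
    ext x
    simp [ρ]
  refine Function.LeftInverse.injective (g := ρ.lTensor A) fun z => ?_
  rw [← LinearMap.comp_apply, ← LinearMap.lTensor_comp, hρ, LinearMap.lTensor_id]
  rfl

end CyclicTensor

/-! ### Minimal generators, and projectivity from the vanishing of Tor_1 -/

namespace GrMod

variable [Algebra ℚ R] {𝓡 : ℤ → Submodule ℚ R} {M : GrMod R}

theorem proj_apply (hR : IsConnectedGraded 𝓡 𝔪) (hM : M.IsGraded 𝓡) (i : ℤ) (f : M.Gen →₀ R)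
    (x : M.Gen) : (show M.Gen →₀ R from (free_isGraded hR hM).grading.proj i f) x =
      hR.grading.proj (i - x.1.1) (f x) :=
  (free_isGraded hR hM).grading.map_proj hR.grading
    (Finsupp.lapply (R := ℚ) x : (M.Gen →₀ R) →ₗ[ℚ] R) (fun i => i - x.1.1)
    (fun a b hab => by simpa using hab) (fun _ _ hf => hf x) i f

theorem proj_mem_supported (hR : IsConnectedGraded 𝓡 𝔪) (hM : M.IsGraded 𝓡) (X : Set M.Gen)
    (i : ℤ) (f : M.Gen →₀ R) (hf : f ∈ Finsupp.supported R R X) :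
    (show M.Gen →₀ R from (free_isGraded hR hM).grading.proj i f) ∈ Finsupp.supported R R X := by
  rw [Finsupp.mem_supported'] at hf ⊢
  intro x hx
  rw [proj_apply hR hM, hf x hx, map_zero]

/-- A set of homogeneous elements that is a basis modulo `𝔪`. -/
theorem exists_minimal_generators (hR : IsConnectedGraded 𝓡 𝔪) (hM : M.IsGraded 𝓡) :
    ∃ X : Set M.Gen,
      (Finsupp.supported R R X).map (M.cover 𝓡 : (M.Gen →₀ R) →ₗ[R] M.carrier) = ⊤ ∧
      ∀ y ∈ Finsupp.supported R R X, M.cover 𝓡 y = 0 →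
        y ∈ 𝔪 • (⊤ : Submodule R (M.Gen →₀ R)) := by
  let V := M.carrier ⧸ (𝔪 • ⊤ : Submodule R M.carrier)
  let v : M.Gen → V := fun x => Submodule.Quotient.mk x.1.2
  have hv : ∀ x : M.carrier, (Submodule.Quotient.mk x : V) ∈ Submodule.span ℚ (Set.range v) := by
    intro x
    refine hM.grading.induction x (fun i x hx => ?_) (Submodule.zero_mem _)
      (fun x y hx hy => Submodule.add_mem _ hx hy)
    by_cases h0 : x = 0
    · rw [h0]
      exact Submodule.zero_mem _
    · exact Submodule.subset_span ⟨⟨(i, x), hx, h0⟩, rfl⟩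
  -- Homogeneous elements span M/𝔪M over ℚ, so a basis can be selected among their classes; no
  -- finiteness is needed.
  obtain ⟨κ, a, ha, hspan, hind⟩ := exists_linearIndependent' ℚ v
  rw [← linearIndepOn_range_iff ha] at hind
  let c : (M.Gen →₀ R) →ₗ[R] M.carrier := M.cover 𝓡
  have hc : ∀ x r, c (Finsupp.single x r) = r • x.1.2 := cover_single
  refine ⟨Set.range a, top_le_iff.1 ?_, fun y hy hy0 => ?_⟩
  · refine nakayama hR hM _ ⊤ ?_ (fun _ _ _ => Submodule.mem_top) fun x _ => ?_
    · rintro i _ ⟨g, hg, rfl⟩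
      rw [← cover_proj hR hM]
      exact ⟨_, proj_mem_supported hR hM _ i g hg, rfl⟩
    · have h1 := hv x
      rw [← hspan] at h1
      have h2 : Submodule.span ℚ (Set.range (v ∘ a)) ≤
          (((Finsupp.supported R R (Set.range a)).map c).map
            (𝔪 • ⊤ : Submodule R M.carrier).mkQ).restrictScalars ℚ := by
        rw [Submodule.span_le]
        rintro _ ⟨k, rfl⟩
        refine ⟨(a k).1.2, ⟨Finsupp.single (a k) 1, ?_, ?_⟩, rfl⟩
        · exact Finsupp.single_mem_supported R 1 ⟨k, rfl⟩
        · rw [hc, one_smul]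
      obtain ⟨n, hn, hnx⟩ := h2 h1
      have h3 : x - n ∈ (𝔪 • ⊤ : Submodule R M.carrier) := by
        rw [← Submodule.Quotient.mk_eq_zero, Submodule.Quotient.mk_sub, sub_eq_zero]
        exact hnx.symm
      rw [← add_sub_cancel n x]
      exact Submodule.add_mem_sup hn h3
  -- `ε r` is a residue of `r` modulo 𝔪. Reducing a relation between the chosen generators modulo 𝔪
  -- gives a ℚ-linear relation with coefficients `ε (y x)`, which must all vanish; so the
  -- coefficients `y x` lie in 𝔪.
  · choose ε hε using hR.exists_sub_mem
    have h1 : ∑ x ∈ y.support, ε (y x) • v x = 0 := by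
      have h2 : (Submodule.Quotient.mk (c y) : V) = 0 := by
        rw [show c y = 0 from hy0, Submodule.Quotient.mk_zero]
      rw [← h2]
      change _ = Submodule.mkQ _ (∑ x ∈ y.support, y x • x.1.2)
      rw [map_sum]
      refine Finset.sum_congr rfl fun x _ => ?_
      symm
      change Submodule.Quotient.mk _ = ε (y x) • Submodule.Quotient.mk _
      rw [← Submodule.Quotient.mk_smul, ← sub_eq_zero, ← Submodule.Quotient.mk_sub,
        Submodule.Quotient.mk_eq_zero, ← algebraMap_smul R (ε (y x)), ← sub_smul]
      exact Submodule.smul_mem_smul (hε _) Submodule.mem_top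
    have h2 := linearIndepOn_iff'.1 hind y.support (fun x => ε (y x))
      ((Finsupp.mem_supported R y).1 hy) h1
    rw [← Finsupp.sum_single y]
    refine Submodule.sum_mem _ fun x hx => ?_
    have h3 : y x ∈ 𝔪 := by
      have := hε (y x)
      rwa [h2 x hx, map_zero, sub_zero] at this
    rw [← mul_one (y x), ← smul_eq_mul, ← Finsupp.smul_single]
    exact Submodule.smul_mem_smul h3 Submodule.mem_top

/-- Let G be the free submodule on minimal generators and K the kernel of the cover. Nakayama shows
K ∩ G = 0, so G maps isomorphically to M. In practice this is realized by a retraction `r` onto G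
over M that kills K and hence descends to a section of the cover. -/
theorem projective_of_lTensor_injective (hR : IsConnectedGraded 𝓡 𝔪) (hM : M.IsGraded 𝓡)
    {A : Type} [AddCommGroup A] [Module R A] (u : A ≃ₗ[R] R ⧸ 𝔪)
    (h : Function.Injective ((LinearMap.ker (M.cover 𝓡)).subtype.lTensor A)) :
    Module.Projective R M.carrier := by
  classical
  obtain ⟨X, hX, hX'⟩ := exists_minimal_generators hR hM
  let c : (M.Gen →₀ R) →ₗ[R] M.carrier := M.cover 𝓡
  have hc : ∀ x r, c (Finsupp.single x r) = r • x.1.2 := cover_single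
  have hc' : Function.Surjective c := cover_surjective hM
  let G := Finsupp.supported R R X
  -- Each generator is expressed through the minimal ones; taking the expression of a minimal
  -- generator to be itself makes `r` the identity on G.
  have hg : ∀ x : M.Gen, ∃ g ∈ G, c g = x.1.2 ∧ (x ∈ X → g = Finsupp.single x 1) := by
    intro x
    by_cases hx : x ∈ X
    · exact ⟨_, Finsupp.single_mem_supported R 1 hx, by rw [hc, one_smul], fun _ => rfl⟩
    · obtain ⟨g, hg, hgx⟩ : x.1.2 ∈ G.map c := hX ▸ Submodule.mem_top
      exact ⟨g, hg, hgx, fun h => absurd h hx⟩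
  choose g hgG hgc hgX using hg
  let r : (M.Gen →₀ R) →ₗ[R] (M.Gen →₀ R) := Finsupp.linearCombination R g
  have hrG : ∀ f, r f ∈ G := fun f => G.sum_mem fun x _ => G.smul_mem _ (hgG x)
  have hrc : ∀ f, c (r f) = c f := by
    intro f
    refine LinearMap.congr_fun (f := c ∘ₗ r) (g := c) (Finsupp.lhom_ext fun x a => ?_) f
    rw [LinearMap.comp_apply, Finsupp.linearCombination_single, map_smul, hgc, hc]
  have hr : ∀ f ∈ G, r f = f := by
    intro f hf
    rw [Finsupp.linearCombination_apply]
    conv_rhs => rw [← Finsupp.sum_single f]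
    refine Finsupp.sum_congr fun x hx => ?_
    rw [hgX x ((Finsupp.mem_supported R f).1 hf hx), Finsupp.smul_single, smul_eq_mul, mul_one]
  have hK : LinearMap.ker c ⊓ G ≤ ⊥ := by
    refine nakayama (M := M.free 𝓡) hR (free_isGraded hR hM) ⊥ (LinearMap.ker c ⊓ G) ?_ ?_ ?_
    · rintro i x hx
      rw [Submodule.mem_bot] at hx ⊢
      rw [hx, map_zero]
    · rintro i x ⟨hx, hxG⟩
      refine ⟨?_, proj_mem_supported hR hM _ i x hxG⟩
      have := cover_proj hR hM i x
      rw [show M.cover 𝓡 x = 0 from hx, map_zero] at this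
      exact this
    -- By minimality `y` lies in 𝔪F, by the injectivity `h` in 𝔪K, and applying `r` moves it into
    -- 𝔪(K ∩ G).
    · rintro y ⟨hy, hyG⟩
      rw [bot_sup_eq]
      have h1 : y ∈ 𝔪 • LinearMap.ker c :=
        mem_smul_of_lTensor_injective u _ h hy (hX' y hyG hy)
      have h2 := Submodule.mem_map_of_mem (f := r) h1
      rw [hr y hyG, Submodule.map_smul''] at h2
      refine Submodule.smul_mono le_rfl ?_ h2
      rintro _ ⟨z, hz, rfl⟩
      exact ⟨(hrc z).trans hz, hrG z⟩
  have hker : LinearMap.ker c ≤ LinearMap.ker r := fun y hy =>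
    hK ⟨by rw [SetLike.mem_coe, LinearMap.mem_ker, hrc]; exact hy, hrG y⟩
  refine Module.Projective.of_split
    (((LinearMap.ker c).liftQ r hker) ∘ₗ (c.quotKerEquivOfSurjective hc').symm.toLinearMap) c ?_
  ext m
  obtain ⟨f, rfl⟩ := hc' m
  have : (c.quotKerEquivOfSurjective hc').symm (c f) = (LinearMap.ker c).mkQ f := by
    rw [LinearEquiv.symm_apply_eq]
    rfl
  simp only [LinearMap.comp_apply, LinearEquiv.coe_coe, this, LinearMap.id_apply]
  exact hrc f

end GrMod

end HOMFLYPT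

end

noncomputable section

namespace HOMFLYPT

/-! ## Vanishing, finiteness and grading of `Tor` -/

/-! ### Retracts of modules with finitely generated relations -/

section Retract

variable {R : Type} [CommRing R]

/-- `M` is a retract of a quotient of a projective module by a finitely generated submodule. -/
def IsFGRetract (R : Type) [CommRing R] (M : Type) [AddCommGroup M] [Module R M] : Prop :=
  ∃ (P N : Type) (_ : AddCommGroup P) (_ : Module R P) (_ : AddCommGroup N) (_ : Module R N)
    (π : P →ₗ[R] N) (i : M →ₗ[R] N) (r : N →ₗ[R] M), Module.Projective R P ∧
      Function.Surjective π ∧ (LinearMap.ker π).FG ∧ r ∘ₗ i = LinearMap.id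

variable {M F : Type} [AddCommGroup M] [Module R M] [AddCommGroup F] [Module R F]

theorem IsFGRetract.of_finite [IsNoetherianRing R] [hM : Module.Finite R M] : IsFGRetract R M := by
  obtain ⟨n, f, hf⟩ := Module.Finite.exists_fin' R M
  exact ⟨_, M, _, _, _, _, f, LinearMap.id, LinearMap.id, inferInstance, hf,
    IsNoetherian.noetherian _, rfl⟩

/-- The kernel of a projective cover of a retract of `P ⧸ L` is compared with `L`. -/
theorem IsFGRetract.exists_comparison (h : IsFGRetract R M) [Module.Projective R F]
    (c : F →ₗ[R] M) (hc : Function.Surjective c) :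
    ∃ (L : Type) (_ : AddCommGroup L) (_ : Module R L) (φ : LinearMap.ker c →ₗ[R] L)
      (ψ : L →ₗ[R] LinearMap.ker c) (θ : F →ₗ[R] LinearMap.ker c), Module.Finite R L ∧
      ψ ∘ₗ φ + θ ∘ₗ (LinearMap.ker c).subtype = LinearMap.id := by
  obtain ⟨P, N, _, _, _, _, π, i, r, hP, hπ, hL, hri⟩ := h
  obtain ⟨φ, hφ⟩ := Module.projective_lifting_property π (i ∘ₗ c) hπ
  obtain ⟨ψ, hψ⟩ := Module.projective_lifting_property c (r ∘ₗ π) hc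
  have hφ' : ∀ x, π (φ x) = i (c x) := LinearMap.congr_fun hφ
  have hψ' : ∀ x, c (ψ x) = r (π x) := LinearMap.congr_fun hψ
  have hri' : ∀ x, r (i x) = x := LinearMap.congr_fun hri
  have h1 : ∀ x ∈ LinearMap.ker c, φ x ∈ LinearMap.ker π := fun x hx => by
    rw [LinearMap.mem_ker] at hx ⊢
    rw [hφ', hx, map_zero]
  have h2 : ∀ x ∈ LinearMap.ker π, ψ x ∈ LinearMap.ker c := fun x hx => by
    rw [LinearMap.mem_ker] at hx ⊢
    rw [hψ', hx, map_zero]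
  have h3 : ∀ x, (LinearMap.id - ψ ∘ₗ φ : F →ₗ[R] F) x ∈ LinearMap.ker c := fun x => by
    rw [LinearMap.mem_ker, LinearMap.sub_apply, map_sub, LinearMap.comp_apply, hψ', hφ', hri']
    exact sub_self _
  refine ⟨LinearMap.ker π, _, _, φ.restrict h1, ψ.restrict h2,
    -- The lifts `φ : F → P` and `ψ : P → F` compose to a map over the identity of `M`, so `1 - ψφ`
    -- sends all of `F` into the kernel of `c`.
    (LinearMap.id - ψ ∘ₗ φ).codRestrict _ h3, Module.Finite.iff_fg.2 hL, ?_⟩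
  ext x
  simp

/-- The comparison exhibits the kernel as a retract of `L × F` with `L` finite. This is a quotient
of `R^n × F` by a finitely generated submodule, so the property passes to all syzygies of covers of
infinite rank. -/
theorem IsFGRetract.ker [IsNoetherianRing R] (h : IsFGRetract R M) [Module.Projective R F]
    (c : F →ₗ[R] M) (hc : Function.Surjective c) : IsFGRetract R (LinearMap.ker c) := by
  obtain ⟨L, _, _, φ, ψ, θ, hL, hid⟩ := h.exists_comparison c hc
  obtain ⟨n, g, hg⟩ := Module.Finite.exists_fin' R L
  refine ⟨(Fin n → R) × F, L × F, _, _, _, _, g.prodMap LinearMap.id,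
    φ.prod (LinearMap.ker c).subtype, ψ.coprod θ, inferInstance, ?_, ?_, ?_⟩
  · exact Function.Surjective.prodMap hg Function.surjective_id
  · rw [LinearMap.ker_prodMap, LinearMap.ker_id]
    exact (IsNoetherian.noetherian _).prod Submodule.fg_bot
  · rw [LinearMap.coprod_comp_prod, hid]

section LTensor

variable (A : Type) [AddCommGroup A] [Module R A] {F' : Type} [AddCommGroup F'] [Module R F']

theorem range_lTensor_eq_ker (c : F →ₗ[R] M) (hc : Function.Surjective c)
    (c' : F' →ₗ[R] LinearMap.ker c) (hc' : Function.Surjective c') :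
    LinearMap.range (((LinearMap.ker c).subtype ∘ₗ c').lTensor A) =
      LinearMap.ker (c.lTensor A) := by
  have h := lTensor_exact A (f := (LinearMap.ker c).subtype ∘ₗ c') (g := c) ?_ hc
  · exact (LinearMap.exact_iff.1 h).symm
  · rw [LinearMap.exact_iff, LinearMap.range_comp_of_range_eq_top _ (LinearMap.range_eq_top.2 hc'),
      Submodule.range_subtype]

/-- Both sides express Tor_1(A, M) = 0; since `c'` stays surjective after tensoring, elements of A ⊗
F' represent all elements of A ⊗ ker c. -/
theorem ker_lTensor_le_iff (c : F →ₗ[R] M) (c' : F' →ₗ[R] LinearMap.ker c)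
    (hc' : Function.Surjective c') :
    LinearMap.ker (((LinearMap.ker c).subtype ∘ₗ c').lTensor A) ≤ LinearMap.ker (c'.lTensor A) ↔
      Function.Injective ((LinearMap.ker c).subtype.lTensor A) := by
  rw [LinearMap.lTensor_comp]
  constructor
  · intro h
    rw [injective_iff_map_eq_zero]
    intro w hw
    obtain ⟨z, rfl⟩ := LinearMap.lTensor_surjective A hc' w
    exact h (x := z) hw
  · intro h z hz
    apply h
    rw [map_zero]
    exact hz

/-- Tensoring the identity ψφ + θ∘incl = 1 on ker c shows that a cycle, which dies in A ⊗ F, is a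
boundary once it also dies in A ⊗ L. Cycles modulo boundaries are thus controlled by the finite
module A ⊗ L. -/
theorem IsFGRetract.exists_lTensor (h : IsFGRetract R M) [Module.Projective R F]
    (c : F →ₗ[R] M) (hc : Function.Surjective c) (c' : F' →ₗ[R] LinearMap.ker c) :
    ∃ (L : Type) (_ : AddCommGroup L) (_ : Module R L) (f : A ⊗[R] F' →ₗ[R] A ⊗[R] L),
      Module.Finite R L ∧ ∀ z, f z = 0 →
        z ∈ LinearMap.ker (((LinearMap.ker c).subtype ∘ₗ c').lTensor A) →
        z ∈ LinearMap.ker (c'.lTensor A) := by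
  obtain ⟨L, _, _, φ, ψ, θ, hL, hid⟩ := h.exists_comparison c hc
  refine ⟨L, _, _, (φ ∘ₗ c').lTensor A, hL, fun z hz hz' => ?_⟩
  rw [LinearMap.mem_ker, LinearMap.lTensor_comp, LinearMap.comp_apply] at hz'
  rw [LinearMap.lTensor_comp, LinearMap.comp_apply] at hz
  rw [LinearMap.mem_ker, ← LinearMap.id_apply (R := R) (c'.lTensor A z), ← LinearMap.lTensor_id,
    ← hid, LinearMap.lTensor_add, LinearMap.add_apply, LinearMap.lTensor_comp,
    LinearMap.lTensor_comp, LinearMap.comp_apply, LinearMap.comp_apply, hz, hz', map_zero, map_zero,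
    add_zero]

end LTensor

theorem finite_of_smul_eq {S W : Type} [CommRing S] [AddCommGroup W] [Module R W] [Module S W]
    [Module.Finite R W] (h : ∀ r : R, ∃ s : S, ∀ w : W, r • w = s • w) : Module.Finite S W := by
  obtain ⟨T, hT⟩ := Module.Finite.fg_top (R := R) (M := W)
  refine ⟨T, top_le_iff.1 fun w _ => ?_⟩
  have hw : w ∈ Submodule.span R (T : Set W) := hT ▸ Submodule.mem_top
  induction hw using Submodule.span_induction with
  | mem x hx => exact Submodule.subset_span hx
  | zero => exact Submodule.zero_mem _
  | add x y _ _ hx hy => exact Submodule.add_mem _ (hx trivial) (hy trivial)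
  | smul r x _ hx =>
    obtain ⟨s, hs⟩ := h r
    rw [hs]
    exact Submodule.smul_mem _ s (hx trivial)

theorem finite_quotient_of_ker_le {S Z W : Type} [CommRing S] [IsNoetherianRing S] [AddCommGroup Z]
    [AddCommGroup W] [Module R Z] [Module R W] [Algebra S R] [Module S Z] [Module S W]
    [IsScalarTower S R Z] [IsScalarTower S R W] [Module.Finite S W] (g : Z →ₗ[R] W)
    (B : Submodule R Z) (h : LinearMap.ker g ≤ B) : Module.Finite S (Z ⧸ B) := by
  let g' := g.restrictScalars S
  let q : LinearMap.range g' →ₗ[S] Z ⧸ B :=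
    ((LinearMap.ker g').liftQ (B.mkQ.restrictScalars S) fun z hz =>
      (Submodule.Quotient.mk_eq_zero B).2 (h hz)) ∘ₗ g'.quotKerEquivRange.symm.toLinearMap
  refine Module.Finite.of_surjective q fun y => ?_
  obtain ⟨z, rfl⟩ := B.mkQ_surjective y
  refine ⟨g'.quotKerEquivRange ((LinearMap.ker g').mkQ z), ?_⟩
  simp only [q, LinearMap.comp_apply, LinearEquiv.coe_coe, LinearEquiv.symm_apply_apply]
  rfl

end Retract

variable {R : Type} [CommRing R] [Algebra ℚ R] {𝓡 : ℤ → Submodule ℚ R} {𝔪 : Ideal R}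

/-- 𝔪 annihilates A ⊗ L and R = ℚ + 𝔪, so R-generators are already ℚ-generators. -/
theorem finite_rat_tensor (hR : IsConnectedGraded 𝓡 𝔪) {A L : Type} [AddCommGroup A] [Module R A]
    [AddCommGroup L] [Module R L] (u : A ≃ₗ[R] R ⧸ 𝔪) [Module.Finite R L]
    [Module ℚ (A ⊗[R] L)] [IsScalarTower ℚ R (A ⊗[R] L)] : Module.Finite ℚ (A ⊗[R] L) := by
  have : Module.Finite R A := Module.Finite.equiv u.symm
  refine finite_of_smul_eq (R := R) fun r => ?_
  obtain ⟨c, hc⟩ := hR.exists_sub_mem r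
  refine ⟨c, fun w => ?_⟩
  rw [← algebraMap_smul R c w, ← sub_eq_zero, ← sub_smul]
  obtain ⟨n, rfl⟩ := exists_one_tmul u w
  rw [← TensorProduct.tmul_smul, one_tmul_eq_zero_iff]
  exact Submodule.smul_mem_smul hc Submodule.mem_top

/-! ### Syzygies, projective dimension and the size of Tor -/

namespace GrMod

variable {M : GrMod R}

instance (p : ℕ) : Module.Projective R (M.res 𝓡 p).carrier :=
  inferInstanceAs (Module.Projective R ((M.syzIter 𝓡 p).Gen →₀ R))

instance : Module.Projective R (M.free 𝓡).carrier :=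
  inferInstanceAs (Module.Projective R (M.Gen →₀ R))

theorem isFGRetract_syzIter (hR : IsConnectedGraded 𝓡 𝔪) (hM : M.IsGraded 𝓡) [IsNoetherianRing R]
    [Module.Finite R M.carrier] (p : ℕ) : IsFGRetract R (M.syzIter 𝓡 p).carrier := by
  induction p with
  | zero => exact IsFGRetract.of_finite (hM := inferInstanceAs (Module.Finite R M.carrier))
  | succ p ih => exact ih.ker _ (cover_surjective (syzIter_isGraded hR hM p))

open CategoryTheory

/-- Dimension shifting along the short exact sequences 0 → syzygy → free → module → 0. -/
theorem hasProjectiveDimensionLT_syzIter (hR : IsConnectedGraded 𝓡 𝔪) (hM : M.IsGraded 𝓡)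
    (p k : ℕ) : HasProjectiveDimensionLT (ModuleCat.of R M.carrier) (p + k + 1) ↔
      HasProjectiveDimensionLT (ModuleCat.of R (M.syzIter 𝓡 p).carrier) (k + 1) := by
  induction p generalizing k with
  | zero => rw [zero_add]; rfl
  | succ p ih =>
    rw [show p + 1 + k + 1 = p + (k + 1) + 1 by ring, ih]
    have hS := LinearMap.shortExact_shortComplexKer
      (cover_surjective (𝓡 := 𝓡) (syzIter_isGraded hR hM p))
    exact hS.hasProjectiveDimensionLT_X₃_iff k
      ((IsProjective.iff_projective _).1 (inferInstanceAs (Module.Projective R (M.res 𝓡 p).carrier)))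

theorem hasProjectiveDimensionLT_succ_iff (hR : IsConnectedGraded 𝓡 𝔪) (hM : M.IsGraded 𝓡)
    (p : ℕ) : HasProjectiveDimensionLT (ModuleCat.of R M.carrier) (p + 1) ↔
      Module.Projective R (M.syzIter 𝓡 p).carrier := by
  rw [IsProjective.iff_projective, projective_iff_hasProjectiveDimensionLT_one]
  exact hasProjectiveDimensionLT_syzIter hR hM p 0

/-! ### The differentials of the complex `A ⊗ F_•` -/

variable {A : GrMod R}

theorem torBoundaries_eq_ker (hR : IsConnectedGraded 𝓡 𝔪) (hM : M.IsGraded 𝓡) (p : ℕ) :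
    torBoundaries 𝓡 A M p =
      LinearMap.ker (((M.syzIter 𝓡 p).cover 𝓡).lTensor A.carrier) :=
  range_lTensor_eq_ker A.carrier ((M.syzIter 𝓡 p).cover 𝓡)
    (cover_surjective (syzIter_isGraded hR hM p)) (((M.syzIter 𝓡 p).syz 𝓡).cover 𝓡)
    (cover_surjective (syzIter_isGraded hR hM (p + 1)))

theorem subsingleton_tor_iff (p : ℕ) : Subsingleton (tor 𝓡 A M p).carrier ↔
    torCycles 𝓡 A M p ≤ torBoundaries 𝓡 A M p := by
  rw [← Submodule.submoduleOf_eq_top]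
  exact Submodule.Quotient.subsingleton_iff

/-- For p = 0 this is Nakayama: M = 𝔪M forces M = 0. For p + 1, Tor_{p+1}(A, M) is Tor_1 of the p-th
syzygy, whose vanishing means that this syzygy is projective. -/
theorem subsingleton_tor_iff_hasProjectiveDimensionLT (hR : IsConnectedGraded 𝓡 𝔪)
    (hM : M.IsGraded 𝓡) (u : A.carrier ≃ₗ[R] R ⧸ 𝔪) (p : ℕ) :
    Subsingleton (tor 𝓡 A M p).carrier ↔
      HasProjectiveDimensionLT (ModuleCat.of R M.carrier) p := by
  rw [subsingleton_tor_iff, torBoundaries_eq_ker hR hM]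
  cases p with
  | zero =>
    rw [hasProjectiveDimensionLT_zero_iff_isZero, ModuleCat.isZero_iff_subsingleton]
    have hs := LinearMap.lTensor_surjective A.carrier (cover_surjective (𝓡 := 𝓡) hM)
    constructor
    · intro h
      have h1 : (⊤ : Submodule R M.carrier) ≤ ⊥ := by
        refine nakayama hR hM ⊥ ⊤ ?_ (fun _ _ _ => Submodule.mem_top) fun x _ => ?_
        · rintro i x hx
          rw [Submodule.mem_bot] at hx ⊢
          rw [hx, map_zero]
        · rw [bot_sup_eq, ← one_tmul_eq_zero_iff u]
          obtain ⟨z, hz⟩ := hs (u.symm 1 ⊗ₜ x)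
          rw [← hz]
          exact h (x := z) Submodule.mem_top
      exact (Submodule.subsingleton_iff R).1 (subsingleton_of_top_le_bot h1)
    · intro (h : Subsingleton M.carrier) z _
      obtain ⟨n, hn⟩ := exists_one_tmul u (((M.syzIter 𝓡 0).cover 𝓡).lTensor A.carrier z)
      have h0 : n = 0 := h.elim n 0
      rw [h0, TensorProduct.tmul_zero] at hn
      exact hn.symm
  | succ p =>
    rw [hasProjectiveDimensionLT_succ_iff hR hM]
    refine (ker_lTensor_le_iff A.carrier ((M.syzIter 𝓡 p).cover 𝓡)
      (((M.syzIter 𝓡 p).syz 𝓡).cover 𝓡)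
      (cover_surjective (syzIter_isGraded hR hM (p + 1)))).trans ⟨fun h => ?_, fun h => ?_⟩
    · exact projective_of_lTensor_injective hR (syzIter_isGraded hR hM p) u h
    · exact lTensor_injective_of_projective A.carrier ((M.syzIter 𝓡 p).cover 𝓡)
        (cover_surjective (syzIter_isGraded hR hM p))

theorem finite_tor (hR : IsConnectedGraded 𝓡 𝔪) (hM : M.IsGraded 𝓡) [IsNoetherianRing R]
    [Module.Finite R M.carrier] (u : A.carrier ≃ₗ[R] R ⧸ 𝔪) (p : ℕ) :
    Module.Finite ℚ (tor 𝓡 A M p).carrier := by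
  suffices ∃ (L : Type) (_ : AddCommGroup L) (_ : Module R L)
      (f : A.carrier ⊗[R] (M.res 𝓡 p).carrier →ₗ[R] A.carrier ⊗[R] L), Module.Finite R L ∧
      ∀ z, f z = 0 → z ∈ torCycles 𝓡 A M p → z ∈ torBoundaries 𝓡 A M p by
    obtain ⟨L, _, _, f, hL, hf⟩ := this
    have := finite_rat_tensor hR (A := A.carrier) (L := L) u
    exact finite_quotient_of_ker_le (f ∘ₗ (torCycles 𝓡 A M p).subtype) _ fun z hz => hf z hz z.2
  cases p with
  | zero =>
    refine ⟨M.carrier, _, _, (M.cover 𝓡).lTensor A.carrier, inferInstance, fun z hz _ => ?_⟩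
    rw [torBoundaries_eq_ker hR hM]
    exact hz
  | succ p =>
    rw [torBoundaries_eq_ker hR hM]
    exact (isFGRetract_syzIter hR hM p).exists_lTensor A.carrier
      ((M.syzIter 𝓡 p).cover 𝓡) (cover_surjective (syzIter_isGraded hR hM p))
      (((M.syzIter 𝓡 p).syz 𝓡).cover 𝓡)

/-! ### The grading of `Tor` -/

/-- The tensor product with a free module is a sum of shifted copies of A, where the grading is
evident; the pieces spanned by pure tensors map into it injectively. -/
theorem tensorPiece_isGrading (hA : IsGrading A.piece) (hA' : ∀ {i j : ℤ} {r : R} {x : A.carrier},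
    r ∈ 𝓡 i → x ∈ A.piece j → r • x ∈ A.piece (i + j)) (hR : IsConnectedGraded 𝓡 𝔪)
    (hM : M.IsGraded 𝓡) : IsGrading (tensorPiece A (M.free 𝓡)) := by
  classical
  let f : A.carrier ⊗[R] (M.Gen →₀ R) →ₗ[R] M.Gen →₀ A.carrier :=
    (TensorProduct.finsuppScalarRight R R A.carrier M.Gen).toLinearMap
  have hf : ∀ a g x, f (a ⊗ₜ g) x = g x • a := fun a g x =>
    TensorProduct.finsuppScalarRight_apply_tmul_apply a g x
  let L : ℤ → Submodule ℚ (M.Gen →₀ A.carrier) := fun i =>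
    { carrier := {f | ∀ x : M.Gen, f x ∈ A.piece (i - x.1.1)}
      add_mem' := fun hf hg x => Submodule.add_mem _ (hf x) (hg x)
      zero_mem' := fun _ => Submodule.zero_mem _
      smul_mem' := fun q _ hf x => Submodule.smul_mem _ q (hf x) }
  have hL : IsGrading L := hA.finsupp (fun x : M.Gen => x.1.1) L (fun _ _ => Iff.rfl)
  refine hL.of_injective (f.restrictScalars ℚ)
    (TensorProduct.finsuppScalarRight R R A.carrier M.Gen).injective ?_ ?_
  · intro q z hz
    refine Submodule.span_le (p := (L q).comap (f.restrictScalars ℚ)) |>.2 ?_ hz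
    rintro _ ⟨i, a, ha, g, hg, rfl⟩ x
    change f (a ⊗ₜ[R] (show M.Gen →₀ R from g)) x ∈ _
    rw [hf]
    have := hA' (hg x) ha
    rwa [show q - i - x.1.1 + i = q - x.1.1 by ring] at this
  · rw [eq_top_iff]
    rintro z -
    induction z using TensorProduct.induction_on with
    | zero => exact Submodule.zero_mem _
    | add x y hx hy => exact Submodule.add_mem _ hx hy
    | tmul a g =>
      refine hA.induction a (fun i a ha => ?_) ?_ (fun a a' h h' => ?_)
      · refine (free_isGraded hR hM).grading.induction g (fun j g hg => ?_) ?_ (fun g g' h h' => ?_)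
        · refine Submodule.mem_iSup_of_mem (i + j) (Submodule.subset_span ⟨i, a, ha, g, ?_, rfl⟩)
          rwa [add_sub_cancel_left]
        · rw [TensorProduct.tmul_zero]
          exact Submodule.zero_mem _
        · rw [TensorProduct.tmul_add]
          exact Submodule.add_mem _ h h'
      · rw [TensorProduct.zero_tmul]
        exact Submodule.zero_mem _
      · rw [TensorProduct.add_tmul]
        exact Submodule.add_mem _ h h'

theorem lTensor_resD_mem (hR : IsConnectedGraded 𝓡 𝔪) (hM : M.IsGraded 𝓡) (p : ℕ) (q : ℤ) :
    ∀ z ∈ tensorPiece A (M.res 𝓡 (p + 1)) q,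
      (M.resD 𝓡 p).lTensor A.carrier z ∈ tensorPiece A (M.res 𝓡 p) q := by
  intro z hz
  refine Submodule.span_le (p := (tensorPiece A (M.res 𝓡 p) q).comap
    (((M.resD 𝓡 p).lTensor A.carrier).restrictScalars ℚ)) |>.2 ?_ hz
  rintro _ ⟨i, a, ha, g, hg, rfl⟩
  exact Submodule.subset_span ⟨i, a, ha, _,
    cover_mem (syz_isGraded hR (syzIter_isGraded hR hM p)) hg, rfl⟩

theorem tor_isGrading (hA : IsGrading A.piece) (hA' : ∀ {i j : ℤ} {r : R} {x : A.carrier},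
    r ∈ 𝓡 i → x ∈ A.piece j → r • x ∈ A.piece (i + j)) (hR : IsConnectedGraded 𝓡 𝔪)
    (hM : M.IsGraded 𝓡) (p : ℕ) : IsGrading (tor 𝓡 A M p).piece := by
  have h : ∀ p, IsGrading (tensorPiece A (M.res 𝓡 p)) := fun p =>
    tensorPiece_isGrading hA hA' hR (syzIter_isGraded hR hM p)
  refine (h p).subquotient (torCycles 𝓡 A M p) (torBoundaries 𝓡 A M p) ?_
    ((h (p + 1)).proj_mem_range (h p) ((M.resD 𝓡 p).lTensor A.carrier) (Equiv.refl ℤ)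
      (lTensor_resD_mem hR hM p))
  cases p with
  | zero => exact fun _ _ _ => Submodule.mem_top
  | succ p =>
    exact (h (p + 1)).proj_mem_ker (h p) ((M.resD 𝓡 p).lTensor A.carrier) id
      Function.injective_id (lTensor_resD_mem hR hM p)

theorem quot_isGrading (hR : IsConnectedGraded 𝓡 𝔪) : IsGrading (quot 𝓡 𝔪).piece := by
  refine hR.grading.map (Ideal.Quotient.mkₐ ℚ 𝔪).toLinearMap Ideal.Quotient.mk_surjective
    fun i x hx => ?_
  have hx : x ∈ 𝔪 := Ideal.Quotient.eq_zero_iff_mem.1 hx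
  refine Ideal.Quotient.eq_zero_iff_mem.2 ?_
  have := hR.grading.proj_mem i x
  rcases lt_trichotomy i 0 with hi | rfl | hi
  · rw [hR.eq_bot_of_neg hi, Submodule.mem_bot] at this
    rw [this]
    exact 𝔪.zero_mem
  · rw [hR.proj_zero hx]
    exact 𝔪.zero_mem
  · exact hR.mem_of_pos hi this

theorem quot_smul_mem (hR : IsConnectedGraded 𝓡 𝔪) {i j : ℤ} {r : R} {x : (quot 𝓡 𝔪).carrier}
    (hr : r ∈ 𝓡 i) (hx : x ∈ (quot 𝓡 𝔪).piece j) : r • x ∈ (quot 𝓡 𝔪).piece (i + j) := by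
  obtain ⟨y, hy, rfl⟩ := hx
  exact ⟨r * y, hR.mul_mem hr hy, rfl⟩

/-! ### Betti numbers and projective dimension -/

theorem betti_ne_zero_iff (hR : IsConnectedGraded 𝓡 𝔪) (hM : M.IsGraded 𝓡) [IsNoetherianRing R]
    [Module.Finite R M.carrier] (p : ℕ) (q : ℤ) :
    betti 𝓡 𝔪 M p q ≠ 0 ↔ (tor 𝓡 (quot 𝓡 𝔪) M p).piece q ≠ ⊥ := by
  -- Needed because `finrank` is also 0 on infinite-dimensional spaces.
  have := finite_tor (A := quot 𝓡 𝔪) hR hM (LinearEquiv.refl R (R ⧸ 𝔪)) p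
  rw [betti, Ne, Submodule.finrank_eq_zero]

theorem finite_betti_ne_zero (hR : IsConnectedGraded 𝓡 𝔪) (hM : M.IsGraded 𝓡) [IsNoetherianRing R]
    [Module.Finite R M.carrier] (p : ℕ) : {q | betti 𝓡 𝔪 M p q ≠ 0}.Finite := by
  have := finite_tor (A := quot 𝓡 𝔪) hR hM (LinearEquiv.refl R (R ⧸ 𝔪)) p
  simp only [betti_ne_zero_iff hR hM]
  exact WellFoundedGT.finite_ne_bot_of_iSupIndep
    (tor_isGrading (quot_isGrading hR) (quot_smul_mem hR) hR hM p).indep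

theorem forall_betti_eq_zero_iff (hR : IsConnectedGraded 𝓡 𝔪) (hM : M.IsGraded 𝓡)
    [IsNoetherianRing R] [Module.Finite R M.carrier] (p : ℕ) :
    (∀ q, betti 𝓡 𝔪 M p q = 0) ↔ HasProjectiveDimensionLT (ModuleCat.of R M.carrier) p := by
  rw [← subsingleton_tor_iff_hasProjectiveDimensionLT (A := quot 𝓡 𝔪) hR hM
    (LinearEquiv.refl R (R ⧸ 𝔪)) p]
  have h := tor_isGrading (quot_isGrading hR) (quot_smul_mem hR) hR hM p
  have h1 : ∀ q, betti 𝓡 𝔪 M p q = 0 ↔ (tor 𝓡 (quot 𝓡 𝔪) M p).piece q = ⊥ := fun q =>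
    not_iff_not.1 (betti_ne_zero_iff hR hM p q)
  simp only [h1]
  constructor
  · intro h2
    have h3 := h.span
    rw [funext h2, iSup_bot] at h3
    exact (Submodule.subsingleton_iff ℚ).1 (subsingleton_of_bot_eq_top h3)
  · intro h2 q
    exact Subsingleton.elim _ _

end GrMod

end HOMFLYPT

end

noncomputable section

namespace HOMFLYPT

/-! ## Hilbert's syzygy theorem -/

section Syzygy

open CategoryTheory

theorem hasProjectiveDimensionLE_succ_of_exact {R : Type} [CommRing R] {X Y Z : Type}
    [AddCommGroup X] [Module R X] [AddCommGroup Y] [Module R Y] [AddCommGroup Z] [Module R Z]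
    (f : X →ₗ[R] Y) (g : Y →ₗ[R] Z) (hf : Function.Injective f) (hg : Function.Surjective g)
    (h : Function.Exact f g) {n : ℕ} (hX : HasProjectiveDimensionLE (ModuleCat.of R X) n)
    (hY : HasProjectiveDimensionLE (ModuleCat.of R Y) (n + 1)) :
    HasProjectiveDimensionLE (ModuleCat.of R Z) (n + 1) := by
  let S := ShortComplex.moduleCatMk f g (by ext x; exact h.apply_apply_eq_zero x)
  have hS : S.ShortExact := ModuleCat.shortComplex_shortExact S h hf hg
  exact hS.hasProjectiveDimensionLT_X₃ (n + 1) hX hY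

theorem hasProjectiveDimensionLE_of_projective {R : Type} [CommRing R] (X : Type)
    [AddCommGroup X] [Module R X] [h : Module.Projective R X] (n : ℕ) :
    HasProjectiveDimensionLE (ModuleCat.of R X) n := by
  rw [IsProjective.iff_projective] at h
  exact hasProjectiveDimensionLT_of_ge _ 1 _ (by omega)

theorem hasProjectiveDimensionLE_baseChange_succ {R S F M : Type} [CommRing R] [CommRing S]
    [Algebra R S] [Module.Flat R S] [AddCommGroup F] [Module R F] [Module.Projective R F]
    [AddCommGroup M] [Module R M] (c : F →ₗ[R] M) (hc : Function.Surjective c) {n : ℕ}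
    (h : HasProjectiveDimensionLE (ModuleCat.of S (S ⊗[R] LinearMap.ker c)) n) :
    HasProjectiveDimensionLE (ModuleCat.of S (S ⊗[R] M)) (n + 1) := by
  have he : Function.Exact ((LinearMap.ker c).subtype.lTensor S) (c.lTensor S) :=
    lTensor_exact S (LinearMap.exact_subtype_ker_map c) hc
  exact hasProjectiveDimensionLE_succ_of_exact
    ((LinearMap.ker c).subtype.baseChange S) (c.baseChange S)
    (Module.Flat.lTensor_preserves_injective_linearMap (M := S) (LinearMap.ker c).subtype
      Subtype.val_injective)
    (LinearMap.lTensor_surjective S hc) he h (hasProjectiveDimensionLE_of_projective _ _)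

/-- Induction over a free cover: flatness keeps the sequence of the kernel exact, and base change
keeps projectives projective. -/
theorem hasProjectiveDimensionLE_baseChange {R S : Type} [CommRing R] [CommRing S] [Algebra R S]
    [Module.Flat R S] (n : ℕ) (M : Type) [AddCommGroup M] [Module R M]
    (h : HasProjectiveDimensionLE (ModuleCat.of R M) n) :
    HasProjectiveDimensionLE (ModuleCat.of S (S ⊗[R] M)) n := by
  induction n generalizing M with
  | zero =>
    rw [← projective_iff_hasProjectiveDimensionLE_zero, ← IsProjective.iff_projective] at h ⊢
    infer_instance
  | succ n ih =>
    let c : (M →₀ R) →ₗ[R] M := Finsupp.linearCombination R id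
    have hc : Function.Surjective c := Finsupp.linearCombination_id_surjective R M
    have hK : HasProjectiveDimensionLE (ModuleCat.of R (LinearMap.ker c)) n :=
      ((LinearMap.shortExact_shortComplexKer hc).hasProjectiveDimensionLT_X₃_iff n
        ((IsProjective.iff_projective _).1 inferInstance)).1 h
    exact hasProjectiveDimensionLE_baseChange_succ c hc (ih _ hK)

open Polynomial in
-- Uses the exact sequence 0 → R[X] ⊗ M → R[X] ⊗ M → M → 0 with first map f ⊗ m ↦ Xf ⊗ m - f ⊗ Xm
-- and second map f ⊗ m ↦ fm. Base change bounds the first two terms by n.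
theorem hasProjectiveDimensionLE_polynomial {R : Type} [CommRing R] {n : ℕ}
    (h : ∀ (M : Type) [AddCommGroup M] [Module R M], HasProjectiveDimensionLE (ModuleCat.of R M) n)
    (M : Type) [AddCommGroup M] [Module R[X] M] :
    HasProjectiveDimensionLE (ModuleCat.of R[X] M) (n + 1) := by
  let _ : Module R M := Module.compHom M (C : R →+* R[X])
  have : IsScalarTower R R[X] M := ⟨fun r f m => by
    rw [Polynomial.smul_eq_C_mul, mul_smul]
    rfl⟩
  let x : M →ₗ[R] M := LinearMap.lsmul R[X] M X |>.restrictScalars R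
  let d : R[X] ⊗[R] M →ₗ[R[X]] R[X] ⊗[R] M :=
    LinearMap.lsmul R[X] (R[X] ⊗[R] M) X - x.baseChange R[X]
  let ev : R[X] ⊗[R] M →ₗ[R[X]] M := LinearMap.liftBaseChange R[X] LinearMap.id
  have hd : ∀ (f : R[X]) (m : M), d (f ⊗ₜ m) = (X * f) ⊗ₜ m - f ⊗ₜ ((X : R[X]) • m) :=
    fun f m => rfl
  have hev : ∀ (f : R[X]) (m : M), ev (f ⊗ₜ m) = f • m := fun f m => by simp [ev]
  have hevd : ∀ z, ev (d z) = 0 := by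
    intro z
    induction z using TensorProduct.induction_on with
    | zero => simp
    | add x y hx hy => rw [map_add, map_add, hx, hy, add_zero]
    | tmul f m => rw [hd, map_sub, hev, hev, mul_comm, mul_smul, sub_self]
  have hT : HasProjectiveDimensionLE (ModuleCat.of R[X] (R[X] ⊗[R] M)) n :=
    hasProjectiveDimensionLE_baseChange n M (h M)
  refine hasProjectiveDimensionLE_succ_of_exact d ev ?_ (fun m => ⟨1 ⊗ₜ m, by simp [hev]⟩) ?_ hT
    (hasProjectiveDimensionLT_of_ge _ (n + 1) _ (by omega))
  · rw [injective_iff_map_eq_zero]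
    intro z hz
    -- `c j` reads off the coefficient of X^j. On the kernel of `d` it satisfies `c j z = X • c (j +
    -- 1) z`, and the coefficients vanish for large `j`, hence all do by descent.
    let c : ℕ → R[X] ⊗[R] M →ₗ[R] M := fun j =>
      TensorProduct.lift ((LinearMap.lsmul R M).comp (Polynomial.lcoeff R j))
    have hc : ∀ j f m, c j (f ⊗ₜ m) = f.coeff j • m := fun j f m => rfl
    have hcd : ∀ j z, c (j + 1) (d z) = c j z - (X : R[X]) • c (j + 1) z := by
      intro j z
      induction z using TensorProduct.induction_on with
      | zero => simp
      | add x y hx hy => simp only [map_add, hx, hy, smul_add]; abel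
      | tmul f m =>
        rw [hd, map_sub, hc, hc, hc, hc, Polynomial.coeff_X_mul, smul_comm]
    have hsum : ∀ z : R[X] ⊗[R] M, ∃ N, (∀ j ≥ N, c j z = 0) ∧
        ∀ L ≥ N, z = ∑ j ∈ Finset.range L, (X ^ j : R[X]) ⊗ₜ[R] c j z := by
      intro z
      induction z using TensorProduct.induction_on with
      | zero => exact ⟨0, by simp, by simp⟩
      | add x y hx hy =>
        obtain ⟨N, h1, h2⟩ := hx
        obtain ⟨N', h1', h2'⟩ := hy
        refine ⟨max N N', fun j hj => ?_, fun L hL => ?_⟩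
        · rw [map_add, h1 j (le_trans (le_max_left _ _) hj),
            h1' j (le_trans (le_max_right _ _) hj), add_zero]
        · simp only [map_add, TensorProduct.tmul_add, Finset.sum_add_distrib]
          rw [← h2 L (le_trans (le_max_left _ _) hL), ← h2' L (le_trans (le_max_right _ _) hL)]
      | tmul f m =>
        refine ⟨f.natDegree + 1, fun j hj => ?_, fun L hL => ?_⟩
        · rw [hc, Polynomial.coeff_eq_zero_of_natDegree_lt hj, zero_smul]
        · conv_lhs => rw [f.as_sum_range' L hL, TensorProduct.sum_tmul]
          refine Finset.sum_congr rfl fun j _ => ?_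
          rw [hc, ← TensorProduct.smul_tmul, Polynomial.smul_X_eq_monomial]
    obtain ⟨N, h1, h2⟩ := hsum z
    have h3 : ∀ k j, N ≤ j + k → c j z = 0 := by
      intro k
      induction k with
      | zero => exact h1
      | succ k ih =>
        intro j hj
        have := hcd j z
        rw [hz, map_zero, ih (j + 1) (by omega), smul_zero, sub_zero] at this
        exact this.symm
    rw [h2 N le_rfl]
    refine Finset.sum_eq_zero fun j _ => ?_
    rw [h3 N j (by omega), TensorProduct.tmul_zero]
  -- Modulo the image of `d`, powers of X can be moved across the tensor sign, so every `z` is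
  -- congruent to `1 ⊗ ev z`.
  · have key : ∀ z, z - 1 ⊗ₜ ev z ∈ LinearMap.range d := by
      intro z
      induction z using TensorProduct.induction_on with
      | zero => simp
      | add x y hx hy =>
        rw [map_add, TensorProduct.tmul_add, add_sub_add_comm]
        exact Submodule.add_mem _ hx hy
      | tmul f m =>
        rw [hev]
        induction f using Polynomial.induction_on generalizing m with
        | C a =>
          have : (C a : R[X]) ⊗ₜ[R] m = 1 ⊗ₜ[R] ((C a : R[X]) • m) := by
            rw [← mul_one (C a), ← Polynomial.smul_eq_C_mul, TensorProduct.smul_tmul, smul_assoc,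
              one_smul]
          rw [this, sub_self]
          exact Submodule.zero_mem _
        | add f g hf hg =>
          rw [TensorProduct.add_tmul, add_smul, TensorProduct.tmul_add, add_sub_add_comm]
          exact Submodule.add_mem _ (hf m) (hg m)
        | monomial k a ih =>
          have h1 := Submodule.add_mem _ (LinearMap.mem_range_self d ((C a * X ^ k) ⊗ₜ m))
            (ih ((X : R[X]) • m))
          rw [hd, sub_add_sub_cancel, ← mul_smul] at h1
          rwa [show C a * X ^ (k + 1) = X * (C a * X ^ k) by ring, mul_comm X] at *
    intro z
    refine ⟨fun hz => ?_, ?_⟩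
    · have := key z
      rw [hz, TensorProduct.tmul_zero, sub_zero] at this
      exact this
    · rintro ⟨y, rfl⟩
      exact hevd y

theorem hasProjectiveDimensionLE_of_ringEquiv {R R' : Type} [CommRing R] [CommRing R']
    (e : R ≃+* R') {n : ℕ}
    (h : ∀ (M : Type) [AddCommGroup M] [Module R M], HasProjectiveDimensionLE (ModuleCat.of R M) n)
    (M : Type) [AddCommGroup M] [Module R' M] :
    HasProjectiveDimensionLE (ModuleCat.of R' M) n := by
  let _ : Module R M := Module.compHom M e.toRingHom
  have := h M
  let _ := RingHomInvPair.of_ringEquiv e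
  let _ := RingHomInvPair.of_ringEquiv e.symm
  exact ModuleCat.hasProjectiveDimensionLE_of_semiLinearEquiv (M := ModuleCat.of R M)
    (N := ModuleCat.of R' M) e
    { toFun := id
      invFun := id
      map_add' := fun _ _ => rfl
      map_smul' := fun _ _ => rfl
      left_inv := fun _ => rfl
      right_inv := fun _ => rfl } n

/-- Hilbert's syzygy theorem. -/
theorem exists_hasProjectiveDimensionLE_mvPolynomial (σ : Type) [Finite σ] :
    ∃ n, ∀ (M : Type) [AddCommGroup M] [Module (MvPolynomial σ ℚ) M],
      HasProjectiveDimensionLE (ModuleCat.of (MvPolynomial σ ℚ) M) n := by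
  induction σ using Finite.induction_empty_option with
  | of_equiv e h =>
    obtain ⟨n, hn⟩ := h
    exact ⟨n, hasProjectiveDimensionLE_of_ringEquiv
      (MvPolynomial.renameEquiv ℚ e).toRingEquiv hn⟩
  | h_empty =>
    refine ⟨0, hasProjectiveDimensionLE_of_ringEquiv
      (MvPolynomial.isEmptyAlgEquiv ℚ PEmpty).symm.toRingEquiv ?_⟩
    intro M _ _
    exact hasProjectiveDimensionLE_of_projective M 0
  | h_option h =>
    obtain ⟨n, hn⟩ := h
    exact ⟨n + 1, hasProjectiveDimensionLE_of_ringEquiv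
      (MvPolynomial.optionEquivLeft ℚ _).symm.toRingEquiv
      (hasProjectiveDimensionLE_polynomial hn)⟩

end Syzygy

end HOMFLYPT

end

noncomputable section

namespace HOMFLYPT

/-! ## Polynomial rings as connected graded rings -/

open CategoryTheory in
/-- A connected graded ring that behaves like a polynomial ring. -/
structure IsRegularGraded {R : Type} [CommRing R] [Algebra ℚ R] (𝓡 : ℤ → Submodule ℚ R)
    (𝔪 : Ideal R) : Prop extends IsConnectedGraded 𝓡 𝔪 where
  noetherian : IsNoetherianRing R
  exists_pd_le : ∃ n, ∀ (M : Type) [AddCommGroup M] [Module R M],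
    HasProjectiveDimensionLE (ModuleCat.of R M) n

theorem IsRegularGraded.of_algEquiv {R S : Type} [CommRing R] [Algebra ℚ R] [CommRing S]
    [Algebra ℚ S] {𝓡 : ℤ → Submodule ℚ R} {𝔪 : Ideal R} {𝓢 : ℤ → Submodule ℚ S} {𝔫 : Ideal S}
    (h : IsRegularGraded 𝓢 𝔫) (e : R ≃ₐ[ℚ] S) (h₁ : ∀ i a, a ∈ 𝓡 i ↔ e a ∈ 𝓢 i)
    (h₂ : ∀ a, a ∈ 𝔪 ↔ e a ∈ 𝔫) : IsRegularGraded 𝓡 𝔪 := by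
  have hg : IsGrading 𝓡 := by
    have := h.grading.comap e.toLinearMap e.injective
      (fun a y => ⟨e.symm (h.grading.proj a (e y)), e.apply_symm_apply _⟩)
    convert this using 2 with i
    ext a
    exact h₁ i a
  refine ⟨⟨hg, ?_, ?_, ?_, ?_, ?_, ?_⟩, ?_, ?_⟩
  · rw [h₁, map_one]
    exact h.one_mem
  · intro i j a b ha hb
    rw [h₁] at ha hb ⊢
    rw [map_mul]
    exact h.mul_mem ha hb
  · intro i hi
    refine (Submodule.eq_bot_iff _).2 fun a ha => ?_
    rw [h₁, h.eq_bot_of_neg hi, Submodule.mem_bot] at ha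
    exact e.injective (by rw [ha, map_zero])
  · intro a ha
    obtain ⟨c, hc⟩ := h.eq_algebraMap ((h₁ 0 a).1 ha)
    exact ⟨c, e.injective (by rw [hc, AlgEquiv.commutes])⟩
  · intro i a hi ha
    exact (h₂ a).2 (h.mem_of_pos hi ((h₁ i a).1 ha))
  · intro a ha
    have := hg.map_proj h.grading e.toLinearMap id Function.injective_id
      (fun i a ha => (h₁ i a).1 ha) 0 a
    exact e.injective (this.trans ((h.proj_zero ((h₂ a).1 ha)).trans (map_zero e).symm))
  · have := h.noetherian
    exact isNoetherianRing_of_ringEquiv S e.symm.toRingEquiv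
  · obtain ⟨n, hn⟩ := h.exists_pd_le
    exact ⟨n, hasProjectiveDimensionLE_of_ringEquiv e.symm.toRingEquiv hn⟩

open MvPolynomial

variable {σ τ : Type}

theorem weight_two_eq (d : σ →₀ ℕ) :
    Finsupp.weight (fun _ => (2 : ℤ)) d = 2 * (d.degree : ℕ) := by
  rw [Finsupp.weight_apply, Finsupp.sum, Finsupp.degree_apply, Nat.cast_sum, Finset.mul_sum]
  exact Finset.sum_congr rfl fun i _ => by rw [nsmul_eq_mul, mul_comm]

theorem mem_polyPiece_iff {i : ℤ} {f : MvPolynomial σ ℚ} :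
    f ∈ polyPiece σ i ↔ ∀ d, coeff d f ≠ 0 → 2 * ((d.degree : ℕ) : ℤ) = i := by
  simp only [← weight_two_eq]
  rfl

theorem X_mem_polyPiece (c : σ) : (X c : MvPolynomial σ ℚ) ∈ polyPiece σ 2 :=
  isWeightedHomogeneous_X ℚ _ c

theorem mul_mem_polyPiece {i j : ℤ} {f g : MvPolynomial σ ℚ} (hf : f ∈ polyPiece σ i)
    (hg : g ∈ polyPiece σ j) : f * g ∈ polyPiece σ (i + j) :=
  IsWeightedHomogeneous.mul hf hg

theorem aeval_mem_polyPiece (φ : σ → MvPolynomial τ ℚ) (hφ : ∀ c, φ c ∈ polyPiece τ 2) {i : ℤ}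
    {f : MvPolynomial σ ℚ} (hf : f ∈ polyPiece σ i) : aeval φ f ∈ polyPiece τ i := by
  rw [aeval_def, eval₂_eq]
  refine Submodule.sum_mem _ fun d hd => ?_
  rw [← Algebra.smul_def]
  refine Submodule.smul_mem _ _ ?_
  have h1 := IsWeightedHomogeneous.prod (R := ℚ) (w := fun _ : τ => (2 : ℤ)) d.support
    (fun c => φ c ^ d c) (fun c => d c • (2 : ℤ)) (fun c _ => (hφ c).pow _)
  have h2 : ∑ c ∈ d.support, d c • (2 : ℤ) = i := by
    rw [← mem_polyPiece_iff.1 hf d (mem_support_iff.1 hd), ← weight_two_eq, Finsupp.weight_apply]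
    rfl
  rw [h2] at h1
  exact h1

theorem polyPiece_isGrading (σ : Type) : IsGrading (polyPiece σ) := by
  classical
  let _ := weightedDecomposition ℚ (fun _ : σ => (2 : ℤ))
  have h := DirectSum.Decomposition.isInternal (weightedHomogeneousSubmodule ℚ (fun _ : σ => (2 : ℤ)))
  exact ⟨h.submodule_iSupIndep, h.submodule_iSup_eq_top⟩

theorem eq_C_of_mem_polyPiece_zero {f : MvPolynomial σ ℚ} (hf : f ∈ polyPiece σ 0) :
    f = C (coeff 0 f) := by
  classical
  ext d
  rw [coeff_C]
  split_ifs with hd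
  · rw [hd]
  · by_contra h
    have := mem_polyPiece_iff.1 hf d h
    have h0 : d.degree = 0 := by omega
    exact hd ((Finsupp.degree_eq_zero_iff d).1 h0).symm

theorem proj_polyPiece_zero (f : MvPolynomial σ ℚ) :
    (polyPiece_isGrading σ).proj 0 f = C (coeff 0 f) := by
  refine (polyPiece_isGrading σ).induction f (fun i f hf => ?_) (by simp)
    (fun f g hf hg => by rw [map_add, hf, hg, coeff_add, map_add])
  by_cases hi : i = 0
  · subst hi
    rw [(polyPiece_isGrading σ).proj_of_mem hf]
    exact eq_C_of_mem_polyPiece_zero hf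
  · rw [(polyPiece_isGrading σ).proj_of_mem_ne hf hi]
    by_cases h0 : coeff 0 f = 0
    · rw [h0, map_zero]
    · exact absurd (mem_polyPiece_iff.1 hf 0 h0) (by simpa using Ne.symm hi)

theorem polyPiece_isConnectedGraded (σ : Type) :
    IsConnectedGraded (polyPiece σ) (Ideal.span (Set.range X)) where
  grading := polyPiece_isGrading σ
  one_mem := isWeightedHomogeneous_one ℚ _
  mul_mem := mul_mem_polyPiece
  eq_bot_of_neg := by
    intro i hi
    refine (Submodule.eq_bot_iff _).2 fun f hf => ?_
    ext d
    by_contra hd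
    have := mem_polyPiece_iff.1 hf d hd
    omega
  eq_algebraMap := fun hf => ⟨_, eq_C_of_mem_polyPiece_zero hf⟩
  mem_of_pos := by
    intro i f hi hf
    rw [← Set.image_univ, mem_ideal_span_X_image]
    intro d hd
    have := mem_polyPiece_iff.1 hf d (mem_support_iff.1 hd)
    by_contra! h
    have h0 : d = 0 := Finsupp.ext fun c => h c (Set.mem_univ c)
    rw [h0, map_zero] at this
    simp only [Nat.cast_zero, mul_zero] at this
    omega
  proj_zero := by
    intro f hf
    rw [proj_polyPiece_zero, ← map_zero C]
    congr 1
    by_contra h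
    rw [← Set.image_univ, mem_ideal_span_X_image] at hf
    obtain ⟨c, _, hc⟩ := hf 0 (mem_support_iff.2 h)
    exact hc rfl

theorem polyPiece_isRegularGraded (σ : Type) [Finite σ] :
    IsRegularGraded (polyPiece σ) (Ideal.span (Set.range X)) where
  toIsConnectedGraded := polyPiece_isConnectedGraded σ
  noetherian := inferInstance
  exists_pd_le := exists_hasProjectiveDimensionLE_mvPolynomial σ

theorem redPoly.diff_mem_redPolyPiece (c d : σ) : redPoly.diff c d ∈ redPolyPiece σ 2 :=
  Submodule.sub_mem _ (X_mem_polyPiece c) (X_mem_polyPiece d)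

open Classical in
/-- `ℚ[X_c - X_d]` is a polynomial ring in the differences `X_c - X_{c₀}`. -/
def redPolyEquiv (c₀ : σ) : redPoly σ ≃ₐ[ℚ] MvPolynomial {c : σ // c ≠ c₀} ℚ :=
  let G : MvPolynomial σ ℚ →ₐ[ℚ] MvPolynomial {c : σ // c ≠ c₀} ℚ :=
    aeval fun c => if h : c = c₀ then 0 else X ⟨c, h⟩
  let f : MvPolynomial {c : σ // c ≠ c₀} ℚ →ₐ[ℚ] redPoly σ := aeval fun c => redPoly.diff c.1 c₀
  AlgEquiv.ofAlgHom (G.comp (redPoly σ).val) f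
    (by
      refine algHom_ext fun c => ?_
      simp [G, f, redPoly.diff, c.2])
    (by
      have h : redPoly σ ≤ AlgHom.equalizer (((redPoly σ).val.comp f).comp G)
          (AlgHom.id ℚ (MvPolynomial σ ℚ)) := by
        refine Algebra.adjoin_le ?_
        rintro _ ⟨c, d, rfl⟩
        have h1 : ∀ c, (redPoly σ).val (f (G (X c))) = X c - X c₀ := by
          intro c
          by_cases hc : c = c₀
          · simp [G, hc]
          · simp [G, f, hc, redPoly.diff]
        change (redPoly σ).val (f (G (X c - X d))) = X c - X d
        rw [map_sub, map_sub, map_sub, h1, h1, sub_sub_sub_cancel_right]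
      ext y
      exact congrArg _ (h y.2))

theorem redPoly_isRegularGraded (σ : Type) [Finite σ] [Nonempty σ] :
    IsRegularGraded (redPolyPiece σ) (Ideal.span {f | ∃ c d, f = redPoly.diff (σ := σ) c d}) := by
  classical
  obtain ⟨c₀⟩ := ‹Nonempty σ›
  have he : ∀ y, redPolyEquiv c₀ y =
    aeval (fun c => if h : c = c₀ then 0 else X ⟨c, h⟩) (y : MvPolynomial σ ℚ) := by
    intro y; rfl
  have hs : ∀ y, (redPolyEquiv c₀).symm y = aeval (fun c => redPoly.diff c.1 c₀) y := by
    intro y; rfl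
  refine (polyPiece_isRegularGraded {c : σ // c ≠ c₀}).of_algEquiv (redPolyEquiv c₀) ?_ ?_
  · intro i a
    constructor
    · intro ha
      rw [he]
      refine aeval_mem_polyPiece _ (fun c => ?_) ha
      split_ifs
      · exact Submodule.zero_mem _
      · exact X_mem_polyPiece _
    · intro ha
      rw [← (redPolyEquiv c₀).symm_apply_apply a, hs]
      change (redPoly σ).val _ ∈ polyPiece σ i
      rw [← AlgHom.comp_apply, comp_aeval]
      exact aeval_mem_polyPiece _ (fun c => redPoly.diff_mem_redPolyPiece _ _) ha
  · intro a
    constructor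
    · intro ha
      refine Submodule.span_le (p := (Ideal.span (Set.range X)).comap (redPolyEquiv c₀)) |>.2 ?_ ha
      rintro _ ⟨c, d, rfl⟩
      have h1 : ∀ c, aeval (R := ℚ) (S₁ := MvPolynomial {c : σ // c ≠ c₀} ℚ)
          (fun c => if h : c = c₀ then 0 else X ⟨c, h⟩) (X c) ∈ Ideal.span (Set.range X) := by
        intro c
        rw [aeval_X]
        split_ifs
        · exact Ideal.zero_mem _
        · exact Ideal.subset_span ⟨_, rfl⟩
      rw [SetLike.mem_coe, Ideal.mem_comap, he]
      have h2 := Ideal.sub_mem _ (h1 c) (h1 d)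
      rwa [← map_sub] at h2
    · intro ha
      rw [← (redPolyEquiv c₀).symm_apply_apply a]
      refine Submodule.span_le (p := (Ideal.span _).comap (redPolyEquiv c₀).symm) |>.2 ?_ ha
      rintro _ ⟨c, rfl⟩
      rw [SetLike.mem_coe, Ideal.mem_comap, hs, aeval_X]
      exact Ideal.subset_span ⟨_, _, rfl⟩

end HOMFLYPT

end

noncomputable section

namespace HOMFLYPT

/-! ## The double complex of a family of crossings -/

section HomologyActions

variable {A : Type} [CommRing A] {M : Type} [AddCommGroup M] [Module A M]

/-- An element that acts null-homotopically acts by zero on the iterated homology. -/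
theorem smul_eq_zero_of_homotopy (d e k : M →ₗ[A] M) (h : ∀ x, d (e x) = e (d x))
    (hk : ∀ x, d (k x) = k (d x)) (t : A) (ht : ∀ x, e (k x) + k (e x) = t • x)
    (x : Hlgy (hlgyMap d e h)) : t • x = 0 := by
  obtain ⟨⟨z, hz⟩, rfl⟩ := Submodule.Quotient.mk_surjective _ x
  rw [← Submodule.Quotient.mk_smul, Submodule.Quotient.mk_eq_zero]
  refine ⟨hlgyMap d k hk z, ?_⟩
  change hlgyMap d e h (hlgyMap d k hk z) = t • z
  have key : hlgyMap d e h (hlgyMap d k hk z) + hlgyMap d k hk (hlgyMap d e h z) = t • z := by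
    obtain ⟨m, rfl⟩ := Submodule.Quotient.mk_surjective _ z
    exact congrArg (Submodule.Quotient.mk (p := (LinearMap.range d).submoduleOf (LinearMap.ker d)))
      (Subtype.ext (ht m.1))
  rw [LinearMap.mem_ker.1 hz, map_zero, add_zero] at key
  exact key

theorem smul_mem_hlgySub {S : Type} [CommRing S] [Algebra S A] [Module S M] [IsScalarTower S A M]
    (d : M →ₗ[A] M) {P Q : Submodule S M} {a : A} (h : ∀ x ∈ P, a • x ∈ Q) :
    ∀ x ∈ hlgySub d P, a • x ∈ hlgySub d Q := by
  rintro _ ⟨x, hx, rfl⟩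
  exact ⟨a • x, h _ hx, rfl⟩

theorem hlgySub_bot {S : Type} [CommRing S] [Algebra S A] [Module S M] [IsScalarTower S A M]
    (d : M →ₗ[A] M) : hlgySub d (⊥ : Submodule S M) = ⊥ := by
  refine (Submodule.eq_bot_iff _).2 ?_
  rintro _ ⟨x, hx, rfl⟩
  have : x = 0 := Subtype.ext hx
  rw [this, map_zero]

end HomologyActions

namespace CubeData

variable {A : Type} [CommRing A]

/-! ### The homotopy of a crossing -/

/-- The coefficient `t / verCoef`. -/
def htpyCoef (D : CubeData A) (c : Fin D.n) (h : Bool) : A :=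
  if h = D.positive c then D.t c else 1

theorem verCoef_mul_htpyCoef (D : CubeData A) (c : Fin D.n) (h : Bool) :
    D.verCoef c h * D.htpyCoef c h = D.t c := by
  unfold verCoef htpyCoef
  split_ifs <;> ring

/-- The map that inverts the vertical map of the square of a crossing up to `t`. -/
def verHtpy (D : CubeData A) (c : Fin D.n) : D.Cx →ₗ[A] D.Cx where
  toFun f x := if x.2 c then 0 else
    D.sgn x.2 c * D.htpyCoef c (x.1 c) * f (x.1, Function.update x.2 c true)
  map_add' f g := by
    funext x
    simp only [Pi.add_apply]
    split_ifs <;> ring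
  map_smul' a f := by
    funext x
    simp only [Pi.smul_apply, smul_eq_mul, RingHom.id_apply]
    split_ifs <;> ring

theorem verHtpy_apply (D : CubeData A) (c : Fin D.n) (f : D.Cx) (x : Vertex D.n) :
    D.verHtpy c f x = if x.2 c then 0 else
      D.sgn x.2 c * D.htpyCoef c (x.1 c) *
        f (x.1, Function.update x.2 c true) := rfl

theorem dPlus_apply (D : CubeData A) (f : D.Cx) (x : Vertex D.n) :
    D.dPlus f x = ∑ c, if x.1 c then
      D.sgn x.1 c * D.horCoef c (x.2 c) * f (Function.update x.1 c false, x.2) else 0 := rfl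

theorem dV_apply (D : CubeData A) (f : D.Cx) (x : Vertex D.n) :
    D.dV f x = ∑ c, if x.2 c then
      D.sgn x.2 c * D.verCoef c (x.1 c) * f (x.1, Function.update x.2 c false) else 0 := rfl

/-- At the crossing `c` itself both composites have coefficient s t up to sign; at the other
crossings the maps act on different tensor factors. -/
theorem dPlus_verHtpy (D : CubeData A) (c : Fin D.n) (f : D.Cx) :
    D.dPlus (D.verHtpy c f) = D.verHtpy c (D.dPlus f) := by
  funext x
  rw [verHtpy_apply]
  simp only [dPlus_apply, verHtpy_apply]
  by_cases hx : x.2 c = true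
  · simp [hx]
  simp only [hx, if_false, Bool.false_eq_true]
  rw [Finset.mul_sum]
  refine Finset.sum_congr rfl fun c' _ => ?_
  by_cases hc' : x.1 c' = true
  · simp only [hc', if_true]
    by_cases h : c = c'
    · subst h
      have hx' : x.2 c = false := by simpa using hx
      simp only [Function.update_self, hc', hx', horCoef, htpyCoef]
      cases D.positive c <;> simp <;> ring
    · rw [Function.update_of_ne h, Function.update_of_ne (Ne.symm h)]
      ring
  · simp [hc']

theorem sgn_mul_self (D : CubeData A) (u : Fin D.n → Bool) (c : Fin D.n) :
    D.sgn u c * D.sgn u c = 1 := by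
  rw [sgn, ← mul_pow]
  simp

theorem sgn_update_self (D : CubeData A) (u : Fin D.n → Bool) (c : Fin D.n) (b : Bool) :
    D.sgn (Function.update u c b) c = D.sgn u c := by
  unfold sgn
  congr 2
  refine Finset.filter_congr fun c' _ => and_congr_right fun h => ?_
  rw [Function.update_of_ne h.ne]

theorem sgn_update_of_le (D : CubeData A) (u : Fin D.n → Bool) {c c' : Fin D.n} (h : c ≤ c')
    (b : Bool) : D.sgn (Function.update u c' b) c = D.sgn u c := by
  unfold sgn
  congr 2
  refine Finset.filter_congr fun c'' _ => and_congr_right fun h' => ?_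
  rw [Function.update_of_ne (h'.trans_le h).ne]

theorem sgn_update_true (D : CubeData A) (u : Fin D.n → Bool) {c c' : Fin D.n} (h : c' < c) :
    D.sgn (Function.update u c' true) c = -D.sgn (Function.update u c' false) c := by
  unfold sgn
  have : Finset.univ.filter (fun x => x < c ∧ Function.update u c' true x = true) =
      insert c' (Finset.univ.filter (fun x => x < c ∧ Function.update u c' false x = true)) := by
    ext x
    by_cases hx : x = c'
    · subst hx
      simp [h]
    · simp [hx]
  rw [this, Finset.card_insert_of_notMem (by simp), pow_succ, mul_neg_one]

/-- Removing `c'` and adding `c` anticommute in the cube. -/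
theorem sgn_mul_sgn (D : CubeData A) (u : Fin D.n → Bool) {c c' : Fin D.n} (h : c' ≠ c)
    (hc : u c = false) (hc' : u c' = true) :
    D.sgn u c' * D.sgn (Function.update u c' false) c +
      D.sgn u c * D.sgn (Function.update u c true) c' = 0 := by
  have h1 : Function.update u c' true = u := by rw [← hc', Function.update_eq_self]
  have h2 : Function.update u c false = u := by rw [← hc, Function.update_eq_self]
  rcases lt_or_gt_of_ne h with h | h
  · rw [D.sgn_update_of_le u h.le, ← neg_eq_iff_eq_neg.2 (D.sgn_update_true u h), h1]
    ring
  · rw [D.sgn_update_of_le u h.le, D.sgn_update_true u h, h2]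
    ring

/-- The contributions of crossings `c' ≠ c` cancel by the sign rule `sgn_mul_sgn`; the crossing `c`
contributes vertical map times inverse, which is `t`. -/
theorem dV_verHtpy (D : CubeData A) (c : Fin D.n) (f : D.Cx) :
    D.dV (D.verHtpy c f) + D.verHtpy c (D.dV f) = D.t c • f := by
  funext x
  rw [Pi.add_apply, verHtpy_apply, Pi.smul_apply, smul_eq_mul]
  simp only [dV_apply, verHtpy_apply]
  by_cases hx : x.2 c = true
  · simp only [hx, if_true, add_zero]
    rw [Finset.sum_eq_single c]
    · simp only [hx, if_true, Function.update_self, Bool.false_eq_true, if_false,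
        Function.update_idem]
      rw [sgn_update_self, ← hx, Function.update_eq_self]
      linear_combination (D.verCoef c (x.1 c) * D.htpyCoef c (x.1 c) * f x) *
        D.sgn_mul_self x.2 c + f x * D.verCoef_mul_htpyCoef c (x.1 c)
    · intro c' _ hc'
      simp [Function.update_of_ne (Ne.symm hc'), hx]
    · simp
  · have hx' : x.2 c = false := by simpa using hx
    simp only [hx', if_false, Bool.false_eq_true]
    rw [Finset.mul_sum, ← Finset.sum_add_distrib, Finset.sum_eq_single c]
    · simp only [hx', if_true, Function.update_self, Bool.false_eq_true, if_false,
        Function.update_idem]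
      rw [sgn_update_self, ← hx', Function.update_eq_self]
      linear_combination (D.verCoef c (x.1 c) * D.htpyCoef c (x.1 c) * f x) *
        D.sgn_mul_self x.2 c + f x * D.verCoef_mul_htpyCoef c (x.1 c)
    · intro c' _ hc'
      by_cases h' : x.2 c' = true
      · simp only [h', if_true, Function.update_of_ne hc', Function.update_of_ne (Ne.symm hc'), hx',
          Bool.false_eq_true, if_false]
        rw [Function.update_comm hc']
        linear_combination (D.verCoef c' (x.1 c') *
          D.htpyCoef c (x.1 c) *
          f (x.1, Function.update (Function.update x.2 c true) c' false)) *
          D.sgn_mul_sgn x.2 hc' hx' h'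
      · simp [h', Function.update_of_ne hc']
    · simp

theorem t_smul_HH (D : CubeData A) (c : Fin D.n) (x : D.HH) : D.t c • x = 0 :=
  smul_eq_zero_of_homotopy _ _ (D.verHtpy c) _ (D.dPlus_verHtpy c) _ (D.dV_verHtpy c) x

end CubeData

end HOMFLYPT

end

noncomputable section

namespace HOMFLYPT

namespace CubeData

variable {A : Type} [CommRing A]

/-! ### The gradings of the double complex -/

theorem cxPart_isGrading (D : CubeData A) :
    IsGrading fun p : ℤ × ℤ => D.cxPart p.1 p.2 := by
  classical
  let π : ℤ × ℤ → D.Cx →ₗ[A] D.Cx := fun p =>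
    LinearMap.pi fun x => if D.deg₂ x = p.1 ∧ D.deg₃ x = p.2 then LinearMap.proj x else 0
  have hπ : ∀ p f x, π p f x = if D.deg₂ x = p.1 ∧ D.deg₃ x = p.2 then f x else 0 := by
    intro p f x
    simp only [π, LinearMap.pi_apply]
    split_ifs <;> rfl
  refine IsGrading.of_proj π (fun p f hf => ?_) (fun p q hpq f hf => ?_) ?_
  · funext x
    rw [hπ]
    split_ifs with h
    · rfl
    · exact (hf x h).symm
  · funext x
    rw [hπ]
    split_ifs with h
    · exact hf x fun h' => hpq (Prod.ext (h'.1.symm.trans h.1) (h'.2.symm.trans h.2))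
    · rfl
  · rw [eq_top_iff]
    rintro f -
    rw [← Finset.univ_sum_single f]
    refine Submodule.sum_mem _ fun x _ => ?_
    refine Submodule.mem_iSup_of_mem (D.deg₂ x, D.deg₃ x) fun y hy => ?_
    rw [Pi.single_apply]
    split_ifs with h
    · exact absurd (by simp [h]) hy
    · rfl

theorem sum_sub_sum_eq {n : ℕ} (F G : Fin n → ℤ) (c : Fin n) (h : ∀ c', c' ≠ c → F c' = G c') :
    ∑ i, F i = ∑ i, G i + (F c - G c) := by
  rw [← sub_eq_iff_eq_add', ← Finset.sum_sub_distrib]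
  exact Finset.sum_eq_single c (fun c' _ hc' => sub_eq_zero.2 (h c' hc')) (by simp)

section Shift

variable {A : Type} (D : CubeData A) {x : Vertex D.n} {c : Fin D.n}

theorem deg₂_update (h : x.1 c = true) :
    D.deg₂ x = D.deg₂ (Function.update x.1 c false, x.2) + 2 := by
  unfold deg₂
  rw [sum_sub_sum_eq _ (fun i => if Function.update x.1 c false i = true then 0 else -2) c
    (fun c' hc' => by rw [Function.update_of_ne hc'])]
  simp [h]

theorem deg₃_update (h : x.2 c = true) :
    D.deg₃ x = D.deg₃ (x.1, Function.update x.2 c false) + 2 := by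
  unfold deg₃
  rw [sum_sub_sum_eq _ (fun i => if D.positive i = true then
    (if Function.update x.2 c false i = true then 0 else -2) else
    (if Function.update x.2 c false i = true then 2 else 0)) c
    (fun c' hc' => by rw [Function.update_of_ne hc'])]
  cases D.positive c <;> simp [h]

/-- The jump -2 occurs exactly in the row whose horizontal map is s t instead of s, so it
compensates the extra degree of `t`. -/
theorem deg₁_update_fst (h : x.1 c = true) :
    D.deg₁ x = D.deg₁ (Function.update x.1 c false, x.2) +
      if x.2 c = D.positive c then 0 else -2 := by
  unfold deg₁
  rw [sum_sub_sum_eq _ (fun i => if D.positive i = true then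
    (if Function.update x.1 c false i = false ∧ x.2 i = false then 2 else 0) else
    (if Function.update x.1 c false i = true ∧ x.2 i = true then -2 else 0)) c
    (fun c' hc' => by rw [Function.update_of_ne hc'])]
  cases D.positive c <;> cases h2 : x.2 c <;> simp [h]

theorem deg₁_update_snd (h : x.2 c = true) :
    D.deg₁ x = D.deg₁ (x.1, Function.update x.2 c false) +
      if x.1 c = D.positive c then 0 else -2 := by
  unfold deg₁
  rw [sum_sub_sum_eq _ (fun i => if D.positive i = true then
    (if x.1 i = false ∧ Function.update x.2 c false i = false then 2 else 0) else
    (if x.1 i = true ∧ Function.update x.2 c false i = true then -2 else 0)) c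
    (fun c' hc' => by rw [Function.update_of_ne hc'])]
  cases D.positive c <;> cases h2 : x.1 c <;> simp [h]

end Shift

theorem dPlus_mem_cxPart (D : CubeData A) {j k : ℤ} {f : D.Cx} (hf : f ∈ D.cxPart j k) :
    D.dPlus f ∈ D.cxPart (j + 2) k := by
  intro x hx
  rw [dPlus_apply]
  refine Finset.sum_eq_zero fun c _ => ?_
  split_ifs with h
  · rw [hf (Function.update x.1 c false, x.2)
      fun h' => hx ⟨by rw [D.deg₂_update h, h'.1], h'.2⟩, mul_zero]
  · rfl

theorem dV_mem_cxPart (D : CubeData A) {j k : ℤ} {f : D.Cx} (hf : f ∈ D.cxPart j k) :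
    D.dV f ∈ D.cxPart j (k + 2) := by
  intro x hx
  rw [dV_apply]
  refine Finset.sum_eq_zero fun c _ => ?_
  split_ifs with h
  · rw [hf (x.1, Function.update x.2 c false)
      fun h' => hx ⟨h'.1, by rw [D.deg₃_update h, h'.2]⟩, mul_zero]
  · rfl

/-- The part of degree `(j, k)` vanishes unless some vertex has this degree. -/
theorem finite_cxPart_ne_bot (D : CubeData A) :
    {p : ℤ × ℤ | D.cxPart p.1 p.2 ≠ ⊥}.Finite := by
  refine (Set.finite_range fun x : Vertex D.n => (D.deg₂ x, D.deg₃ x)).subset fun p hp => ?_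
  by_contra h
  refine hp ((Submodule.eq_bot_iff _).2 fun f hf => funext fun x => hf x fun h' => h ⟨x, ?_⟩)
  exact Prod.ext h'.1 h'.2

/-- The differentials shift the bidegree by (2, 0) and (0, 2), so both homologies inherit the
decomposition. -/
theorem hhPart_isGrading (D : CubeData A) : IsGrading fun p : ℤ × ℤ => D.hhPart p.1 p.2 := by
  have h1 := D.cxPart_isGrading.hlgySub D.dPlus (Equiv.addRight (2, 0))
    (fun p f hf => by simpa using D.dPlus_mem_cxPart hf)
  refine h1.hlgySub (hlgyMap D.dPlus D.dV D.dPlus_dV) (Equiv.addRight (0, 2)) fun p => ?_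
  exact hlgyMap_mem_hlgySub D.dPlus D.dV D.dPlus_dV
    (fun f hf => by simpa using D.dV_mem_cxPart hf)

theorem finite_hhPart_ne_bot (D : CubeData A) :
    {p : ℤ × ℤ | D.hhPart p.1 p.2 ≠ ⊥}.Finite := by
  refine D.finite_cxPart_ne_bot.subset fun p hp h => hp ?_
  rw [hhPart, h, hlgySub_bot, hlgySub_bot]

/-! ### The grading by the first degree -/

/-- The conditions on the grading of the base ring of a double complex. -/
structure IsGraded [Algebra ℚ A] (D : CubeData A) (𝒜 : ℤ → Submodule ℚ A) : Prop where
  grading : IsGrading 𝒜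
  one_mem : 1 ∈ 𝒜 0
  mul_mem : ∀ {i j : ℤ} {a b : A}, a ∈ 𝒜 i → b ∈ 𝒜 j → a * b ∈ 𝒜 (i + j)
  eq_bot_of_neg : ∀ {i : ℤ}, i < 0 → 𝒜 i = ⊥
  s_mem : ∀ c, D.s c ∈ 𝒜 2
  t_mem : ∀ c, D.t c ∈ 𝒜 2

variable [Algebra ℚ A] {D : CubeData A} {𝒜 : ℤ → Submodule ℚ A}

theorem cxPiece_isGrading (h𝒜 : IsGrading 𝒜) :
    IsGrading fun a : ℤ × ℤ × ℤ => D.cxPiece 𝒜 a.1 a.2.1 a.2.2 := by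
  classical
  let π : ℤ × ℤ × ℤ → D.Cx →ₗ[ℚ] D.Cx := fun a =>
    LinearMap.pi fun x => if D.deg₂ x = a.2.1 ∧ D.deg₃ x = a.2.2 then
      h𝒜.proj (a.1 - D.deg₁ x) ∘ₗ LinearMap.proj x else 0
  have hπ : ∀ a f x, π a f x = if D.deg₂ x = a.2.1 ∧ D.deg₃ x = a.2.2 then
      h𝒜.proj (a.1 - D.deg₁ x) (f x) else 0 := by
    intro p f x
    simp only [π, LinearMap.pi_apply]
    split_ifs <;> rfl
  refine IsGrading.of_proj π (fun a f hf => ?_) (fun a b hab f hf => ?_) ?_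
  · funext x
    rw [hπ]
    split_ifs with h
    · exact h𝒜.proj_of_mem (hf.2 x)
    · exact (hf.1 x h).symm
  · funext x
    rw [hπ]
    split_ifs with h
    · by_cases h' : D.deg₂ x = a.2.1 ∧ D.deg₃ x = a.2.2
      · refine h𝒜.proj_of_mem_ne (hf.2 x) fun h1 => hab ?_
        exact Prod.ext (by simpa using h1)
          (Prod.ext (h'.1.symm.trans h.1) (h'.2.symm.trans h.2))
      · rw [hf.1 x h', map_zero]
        rfl
    · rfl
  · rw [eq_top_iff]
    rintro f -
    rw [← Finset.univ_sum_single f]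
    refine Submodule.sum_mem _ fun x _ => ?_
    refine h𝒜.induction (f x) (fun i a ha => ?_) (by simp) (fun a b ha hb => ?_)
    · refine Submodule.mem_iSup_of_mem (i + D.deg₁ x, D.deg₂ x, D.deg₃ x)
        ⟨fun y hy => ?_, fun y => ?_⟩
      · rw [Pi.single_apply]
        split_ifs with h
        · exact absurd (by simp [h]) hy
        · rfl
      · rw [Pi.single_apply]
        split_ifs with h
        · subst h; simpa using ha
        · exact Submodule.zero_mem _
    · rw [Pi.single_add]
      exact Submodule.add_mem _ ha hb

namespace IsGraded

theorem sgn_mul_mem (u : Fin D.n → Bool) (c : Fin D.n) {i : ℤ} {a : A} (ha : a ∈ 𝒜 i) :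
    D.sgn u c * a ∈ 𝒜 i := by
  unfold sgn
  rcases neg_one_pow_eq_or A
    (Finset.univ.filter (fun c' => c' < c ∧ u c' = true)).card with h1 | h1 <;> rw [h1]
  · rwa [one_mul]
  · rw [neg_one_mul]
    exact Submodule.neg_mem _ ha

theorem horCoef_mem (h : D.IsGraded 𝒜) (c : Fin D.n) (v : Bool) :
    D.horCoef c v ∈ 𝒜 (2 - if v = D.positive c then 0 else -2) := by
  unfold horCoef
  split_ifs
  · exact h.s_mem c
  · exact h.mul_mem (h.s_mem c) (h.t_mem c)

theorem verCoef_mem (h : D.IsGraded 𝒜) (c : Fin D.n) (v : Bool) :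
    D.verCoef c v ∈ 𝒜 (-if v = D.positive c then 0 else -2) := by
  unfold verCoef
  split_ifs
  · exact h.one_mem
  · exact h.t_mem c

theorem dPlus_mem_cxPiece (h : D.IsGraded 𝒜) {i j k : ℤ} {f : D.Cx} (hf : f ∈ D.cxPiece 𝒜 i j k) :
    D.dPlus f ∈ D.cxPiece 𝒜 (i + 2) (j + 2) k := by
  refine ⟨D.dPlus_mem_cxPart hf.1, fun x => ?_⟩
  rw [dPlus_apply]
  refine Submodule.sum_mem _ fun c _ => ?_
  split_ifs with hc
  · rw [mul_assoc]
    refine sgn_mul_mem _ _ ?_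
    have h1 := h.mul_mem (h.horCoef_mem c (x.2 c)) (hf.2 (Function.update x.1 c false, x.2))
    rw [D.deg₁_update_fst hc]
    convert h1 using 2
    ring
  · exact Submodule.zero_mem _

theorem dV_mem_cxPiece (h : D.IsGraded 𝒜) {i j k : ℤ} {f : D.Cx} (hf : f ∈ D.cxPiece 𝒜 i j k) :
    D.dV f ∈ D.cxPiece 𝒜 i j (k + 2) := by
  refine ⟨D.dV_mem_cxPart hf.1, fun x => ?_⟩
  rw [dV_apply]
  refine Submodule.sum_mem _ fun c _ => ?_
  split_ifs with hc
  · rw [mul_assoc]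
    refine sgn_mul_mem _ _ ?_
    have h1 := h.mul_mem (h.verCoef_mem c (x.1 c)) (hf.2 (x.1, Function.update x.2 c false))
    rw [D.deg₁_update_snd hc]
    convert h1 using 2
    ring
  · exact Submodule.zero_mem _

theorem hhPiece_isGrading (h : D.IsGraded 𝒜) :
    IsGrading fun a : ℤ × ℤ × ℤ => D.hhPiece 𝒜 a.1 a.2.1 a.2.2 := by
  have h1 := (cxPiece_isGrading (D := D) h.grading).hlgySub D.dPlus (Equiv.addRight (2, 2, 0))
    (fun p f hf => by simpa using h.dPlus_mem_cxPiece hf)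
  refine h1.hlgySub (hlgyMap D.dPlus D.dV D.dPlus_dV) (Equiv.addRight (0, 0, 2)) fun p => ?_
  exact hlgyMap_mem_hlgySub D.dPlus D.dV D.dPlus_dV
    (fun f hf => by simpa using h.dV_mem_cxPiece hf)

theorem exists_hhPiece_eq_bot (h : D.IsGraded 𝒜) : ∃ d : ℤ, ∀ i < d, ∀ j k, D.hhPiece 𝒜 i j k = ⊥ := by
  -- A crude common lower bound for the degrees of the finitely many generators; the base ring has
  -- no negative degrees.
  refine ⟨-∑ x, |D.deg₁ x|, fun i hi j k => ?_⟩
  have : D.cxPiece 𝒜 i j k = ⊥ := by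
    refine (Submodule.eq_bot_iff _).2 fun f hf => funext fun x => ?_
    have h1 := hf.2 x
    have h2 : |D.deg₁ x| ≤ ∑ x, |D.deg₁ x| :=
      Finset.single_le_sum (f := fun x => |D.deg₁ x|) (fun _ _ => abs_nonneg _) (Finset.mem_univ x)
    have h3 := neg_abs_le (D.deg₁ x)
    rw [h.eq_bot_of_neg (by omega), Submodule.mem_bot] at h1
    exact h1
  rw [hhPiece, this, hlgySub_bot, hlgySub_bot]

theorem smul_mem_hhPiece (h : D.IsGraded 𝒜) {i l j k : ℤ} {a : A} (ha : a ∈ 𝒜 i) :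
    ∀ x ∈ D.hhPiece 𝒜 l j k, a • x ∈ D.hhPiece 𝒜 (i + l) j k := by
  refine smul_mem_hlgySub _ (smul_mem_hlgySub _ fun f hf => ?_)
  refine ⟨Submodule.smul_mem _ _ hf.1, fun x => ?_⟩
  rw [add_sub_assoc]
  exact h.mul_mem ha (hf.2 x)

end IsGraded

theorem hhPiece_le_hhPart (i j k : ℤ) : ∀ x ∈ D.hhPiece 𝒜 i j k, x ∈ D.hhPart j k :=
  hlgySub_mono _ (hlgySub_mono _ fun _ hf => hf.1)

end CubeData

end HOMFLYPT

end

/-! ### The parts of the homology as graded modules, and their direct sum -/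

noncomputable section

namespace HOMFLYPT

namespace CubeData

open CategoryTheory

variable {A : Type} [CommRing A] [Algebra ℚ A] {R : Type} [CommRing R] [Algebra ℚ R]
  {D : CubeData A} {𝒜 : ℤ → Submodule ℚ A} {𝓡 : ℤ → Submodule ℚ R} {φ : R →ₐ[ℚ] A}

theorem graded_piece_isGrading (h : D.IsGraded 𝒜) (a : ℤ × ℤ × ℤ) (j k : ℤ) :
    IsGrading (D.graded 𝒜 φ a j k).piece := by
  refine h.hhPiece_isGrading.restrict D.hhPart_isGrading (fun b => b.2)
    (fun b => hhPiece_le_hhPart _ _ _) (j - a.2.1, k - a.2.2)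
    (fun i : ℤ => (i - a.1, j - a.2.1, k - a.2.2)) (fun i l hil => ?_) (fun b => ⟨fun hb => ?_, ?_⟩)
  · simpa using congrArg Prod.fst hil
  · exact ⟨b.1 + a.1, Prod.ext (add_sub_cancel_right _ _) hb.symm⟩
  · rintro ⟨i, rfl⟩
    rfl

theorem graded_isGraded (h : D.IsGraded 𝒜) (hφ : ∀ {i r}, r ∈ 𝓡 i → φ r ∈ 𝒜 i)
    (a : ℤ × ℤ × ℤ) (j k : ℤ) : (D.graded 𝒜 φ a j k).IsGraded 𝓡 where
  grading := graded_piece_isGrading h a j k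
  smul_mem := by
    rintro i l r x hr hx
    have := h.smul_mem_hhPiece (hφ hr) _ hx
    rw [← add_sub_assoc] at this
    exact this
  bdd := by
    obtain ⟨d, hd⟩ := h.exists_hhPiece_eq_bot
    refine ⟨d + a.1, fun i hi => (Submodule.eq_bot_iff _).2 ?_⟩
    rintro (x : D.hhPart _ _) hx
    have h1 : (x : D.HH) ∈ D.hhPiece 𝒜 (i - a.1) (j - a.2.1) (k - a.2.2) := hx
    rw [hd _ (by omega), Submodule.mem_bot] at h1
    exact Subtype.ext h1

/-- The part is finite over A as a subquotient of a finite free module over a noetherian ring; since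
A acts through R, the same generators suffice over R. -/
theorem graded_finite [IsNoetherianRing A] (hact : ∀ b : A, ∃ r : R, ∀ x : D.HH, b • x = φ r • x)
    (a : ℤ × ℤ × ℤ) (j k : ℤ) : Module.Finite R (D.graded 𝒜 φ a j k).carrier := by
  have h1 : Module.Finite A (D.hhPart (j - a.2.1) (k - a.2.2)) := inferInstance
  let _ : Module R (D.hhPart (j - a.2.1) (k - a.2.2)) := Module.compHom _ φ.toRingHom
  refine finite_of_smul_eq (R := A) (W := D.hhPart (j - a.2.1) (k - a.2.2)) fun b => ?_
  obtain ⟨r, hr⟩ := hact b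
  exact ⟨r, fun w => Subtype.ext (hr w)⟩

/-! ### The decomposition of the total homology -/

/-- Inserting the decomposition of the identity writes every Ext class of X as a sum of classes
factoring through Ext groups of the `Y a`, which vanish. -/
theorem hasProjectiveDimensionLT_of_sum_eq_id {C : Type*} [Category C] [Abelian C] {ι : Type*}
    [Fintype ι] {X : C} {Y : ι → C} (i : ∀ a, Y a ⟶ X) (p : ∀ a, X ⟶ Y a)
    (h : ∑ a, p a ≫ i a = 𝟙 X) {n : ℕ} (hY : ∀ a, HasProjectiveDimensionLT (Y a) n) :
    HasProjectiveDimensionLT X n := by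
  let := HasExt.standard C
  rw [hasProjectiveDimensionLT_iff]
  intro l hl Z e
  rw [← e.mk₀_id_comp, ← h, Abelian.Ext.mk₀_sum, Abelian.Ext.sum_comp]
  refine Finset.sum_eq_zero fun a _ => ?_
  rw [← Abelian.Ext.mk₀_comp_mk₀, Abelian.Ext.comp_assoc_of_second_deg_zero,
    ((Abelian.Ext.mk₀ (i a)).comp e (zero_add l)).eq_zero_of_hasProjectiveDimensionLT n hl,
    Abelian.Ext.comp_zero]

/-- The inclusion of a graded part into the total homology. -/
def ofGraded (D : CubeData A) (𝒜 : ℤ → Submodule ℚ A) (φ : R →ₐ[ℚ] A) (a : ℤ × ℤ × ℤ) (j k : ℤ) :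
    ModuleCat.of R (D.graded 𝒜 φ a j k).carrier ⟶ D.total φ :=
  ModuleCat.ofHom (Y := D.total φ)
    { toFun := fun x => (D.hhPart (j - a.2.1) (k - a.2.2)).subtype x
      map_add' := fun _ _ => rfl
      map_smul' := fun _ _ => rfl }

/-- The projection of the total homology to a graded part. -/
def toGraded (D : CubeData A) (𝒜 : ℤ → Submodule ℚ A) (φ : R →ₐ[ℚ] A) (a : ℤ × ℤ × ℤ) (j k : ℤ) :
    D.total φ ⟶ ModuleCat.of R (D.graded 𝒜 φ a j k).carrier :=
  ModuleCat.ofHom (X := D.total φ)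
    { toFun := fun x => D.hhPart_isGrading.projTo (j - a.2.1, k - a.2.2) x
      map_add' := fun x y => map_add (D.hhPart_isGrading.projTo (j - a.2.1, k - a.2.2)) x y
      map_smul' := fun r x =>
        map_smul (D.hhPart_isGrading.projTo (j - a.2.1, k - a.2.2)) (φ r)
          (show D.HH from x) }

theorem ofGraded_toGraded (a : ℤ × ℤ × ℤ) (j k : ℤ) :
    D.ofGraded 𝒜 φ a j k ≫ D.toGraded 𝒜 φ a j k = 𝟙 _ := by
  ext x
  exact D.hhPart_isGrading.projTo_of_mem (a := (j - a.2.1, k - a.2.2)) x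

theorem total_hasProjectiveDimensionLT_iff (a : ℤ × ℤ × ℤ) (n : ℕ) :
    HasProjectiveDimensionLT (D.total φ) n ↔ ∀ j k,
      HasProjectiveDimensionLT (ModuleCat.of R (D.graded 𝒜 φ a j k).carrier) n := by
  constructor
  · intro h j k
    exact Retract.hasProjectiveDimensionLT
      ⟨D.ofGraded 𝒜 φ a j k, D.toGraded 𝒜 φ a j k, ofGraded_toGraded a j k⟩ n
  · intro h
    let T := D.finite_hhPart_ne_bot.toFinset
    refine hasProjectiveDimensionLT_of_sum_eq_id (ι := T)
      -- Adding the shift back makes the part indexed by `p` equal to `hhPart` in the unshifted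
      -- bidegree `p`.
      (fun p => D.ofGraded 𝒜 φ a (p.1.1 + a.2.1) (p.1.2 + a.2.2))
      (fun p => D.toGraded 𝒜 φ a (p.1.1 + a.2.1) (p.1.2 + a.2.2)) ?_ (fun p => h _ _)
    have hp := D.hhPart_isGrading
    have h1 : ∀ (p : ℤ × ℤ) (x : D.total φ), (D.toGraded 𝒜 φ a (p.1 + a.2.1) (p.2 + a.2.2) ≫
        D.ofGraded 𝒜 φ a (p.1 + a.2.1) (p.2 + a.2.2)).hom x = hp.proj p (show D.HH from x) := by
      intro p x
      change hp.proj (p.1 + a.2.1 - a.2.1, p.2 + a.2.2 - a.2.2) (show D.HH from x) = _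
      rw [add_sub_cancel_right, add_sub_cancel_right]
    ext x
    rw [ModuleCat.hom_sum, LinearMap.sum_apply]
    refine (Finset.sum_congr rfl fun p _ => h1 p.1 x).trans ?_
    refine (Finset.sum_coe_sort T (fun p => hp.proj p (show D.HH from x))).trans ?_
    refine hp.sum_proj T (fun p hp' => ?_) x
    by_contra h2
    exact hp' ((Set.Finite.mem_toFinset _).2 h2)

end CubeData

end HOMFLYPT

end

noncomputable section

namespace HOMFLYPT

/-! ## The double complex of a closed braid -/

/-- An ideal with homogeneous generators contains the components of its elements, so the grading
descends to the quotient. -/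
theorem IsConnectedGraded.quotient_isGrading {R : Type} [CommRing R] [Algebra ℚ R]
    {𝓡 : ℤ → Submodule ℚ R} {𝔪 : Ideal R} (hR : IsConnectedGraded 𝓡 𝔪) {T : Set R} {d : ℤ}
    (hT : ∀ x ∈ T, x ∈ 𝓡 d) :
    IsGrading fun i => (𝓡 i).map (Ideal.Quotient.mkₐ ℚ (Ideal.span T)).toLinearMap := by
  refine hR.grading.map _ (Ideal.Quotient.mkₐ_surjective ℚ _) fun i x hx => ?_
  have hmem : x ∈ Ideal.span T := Ideal.Quotient.eq_zero_iff_mem.1 hx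
  refine Ideal.Quotient.eq_zero_iff_mem.2 ?_
  clear hx
  induction hmem using Submodule.span_induction generalizing i with
  | mem x hx =>
    by_cases hi : d = i
    · subst hi
      rw [hR.grading.proj_of_mem (hT x hx)]
      exact Ideal.subset_span hx
    · rw [hR.grading.proj_of_mem_ne (hT x hx) hi]
      exact Ideal.zero_mem _
  | zero =>
    rw [map_zero]
    exact Ideal.zero_mem _
  | add x y _ _ hx hy =>
    rw [map_add]
    exact Ideal.add_mem _ (hx i) (hy i)
  | smul a x _ hx =>
    refine hR.grading.induction a (fun k a ha => ?_) ?_ (fun a b ha hb => ?_)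
    · obtain ⟨s, hs⟩ := hR.grading.exists_sum x
      rw [hs, Finset.smul_sum, map_sum]
      refine Ideal.sum_mem _ fun l _ => ?_
      have h1 := hR.mul_mem ha (hR.grading.proj_mem l x)
      rw [smul_eq_mul]
      by_cases hi : k + l = i
      · subst hi
        rw [hR.grading.proj_of_mem h1]
        exact Ideal.mul_mem_left _ _ (hx l)
      · rw [hR.grading.proj_of_mem_ne h1 hi]
        exact Ideal.zero_mem _
    · rw [zero_smul, map_zero]
      exact Ideal.zero_mem _
    · rw [add_smul, map_add]
      exact Ideal.add_mem _ ha hb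

theorem CubeData.IsGraded.of_quotient {R : Type} [CommRing R] [Algebra ℚ R]
    {𝓡 : ℤ → Submodule ℚ R} {𝔪 : Ideal R} (hR : IsConnectedGraded 𝓡 𝔪) {T : Set R} {d : ℤ}
    (hT : ∀ x ∈ T, x ∈ 𝓡 d) (D : CubeData (R ⧸ Ideal.span T))
    (hs : ∀ c, ∃ x ∈ 𝓡 2, D.s c = Ideal.Quotient.mk _ x)
    (ht : ∀ c, ∃ x ∈ 𝓡 2, D.t c = Ideal.Quotient.mk _ x) :
    D.IsGraded fun i => (𝓡 i).map (Ideal.Quotient.mkₐ ℚ (Ideal.span T)).toLinearMap where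
  grading := hR.quotient_isGrading hT
  one_mem := ⟨1, hR.one_mem, map_one (Ideal.Quotient.mk _)⟩
  mul_mem := by
    rintro i j _ _ ⟨a, ha, rfl⟩ ⟨b, hb, rfl⟩
    exact ⟨a * b, hR.mul_mem ha hb, map_mul (Ideal.Quotient.mk _) a b⟩
  eq_bot_of_neg := fun hi => by rw [hR.eq_bot_of_neg hi, Submodule.map_bot]
  s_mem := fun c => by
    obtain ⟨x, hx, h⟩ := hs c
    exact ⟨x, hx, h.symm⟩
  t_mem := fun c => by
    obtain ⟨x, hx, h⟩ := ht c
    exact ⟨x, hx, h.symm⟩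

open MvPolynomial

theorem rename_mem_polyPiece {σ τ : Type} (g : σ → τ) {i : ℤ} {f : MvPolynomial σ ℚ}
    (hf : f ∈ polyPiece σ i) : rename g f ∈ polyPiece τ i := by
  rw [rename_eq_aeval]
  exact aeval_mem_polyPiece _ (fun c => X_mem_polyPiece (g c)) hf

theorem redPoly.adjoin_diff {σ : Type} :
    Algebra.adjoin ℚ {f : redPoly σ | ∃ c d, f = redPoly.diff c d} = ⊤ := by
  refine Eq.trans (congrArg _ ?_) (Algebra.adjoin_adjoin_coe_preimage (R := ℚ)
    (s := {f : MvPolynomial σ ℚ | ∃ c d, f = X c - X d}))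
  ext f
  exact exists₂_congr fun c d => Subtype.ext_iff

theorem redRename_diff {σ τ : Type} (g : σ → τ) (c d : σ) :
    redRename g (redPoly.diff c d) = redPoly.diff (g c) (g d) := by
  refine Subtype.ext ?_
  change rename g (X c - X d : MvPolynomial σ ℚ) = X (g c) - X (g d)
  rw [map_sub, rename_X, rename_X]

/-- The two algebra maps agree on generators modulo the annihilator of `W`, hence everywhere modulo
it. -/
theorem smul_eq_smul_of_adjoin_eq_top {P A W : Type} [CommRing P] [Algebra ℚ P] [CommRing A]
    [Algebra ℚ A] [AddCommGroup W] [Module A W] {s : Set P} (hs : Algebra.adjoin ℚ s = ⊤)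
    (φ ψ : P →ₐ[ℚ] A) (h : ∀ f ∈ s, φ f - ψ f ∈ Module.annihilator A W) (f : P) (x : W) :
    φ f • x = ψ f • x := by
  have h1 : (Ideal.Quotient.mkₐ ℚ (Module.annihilator A W)).comp φ =
      (Ideal.Quotient.mkₐ ℚ (Module.annihilator A W)).comp ψ :=
    AlgHom.ext_of_adjoin_eq_top hs fun f hf => Ideal.Quotient.eq.2 (h f hf)
  have h2 := Module.mem_annihilator.1 (Ideal.Quotient.eq.1 (AlgHom.congr_fun h1 f)) x
  rw [sub_smul] at h2
  exact sub_eq_zero.1 h2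

namespace ClosedBraid

variable (B : ClosedBraid)

instance : Finite B.Edge := Quot.finite _

instance : Finite B.Comp := Quot.finite _

instance : Nonempty B.Edge := ⟨Quot.mk _ (0, 0)⟩

instance : Nonempty B.Comp := ⟨Quot.mk _ (0, 0)⟩

theorem rho_mem_polyPiece (c : B.Crossing) : B.rho c ∈ polyPiece B.Edge 2 :=
  Submodule.sub_mem _ (Submodule.sub_mem _ (Submodule.add_mem _ (X_mem_polyPiece _)
    (X_mem_polyPiece _)) (X_mem_polyPiece _)) (X_mem_polyPiece _)

theorem cube_isGraded : B.cube.IsGraded B.edgePiece := by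
  refine CubeData.IsGraded.of_quotient (polyPiece_isConnectedGraded B.Edge) (d := 2) ?_ B.cube
    (fun c => ⟨_, ?_, rfl⟩) (fun c => ⟨_, ?_, rfl⟩)
  · rintro _ ⟨c, rfl⟩
    exact B.rho_mem_polyPiece c
  · exact Submodule.sub_mem _ (X_mem_polyPiece _) (X_mem_polyPiece _)
  · exact Submodule.sub_mem _ (X_mem_polyPiece _) (X_mem_polyPiece _)

theorem redCube_isGraded : B.redCube.IsGraded B.redEdgePiece := by
  refine CubeData.IsGraded.of_quotient (redPoly_isRegularGraded B.Edge).toIsConnectedGraded (d := 2)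
    ?_ B.redCube (fun c => ⟨_, redPoly.diff_mem_redPolyPiece _ _, rfl⟩)
    (fun c => ⟨_, redPoly.diff_mem_redPolyPiece _ _, rfl⟩)
  rintro f ⟨c, hc⟩
  change (f : MvPolynomial B.Edge ℚ) ∈ polyPiece B.Edge 2
  rw [hc]
  exact B.rho_mem_polyPiece c

variable {B}

theorem toEdge_mem_edgePiece (e : B.Marking) {i : ℤ} {f : B.RB} (hf : f ∈ polyPiece B.Comp i) :
    B.toEdge e f ∈ B.edgePiece i :=
  ⟨_, rename_mem_polyPiece e.1 hf, rfl⟩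

theorem toRedEdge_mem_redEdgePiece (e : B.Marking) {i : ℤ} {f : B.RBr}
    (hf : f ∈ redPolyPiece B.Comp i) : B.toRedEdge e f ∈ B.redEdgePiece i :=
  ⟨_, rename_mem_polyPiece e.1 hf, rfl⟩

instance : IsNoetherianRing B.EdgeRing := inferInstance

instance : IsNoetherianRing B.RedEdgeRing :=
  have := (redPoly_isRegularGraded B.Edge).noetherian
  inferInstance

/-! ### The action of the edge ring on the homology -/

/-- An equivalence relation on the edges that identifies the two edges of each strand through each
crossing identifies all edges of a component. -/
theorem rel_of_compOf_eq {E : B.Edge → B.Edge → Prop} (hE : Equivalence E)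
    (h₁ : ∀ c, E (B.outR c) (B.inL c)) (h₂ : ∀ c, E (B.outL c) (B.inR c)) {x y : B.Edge}
    (h : B.compOf x = B.compOf y) : E x y := by
  obtain ⟨x, rfl⟩ := Quot.exists_rep x
  obtain ⟨y, rfl⟩ := Quot.exists_rep y
  replace h : Quot.mk B.StrandRel x = Quot.mk B.StrandRel y := h
  have h' := Quot.eqvGen_exact (r := B.StrandRel) h
  clear h
  induction h' with
  | rel x y hxy =>
    rcases hxy with ⟨c, i⟩ | ⟨i⟩
    · by_cases hl : i = B.left c
      · subst hl
        rw [Equiv.swap_apply_left]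
        exact hE.symm (h₁ c)
      · by_cases hr : i = B.right c
        · subst hr
          rw [Equiv.swap_apply_right]
          exact hE.symm (h₂ c)
        · rw [Equiv.swap_apply_of_ne_of_ne hl hr, Quot.sound (EdgeRel.pass c i hl hr)]
          exact hE.refl _
    · rw [Quot.sound (EdgeRel.close i)]
      exact hE.refl _
  | refl x => exact hE.refl _
  | symm x y _ h => exact hE.symm h
  | trans x y z _ _ h h' => exact hE.trans h h'

theorem compOf_marking (e : B.Marking) (x : B.Edge) : B.compOf (e.1 (B.compOf x)) = B.compOf x :=
  e.2 _

theorem exists_toEdge_smul_eq (e : B.Marking) (b : B.EdgeRing) :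
    ∃ r : B.RB, ∀ x : B.cube.HH, b • x = B.toEdge e r • x := by
  let J : Ideal B.EdgeRing := Module.annihilator B.EdgeRing B.cube.HH
  let q : MvPolynomial B.Edge ℚ →ₐ[ℚ] B.EdgeRing := Ideal.Quotient.mkₐ ℚ B.edgeIdeal
  have h₁ : ∀ c, q (X (B.outR c)) - q (X (B.inL c)) ∈ J := fun c => by
    rw [← map_sub]
    exact Module.mem_annihilator.2 (B.cube.t_smul_HH c)
  have hq : ∀ x y : B.Edge, B.compOf x = B.compOf y → q (X x) - q (X y) ∈ J := by
    intro x y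
    refine rel_of_compOf_eq (E := fun x y => q (X x) - q (X y) ∈ J)
      ⟨fun _ => by simp, fun h => by simpa using J.neg_mem h,
        fun h h' => by simpa using J.add_mem h h'⟩ h₁ fun c => ?_
    have h₂ : q (B.rho c) = 0 :=
      Ideal.Quotient.eq_zero_iff_mem.2 (Ideal.subset_span ⟨c, rfl⟩)
    rw [rho, map_sub, map_sub, map_add] at h₂
    have h₃ : q (X (B.outL c)) - q (X (B.inR c)) = -(q (X (B.outR c)) - q (X (B.inL c))) := by
      linear_combination h₂
    rw [h₃]
    exact J.neg_mem (h₁ c)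
  obtain ⟨f, rfl⟩ := Ideal.Quotient.mk_surjective b
  refine ⟨rename B.compOf f, fun x => ?_⟩
  refine smul_eq_smul_of_adjoin_eq_top adjoin_range_X q ((B.toEdge e).comp (rename B.compOf)) ?_ f x
  rintro _ ⟨x, rfl⟩
  have h₂ : B.toEdge e (rename B.compOf (X x)) = q (X (e.1 (B.compOf x))) := by
    change q (rename e.1 (rename B.compOf (X x))) = _
    rw [rename_X, rename_X]
  rw [AlgHom.comp_apply, h₂]
  exact hq _ _ (compOf_marking e x).symm

theorem mk_diff_mem_annihilator {x y : B.Edge} (hxy : B.compOf x = B.compOf y) :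
    Ideal.Quotient.mkₐ ℚ B.redEdgeIdeal (redPoly.diff x y) ∈
      Module.annihilator B.RedEdgeRing B.redCube.HH := by
  set J := Module.annihilator B.RedEdgeRing B.redCube.HH with hJ
  set q := Ideal.Quotient.mkₐ ℚ B.redEdgeIdeal with hq
  have h₁ : ∀ c, q (redPoly.diff (B.outR c) (B.inL c)) ∈ J := fun c =>
    Module.mem_annihilator.2 (B.redCube.t_smul_HH c)
  have hadd : ∀ x y z : B.Edge, redPoly.diff x y + redPoly.diff y z = redPoly.diff x z :=
    fun x y z => Subtype.ext (sub_add_sub_cancel _ _ _)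
  have hself : ∀ x : B.Edge, redPoly.diff x x = 0 := fun x => Subtype.ext (sub_self _)
  have hneg : ∀ x y : B.Edge, redPoly.diff x y = -redPoly.diff y x :=
    fun x y => Subtype.ext (neg_sub _ _).symm
  have h₂ : ∀ c, q (redPoly.diff (B.outL c) (B.inR c) + redPoly.diff (B.outR c) (B.inL c)) = 0 := by
    intro c
    have h₃ : ((redPoly.diff (B.outL c) (B.inR c) + redPoly.diff (B.outR c) (B.inL c) :
        redPoly B.Edge) : MvPolynomial B.Edge ℚ) = B.rho c := by
      change (X (B.outL c) - X (B.inR c)) + (X (B.outR c) - X (B.inL c)) = B.rho c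
      rw [rho]
      ring
    have h₄ : redPoly.diff (B.outL c) (B.inR c) + redPoly.diff (B.outR c) (B.inL c) ∈
        B.redEdgeIdeal := Ideal.subset_span ⟨c, h₃⟩
    exact Ideal.Quotient.eq_zero_iff_mem.2 h₄
  clear_value q J
  refine rel_of_compOf_eq (E := fun x y => q (redPoly.diff x y) ∈ J)
    ⟨fun x => by rw [hself, map_zero]; exact J.zero_mem,
      fun h => by rw [hneg, map_neg]; exact J.neg_mem h,
      fun h h' => by rw [← hadd, map_add]; exact J.add_mem h h'⟩ h₁ (fun c => ?_) hxy
  have h₅ := h₂ c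
  rw [map_add] at h₅
  rw [eq_neg_of_add_eq_zero_left h₅]
  exact J.neg_mem (h₁ c)

/-- Moving both ends to the marked edges changes the difference by two differences along single
components, each of which acts by zero. -/
theorem mk_sub_toRedEdge_mem_annihilator (e : B.Marking) (c d : B.Edge) :
    Ideal.Quotient.mkₐ ℚ B.redEdgeIdeal (redPoly.diff c d) -
      (B.toRedEdge e).comp (redRename B.compOf) (redPoly.diff c d) ∈
        Module.annihilator B.RedEdgeRing B.redCube.HH := by
  have h₁ := mk_diff_mem_annihilator (compOf_marking e c).symm
  have h₂ := mk_diff_mem_annihilator (compOf_marking e d).symm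
  have h₃ : (B.toRedEdge e).comp (redRename B.compOf) (redPoly.diff c d) =
      Ideal.Quotient.mkₐ ℚ B.redEdgeIdeal (redPoly.diff (e.1 (B.compOf c)) (e.1 (B.compOf d))) := by
    rw [AlgHom.comp_apply, redRename_diff]
    exact congrArg (Ideal.Quotient.mkₐ ℚ B.redEdgeIdeal) (redRename_diff _ _ _)
  have h₄ : redPoly.diff c d - redPoly.diff (e.1 (B.compOf c)) (e.1 (B.compOf d)) =
      redPoly.diff c (e.1 (B.compOf c)) - redPoly.diff d (e.1 (B.compOf d)) :=
    Subtype.ext (sub_sub_sub_comm _ _ _ _)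
  rw [h₃]
  generalize Module.annihilator B.RedEdgeRing B.redCube.HH = J at *
  generalize Ideal.Quotient.mkₐ ℚ B.redEdgeIdeal = q at *
  rw [← map_sub, h₄, map_sub]
  exact J.sub_mem h₁ h₂

theorem exists_toRedEdge_smul_eq (e : B.Marking) (b : B.RedEdgeRing) :
    ∃ r : B.RBr, ∀ x : B.redCube.HH, b • x = B.toRedEdge e r • x := by
  obtain ⟨f, rfl⟩ := Ideal.Quotient.mk_surjective b
  refine ⟨redRename B.compOf f, fun x => ?_⟩
  have h := smul_eq_smul_of_adjoin_eq_top (P := redPoly B.Edge) (A := B.RedEdgeRing)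
    (W := B.redCube.HH) redPoly.adjoin_diff (Ideal.Quotient.mkₐ ℚ B.redEdgeIdeal)
    ((B.toRedEdge e).comp (redRename B.compOf)) (by
      rintro _ ⟨c, d, rfl⟩
      exact mk_sub_toRedEdge_mem_annihilator e c d) f x
  exact h

end ClosedBraid

end HOMFLYPT

end

noncomputable section

namespace HOMFLYPT

/-! ## Betti polynomials -/

/-- The coefficient of `y^q a^j b^l`, where `g = (j, l)`. -/
def coeffAt (q : ℤ) (g : ℤ × ℚ) : CoeffRing →+ ℤ where
  toFun x := (x.coeff q).coeff g
  map_zero' := rfl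
  map_add' _ _ := rfl

theorem ySeries_coeff_eq_natCast (m q : ℤ) : ∃ n : ℕ, (ySeries m).coeff q = (n : ℕ) := by
  by_cases hq : ∃ d : ℕ, (d : ℤ) = q
  · obtain ⟨d, rfl⟩ := hq
    rw [ySeries, LaurentSeries.coeff_coe_powerSeries, PowerSeries.coeff_mk]
    split_ifs
    · exact ⟨_, rfl⟩
    · exact ⟨0, Nat.cast_zero.symm⟩
  · refine ⟨0, ?_⟩
    rw [Nat.cast_zero, ySeries, HahnSeries.ofPowerSeries_apply]
    refine HahnSeries.embDomain_of_notMem_range ?_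
    rintro ⟨d, hd⟩
    exact hq ⟨d, hd⟩

theorem ySeries_coeff_zero {m : ℤ} (hm : 0 ≤ m) : (ySeries m).coeff 0 = 1 := by
  have h := LaurentSeries.coeff_coe_powerSeries (PowerSeries.mk fun d => if Even d then
    (bn ((d / 2 : ℕ) + m - 1) (d / 2 : ℕ) : AddMonoidAlgebra ℤ (ℤ × ℚ)) else 0) 0
  rw [Nat.cast_zero] at h
  rw [ySeries, h, PowerSeries.coeff_mk, if_pos (Even.zero)]
  refine (congrArg Nat.cast ?_).trans Nat.cast_one
  rw [bn, Nat.zero_div, Nat.cast_zero, zero_add]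
  -- For m = 0, the reduced case of a knot, the convention `bn (-1) 0 = 1` supplies the constant
  -- term.
  by_cases h1 : m = 0
  · subst h1
    rfl
  · rw [if_pos (by omega), Int.toNat_zero, Nat.choose_zero_right]

theorem coeffAt_bettiTerm_nonneg (m q j k q' : ℤ) (g : ℤ × ℚ) :
    0 ≤ coeffAt q' g (bettiTerm m q j k) := by
  obtain ⟨n, hn⟩ := ySeries_coeff_eq_natCast m (q' - q)
  change 0 ≤ ((bettiTerm m q j k).coeff q').coeff g
  rw [bettiTerm, HahnSeries.coeff_single_mul, hn, AddMonoidAlgebra.natCast_def,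
    AddMonoidAlgebra.single_mul_single, AddMonoidAlgebra.coeff_single, Finsupp.single_apply]
  split_ifs
  · simp
  · exact le_rfl

theorem coeffAt_bettiTerm_self {m : ℤ} (hm : 0 ≤ m) (q j k : ℤ) :
    coeffAt q (j, ((k - j : ℤ) : ℚ) / 2) (bettiTerm m q j k) = 1 := by
  change ((bettiTerm m q j k).coeff q).coeff _ = 1
  rw [bettiTerm, HahnSeries.coeff_single_mul, sub_self, ySeries_coeff_zero hm, mul_one,
    AddMonoidAlgebra.coeff_single, Finsupp.single_eq_same]

/-- No cancellation occurs in the Betti polynomial. -/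
theorem bettiPoly_coeff_eq_zero_iff {β : ℕ → ℤ → ℤ → ℤ → ℕ} {m : ℤ} (hm : 0 ≤ m)
    (hβ : {u : ℕ × ℤ × ℤ × ℤ | β u.1 u.2.1 u.2.2.1 u.2.2.2 ≠ 0}.Finite) (p : ℕ) :
    (bettiPoly β m).coeff p = 0 ↔ ∀ q j k, β p q j k = 0 := by
  have h1 : bettiPoly β m = ∑ u ∈ hβ.toFinset, β u.1 u.2.1 u.2.2.1 u.2.2.2 •
      Polynomial.monomial u.1 (bettiTerm m u.2.1 u.2.2.1 u.2.2.2) := by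
    refine finsum_eq_sum_of_support_subset _ fun u hu => ?_
    rw [Set.Finite.coe_toFinset]
    intro h
    exact hu (by simp only [h, zero_smul])
  have h2 : (bettiPoly β m).coeff p = ∑ u ∈ hβ.toFinset, if u.1 = p then
      β u.1 u.2.1 u.2.2.1 u.2.2.2 • bettiTerm m u.2.1 u.2.2.1 u.2.2.2 else 0 := by
    rw [h1, Polynomial.finsetSum_coeff]
    refine Finset.sum_congr rfl fun u _ => ?_
    rw [Polynomial.coeff_smul, Polynomial.coeff_monomial]
    split_ifs
    · rfl
    · rw [smul_zero]
  constructor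
  · intro h q j k
    by_contra hne
    -- A vanishing sum of non-negative integers has vanishing summands; the term of (q, j, k)
    -- contributes its Betti number at its own leading monomial.
    have h3 := congrArg (coeffAt q (j, ((k - j : ℤ) : ℚ) / 2)) h
    rw [h2, map_sum, map_zero, Finset.sum_eq_zero_iff_of_nonneg] at h3
    · have h4 := h3 (p, q, j, k) (hβ.mem_toFinset.2 hne)
      rw [if_pos rfl, map_nsmul, coeffAt_bettiTerm_self hm] at h4
      simp only [nsmul_eq_mul, mul_one, Nat.cast_eq_zero] at h4
      exact hne h4
    · intro u _
      split_ifs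
      · rw [map_nsmul]
        exact nsmul_nonneg (coeffAt_bettiTerm_nonneg _ _ _ _ _ _) _
      · rw [map_zero]
  · intro h
    rw [h2]
    refine Finset.sum_eq_zero fun u _ => ?_
    split_ifs with hu
    · rw [hu, h, zero_smul]
    · rfl

/-! ## Projective dimension and Betti numbers -/

open CategoryTheory

/-- Both sides lie below the same natural numbers, and the degree is a natural number or -∞, which
excludes infinite projective dimension. The bound by 0 settles the case -∞. -/
theorem projectiveDimension_eq_degX {C : Type*} [Category C] [Abelian C] (X : C)
    (P : Polynomial CoeffRing)
    (h : ∀ n : ℕ, HasProjectiveDimensionLT X n ↔ ∀ p, n ≤ p → P.coeff p = 0) :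
    projectiveDimension X = degX P := by
  have h1 : ∀ n : ℕ, projectiveDimension X < n ↔ P.degree < n := fun n => by
    rw [projectiveDimension_lt_iff, h, Polynomial.degree_lt_iff_coeff_zero]
  rw [degX]
  cases hP : P.degree with
  | bot =>
    have h2 := (h1 0).2 (by rw [hP]; exact WithBot.bot_lt_coe _)
    rw [WithBot.map_bot]
    by_contra hne
    obtain ⟨d, hd⟩ := WithBot.ne_bot_iff_exists.1 hne
    rw [← hd] at h2
    exact absurd (WithBot.coe_lt_coe.1 h2) not_lt_zero
  | coe d =>
    have h2 := (h1 (d + 1)).2 (by rw [hP]; exact WithBot.coe_lt_coe.2 (Nat.lt_succ_self d))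
    have h3 := mt (h1 d).1 (by rw [hP]; exact lt_irrefl _)
    rw [WithBot.map_coe]
    refine le_antisymm ?_ (not_lt.1 h3)
    exact projectiveDimension_le_iff _ _ |>.2 (projectiveDimension_lt_iff.1 h2)

namespace CubeData

variable {A : Type} [CommRing A] [Algebra ℚ A] {R : Type} [CommRing R] [Algebra ℚ R]
  {D : CubeData A} {𝒜 : ℤ → Submodule ℚ A} {𝓡 : ℤ → Submodule ℚ R} {𝔪 : Ideal R} {φ : R →ₐ[ℚ] A}

theorem finite_betti_and_projectiveDimension_eq [IsNoetherianRing A] (hR : IsRegularGraded 𝓡 𝔪)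
    (hD : D.IsGraded 𝒜) (hφ : ∀ {i r}, r ∈ 𝓡 i → φ r ∈ 𝒜 i)
    (hact : ∀ b : A, ∃ r : R, ∀ x : D.HH, b • x = φ r • x) (a : ℤ × ℤ × ℤ) {m : ℤ} (hm : 0 ≤ m)
    {β : ℕ → ℤ → ℤ → ℤ → ℕ}
    (hβ : ∀ p q j k, β p q j k = (D.graded 𝒜 φ a j k).betti 𝓡 𝔪 p q) :
    {u : ℕ × ℤ × ℤ × ℤ | β u.1 u.2.1 u.2.2.1 u.2.2.2 ≠ 0}.Finite ∧
      projectiveDimension (D.total φ) = degX (bettiPoly β m) := by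
  have := hR.noetherian
  have hg : ∀ j k, (D.graded 𝒜 φ a j k).IsGraded 𝓡 := graded_isGraded hD hφ a
  have hfin : ∀ j k, Module.Finite R (D.graded 𝒜 φ a j k).carrier := graded_finite hact a
  have hpd : ∀ j k p, (∀ q, β p q j k = 0) ↔
      HasProjectiveDimensionLT (ModuleCat.of R (D.graded 𝒜 φ a j k).carrier) p := fun j k p => by
    simp only [hβ]
    exact GrMod.forall_betti_eq_zero_iff hR.toIsConnectedGraded (hg j k) p
  have hF : {u : ℕ × ℤ × ℤ × ℤ | β u.1 u.2.1 u.2.2.1 u.2.2.2 ≠ 0}.Finite := by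
    obtain ⟨N, hN⟩ := hR.exists_pd_le
    have h1 : {w : ℤ × ℤ | D.hhPart (w.1 - a.2.1) (w.2 - a.2.2) ≠ ⊥}.Finite :=
      D.finite_hhPart_ne_bot.preimage (f := fun w : ℤ × ℤ => (w.1 - a.2.1, w.2 - a.2.2))
        (fun w _ w' _ h => Prod.ext (sub_left_injective (congrArg Prod.fst h))
          (sub_left_injective (congrArg Prod.snd h)))
    have h2 : ∀ v ∈ Set.Iio (N + 1) ×ˢ {w : ℤ × ℤ | D.hhPart (w.1 - a.2.1) (w.2 - a.2.2) ≠ ⊥},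
        ((fun q => (v.1, q, v.2)) '' {q | β v.1 q v.2.1 v.2.2 ≠ 0}).Finite := fun v _ => by
      refine Set.Finite.image _ ?_
      simp only [hβ]
      exact GrMod.finite_betti_ne_zero hR.toIsConnectedGraded (hg _ _) _
    -- `N` from the syzygy theorem bounds p, the non-zero parts bound (j, k), and finite-dimensional
    -- Tor bounds q for each (p, j, k).
    refine (((Set.finite_Iio (N + 1)).prod h1).biUnion h2).subset ?_
    rintro ⟨p, q, j, k⟩ hu
    refine Set.mem_biUnion (x := (p, j, k)) ⟨?_, fun hbot => ?_⟩ ⟨q, hu, rfl⟩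
    · by_contra hp
      have := hN (D.graded 𝒜 φ a j k).carrier
      exact hu ((hpd j k p).2 (hasProjectiveDimensionLT_of_ge _ (N + 1) p (not_lt.1 hp)) q)
    · have hs : Subsingleton (D.graded 𝒜 φ a j k).carrier :=
        Submodule.subsingleton_iff_eq_bot.2 hbot
      have h0 : HasProjectiveDimensionLT (ModuleCat.of R (D.graded 𝒜 φ a j k).carrier) 0 :=
        (ModuleCat.isZero_of_subsingleton _).hasProjectiveDimensionLT_zero
      exact hu ((hpd j k p).2 (hasProjectiveDimensionLT_of_ge _ 0 p (Nat.zero_le p)) q)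
  refine ⟨hF, projectiveDimension_eq_degX _ _ fun n => ?_⟩
  rw [total_hasProjectiveDimensionLT_iff a n (𝒜 := 𝒜)]
  simp only [bettiPoly_coeff_eq_zero_iff hm hF]
  constructor
  · intro h p hp q j k
    have := h j k
    exact (hpd j k p).2 (hasProjectiveDimensionLT_of_ge _ n p hp) q
  · intro h j k
    exact (hpd j k n).1 fun q => h n le_rfl q j k

end CubeData

end HOMFLYPT

end

theorem lemma1p6 (B : HOMFLYPT.ClosedBraid) (e : B.Marking) :
    ({u : ℕ × ℤ × ℤ × ℤ | B.beta e u.1 u.2.1 u.2.2.1 u.2.2.2 ≠ 0}.Finite ∧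
      CategoryTheory.projectiveDimension (B.H e) = HOMFLYPT.degX (B.P e)) ∧
    ({u : ℕ × ℤ × ℤ × ℤ | B.betaR e u.1 u.2.1 u.2.2.1 u.2.2.2 ≠ 0}.Finite ∧
      CategoryTheory.projectiveDimension (B.Hr e) = HOMFLYPT.degX (B.Pr e)) := by
  -- Ensures that the exponent `numComp - 1` of the reduced series is non-negative.
  have h : 0 < B.numComp := Nat.card_pos
  constructor
  · exact HOMFLYPT.CubeData.finite_betti_and_projectiveDimension_eq
      (HOMFLYPT.polyPiece_isRegularGraded B.Comp) B.cube_isGraded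
      (HOMFLYPT.ClosedBraid.toEdge_mem_edgePiece e)
      (HOMFLYPT.ClosedBraid.exists_toEdge_smul_eq e) _ (by omega) (fun _ _ _ _ => rfl)
  · exact HOMFLYPT.CubeData.finite_betti_and_projectiveDimension_eq
      (HOMFLYPT.redPoly_isRegularGraded B.Comp) B.redCube_isGraded
      (HOMFLYPT.ClosedBraid.toRedEdge_mem_redEdgePiece e)
      (HOMFLYPT.ClosedBraid.exists_toRedEdge_smul_eq e) _ (by omega) (fun _ _ _ _ => rfl)
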